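/- Let $p$ be a prime, $\mathbb K$ a field of characteristic $p$, and let a split torus $T=\mathbb G_m^k$ act faithfully and diagonally on $\mathbb A^n$, with weights $w_1,\dots,w_n\in X^*(T)=\mathbb Z^k$ (faithfulness means that the $w_i$ generate $\mathbb Z^k$). Let $D=\mathbb G_m^n$ be the full diagonal torus, $G=D/T$, and fix $\lambda\in\mathbb Z^k=X^*(T)$. *The algebra $A^\lambda$.* Let $W$ be the Weyl algebra over $\mathbb K$ on $z_i,\partial_i$ ($1\le i\le n$), with $z_i$ of $D$-weight $\epsilon_i$ and $\partial_i$ of $D$-weight $-\epsilon_i$; put $h_i=z_i\partial_i$, and let $A^\lambda_{\mathbb K}=W^T/\langle \sum_i\langle \epsilon_i,\chi\rangle h_i-\lambda(\chi)\mid \chi\in X_*(T)\rangle$. Let $\mathcal C$ be the category of finitely generated $A^\lambda_{\mathbb K}$-modules $M$ with a compatible $D$-action (a grading $M=\bigoplus_{a\in\mathbb Z^n}M_a$) on which $T$ acts by the character $\lambda$ and such that for all $i$, $a$ and $v\in M_a$ one has $(h_i-a_i)^Nv=0$ for $N\gg0$; morphisms are the $A^\lambda_{\mathbb K}$-linear maps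 preserving the grading. Let $A^\lambda_{\mathbb K}\text{-mod}_o^D\subset\mathcal C$ be the full subcategory of modules that are set-theoretically supported at the point $o$ (given by $z=w=0$) when viewed, via $z_i\mapsto z_i^p$, $w_i\mapsto\partial_i^p$, as modules over the ring $\mathbb K[z_1,\dots,z_n,w_1,\dots,w_n]^T$, where $D$ acts on $w_i$ by $-\epsilon_i$. *The modules $Q_a$.* Let $\mathfrak g^{*,\lambda}_{\mathbb Z}=\{a\in\mathbb Z^n\mid \sum_i a_iw_i=\lambda\}$. For $a\in \mathfrak g^{*,\lambda}_{\mathbb Z}$ let $Q_a=\varprojlim_N A^\lambda_{\mathbb K}/\sum_iA^\lambda_{\mathbb K}(h_i-a_i)^N$, with the inverse limit topology and the $D$-action for which the image $1_a$ of $1$ has weight $a$. Homomorphisms from $Q_a$ are continuous, $A^\lambda_{\mathbb K}$-linear and compatible with $D$; objects of $\mathcal C$ are discrete. For $x\in\mathbb Z^n$ let $\Delta_x=\{a\in\mathfrak g^{*,\lambda}_{\mathbb Z}\mid px_i\le a_i<px_i+p \text{ for all } i\}$, and let $\Lambda(\lambda)=\{x\mid\Delta_x\ne\emptyset\}$. For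 each $x\in\Lambda(\lambda)$ choose $b_x\in\Delta_x$ and put $P_x=Q_{b_x}$. *The algebra $H^\lambda$.* Let $S=\operatorname{Sym}_{\mathbb K}(\mathfrak g_{\mathbb K})=\mathbb K[s_1,\dots,s_n]/\langle\sum_i\langle\epsilon_i,\chi\rangle s_i\mid\chi\in X_*(T)\rangle$. Let $H^\lambda_{\mathbb K}$ be the (locally unital) $S$-algebra generated by elements $c_{x,y}$ ($x,y\in\Lambda(\lambda)$), with orthogonal idempotents $1_x=c_{x,x}$ and $c_{x,y}=1_xc_{x,y}1_y$, modulo $$c_{x,y}c_{y,u}=\prod_i s_i^{\eta_i(x,y,u)}c_{x,u},\qquad \eta_i(x,y,u)=\tfrac12\bigl(|x_i-y_i|+|y_i-u_i|-|x_i-u_i|\bigr).$$ An $H^\lambda_{\mathbb K}$-module $N$ is required to satisfy $N=\sum_x1_xN$. For $a\in\mathfrak g^{*,\lambda}_{\mathbb Z}$ and $\beta\in\mathbb Z^n$ with $\sum_i\beta_iw_i=0$ put $$c_a^\beta=\prod_{\beta_i>0}z_i^{\beta_i}\prod_{\beta_i<0}\partial_i^{-\beta_i}\cdot\prod_i\prod_{j=1}^{\beta_i}q(h_i-a_i,a_i+j)\cdot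 1_a\in Q_a,$$ where $q(y,c)=1/(y+c)\in\mathbb K[[y]]$ if $c\neq0$ in $\mathbb K$, $q(y,0)=1$, and empty products (in particular those with $\beta_i\le0$) are $1$. **Theorem.** 1. For $x,y\in\Lambda(\lambda)$ there is a homomorphism $\gamma_{x,y}\colon P_x\to P_y$ sending the generator $1_{b_x}$ of $P_x$ to $c_{b_y}^{b_x-b_y}$. Composition with the $\gamma_{x,y}$ (so that $c_{x,y}\cdot\varphi=\varphi\circ\gamma_{x,y}$ for $\varphi\in\operatorname{Hom}(P_y,M)$), together with the action of $s_i$ by $h_i-a_i$ on values on vectors of weight $a$, makes $\bigoplus_{x\in\Lambda(\lambda)}\operatorname{Hom}(P_x,M)$ an $H^\lambda_{\mathbb K}$-module, functorially in $M\in\mathcal C$. If $M$ lies in $A^\lambda_{\mathbb K}\text{-mod}_o^D$, only finitely many of the spaces $\operatorname{Hom}(P_x,M)$ are nonzero, so this module is $\operatorname{Hom}(\bigoplus_xP_x,M)$. 2. The functor $\operatorname{Hom}(\bigoplus_{x\in\Lambda(\lambda)}P_x,-)$ is an equivalence from $A^\lambda_{\mathbb K}\text{-mod}_o^D$ to the category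 of finite-dimensional $H^\lambda_{\mathbb K}$-modules on which each $s_i$ acts nilpotently. 3. The functor $\bigoplus_{x\in\Lambda(\lambda)}\operatorname{Hom}(P_x,-)$ is an equivalence from $\mathcal C$ (no condition on the support) to the category of finitely generated $H^\lambda_{\mathbb K}$-modules on which each $s_i$ acts nilpotently. 4. For $a,a'\in\mathfrak g^{*,\lambda}_{\mathbb Z}$, one has $Q_a\cong Q_{a'}$ (as topological $A^\lambda_{\mathbb K}$-modules with $D$-action) if and only if $a,a'\in\Delta_x$ for some $x\in\mathbb Z^n$. -/

import Mathlib

open CategoryTheory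

universe u

namespace Hypertoric

noncomputable section

/-! Throughout, the torus `T = 𝔾ₘᵏ` acts diagonally on affine `n`-space; `w i ∈ X*(T) = ℤᵏ` is the
weight of the `i`-th coordinate line, that is, the restriction to `T` of the coordinate character
`εᵢ` of the diagonal torus `D = 𝔾ₘⁿ`.  The action is faithful iff the `w i` generate `ℤᵏ`.
Actions of split tori are gradings by the character lattice, equivalently coactions of its group
algebra. -/

/-! ### The Weyl algebra -/

/-- Relations of the Weyl algebra; `Sum.inl i` stands for `zᵢ` and `Sum.inr i` for `∂ᵢ`. -/
inductive WeylRel (K : Type u) [Field K] (n : ℕ) :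
    FreeAlgebra K (Fin n ⊕ Fin n) → FreeAlgebra K (Fin n ⊕ Fin n) → Prop
  | zz (i j : Fin n) : WeylRel K n
      (FreeAlgebra.ι K (Sum.inl i) * FreeAlgebra.ι K (Sum.inl j))
      (FreeAlgebra.ι K (Sum.inl j) * FreeAlgebra.ι K (Sum.inl i))
  | dd (i j : Fin n) : WeylRel K n
      (FreeAlgebra.ι K (Sum.inr i) * FreeAlgebra.ι K (Sum.inr j))
      (FreeAlgebra.ι K (Sum.inr j) * FreeAlgebra.ι K (Sum.inr i))
  | dz (i j : Fin n) : WeylRel K n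
      (FreeAlgebra.ι K (Sum.inr i) * FreeAlgebra.ι K (Sum.inl j))
      (FreeAlgebra.ι K (Sum.inl j) * FreeAlgebra.ι K (Sum.inr i) + if i = j then 1 else 0)

/-- The Weyl algebra in `n` variables over `K`. -/
abbrev Weyl (K : Type u) [Field K] (n : ℕ) : Type u := RingQuot (WeylRel K n)

section WeylAlgebra

variable (K : Type u) [Field K] {n : ℕ}

/-- The generator `zᵢ`. -/
def z (i : Fin n) : Weyl K n := RingQuot.mkAlgHom K (WeylRel K n) (FreeAlgebra.ι K (Sum.inl i))

/-- The generator `∂ᵢ`. -/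
def d (i : Fin n) : Weyl K n := RingQuot.mkAlgHom K (WeylRel K n) (FreeAlgebra.ι K (Sum.inr i))

theorem z_mul_z (i j : Fin n) : z K i * z K j = z K j * z K i := by
  have := RingQuot.mkAlgHom_rel K (WeylRel.zz (K := K) i j)
  simp only [map_mul] at this
  exact this

theorem d_mul_d (i j : Fin n) : d K i * d K j = d K j * d K i := by
  have := RingQuot.mkAlgHom_rel K (WeylRel.dd (K := K) i j)
  simp only [map_mul] at this
  exact this

theorem d_mul_z (i j : Fin n) : d K i * z K j = z K j * d K i + if i = j then 1 else 0 := by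
  have := RingQuot.mkAlgHom_rel K (WeylRel.dz (K := K) i j)
  simp only [map_mul, map_add] at this
  refine this.trans ?_
  split_ifs <;> simp [z, d]

/-- The ordered monomial `z^α ∂^β`. -/
def zdMonomial (α β : Fin n → ℕ) : Weyl K n :=
  ((List.finRange n).map fun i => z K i ^ α i).prod *
    ((List.finRange n).map fun i => d K i ^ β i).prod

/-- The coaction on the Weyl algebra of the torus with character group `Γ` for which `zᵢ` has
weight `wt i` and `∂ᵢ` has weight `-wt i`. -/
def coaction {Γ : Type} [AddCommGroup Γ] (wt : Fin n → Γ) :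
    Weyl K n →ₐ[K] AddMonoidAlgebra (Weyl K n) Γ :=
  RingQuot.liftAlgHom K
    ⟨FreeAlgebra.lift K (Sum.elim (fun i => AddMonoidAlgebra.single (wt i) (z K i))
      (fun i => AddMonoidAlgebra.single (-wt i) (d K i))), by
      intro x y hxy
      cases hxy with
      | zz i j =>
        simp only [map_mul, FreeAlgebra.lift_ι_apply, Sum.elim_inl,
          AddMonoidAlgebra.single_mul_single]
        rw [z_mul_z, add_comm]
      | dd i j =>
        simp only [map_mul, FreeAlgebra.lift_ι_apply, Sum.elim_inr,
          AddMonoidAlgebra.single_mul_single]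
        rw [d_mul_d, add_comm]
      | dz i j =>
        simp only [map_mul, map_add, FreeAlgebra.lift_ι_apply, Sum.elim_inr, Sum.elim_inl,
          AddMonoidAlgebra.single_mul_single]
        rw [d_mul_z, AddMonoidAlgebra.single_add, add_comm (-wt i) (wt j)]
        congr 1
        split_ifs with h
        · subst h
          simp [AddMonoidAlgebra.one_def]
        · simp⟩

/-- The elements of weight `γ` in the Weyl algebra. -/
def weylWeight {Γ : Type} [AddCommGroup Γ] (wt : Fin n → Γ) (γ : Γ) : Submodule K (Weyl K n) where
  carrier := {x | coaction K wt x = AddMonoidAlgebra.single γ x}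
  add_mem' := by
    intro a b ha hb
    simp only [Set.mem_ofPred_eq] at *
    rw [map_add, ha, hb, AddMonoidAlgebra.single_add]
  zero_mem' := by simp
  smul_mem' := by
    intro c x hx
    simp only [Set.mem_ofPred_eq] at *
    rw [map_smul, hx, AddMonoidAlgebra.smul_single]

theorem z_mem {Γ : Type} [AddCommGroup Γ] (wt : Fin n → Γ) (i : Fin n) :
    z K i ∈ weylWeight K wt (wt i) := by
  change coaction K wt (z K i) = _
  simp [coaction, z, RingQuot.liftAlgHom_mkAlgHom_apply]

theorem d_mem {Γ : Type} [AddCommGroup Γ] (wt : Fin n → Γ) (i : Fin n) :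
    d K i ∈ weylWeight K wt (-wt i) := by
  change coaction K wt (d K i) = _
  simp [coaction, d, RingQuot.liftAlgHom_mkAlgHom_apply]

theorem one_mem_weylWeight {Γ : Type} [AddCommGroup Γ] (wt : Fin n → Γ) :
    (1 : Weyl K n) ∈ weylWeight K wt 0 := by
  change coaction K wt 1 = _
  rw [map_one, AddMonoidAlgebra.one_def]

theorem mul_mem_weylWeight {Γ : Type} [AddCommGroup Γ] {wt : Fin n → Γ} {γ δ : Γ} {x y : Weyl K n}
    (hx : x ∈ weylWeight K wt γ) (hy : y ∈ weylWeight K wt δ) :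
    x * y ∈ weylWeight K wt (γ + δ) := by
  change coaction K wt _ = _ at *
  rw [map_mul, hx, hy, AddMonoidAlgebra.single_mul_single]

theorem pow_mem_weylWeight {Γ : Type} [AddCommGroup Γ] {wt : Fin n → Γ} {γ : Γ} {x : Weyl K n}
    (hx : x ∈ weylWeight K wt γ) (m : ℕ) : x ^ m ∈ weylWeight K wt (m • γ) := by
  induction m with
  | zero => simpa using one_mem_weylWeight K wt
  | succ m ih => rw [pow_succ, succ_nsmul]; exact mul_mem_weylWeight K ih hx

theorem list_prod_mem_weylWeight {Γ : Type} [AddCommGroup Γ] {wt : Fin n → Γ}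
    {f : Fin n → Weyl K n} {g : Fin n → Γ} (h : ∀ i, f i ∈ weylWeight K wt (g i))
    (l : List (Fin n)) : (l.map f).prod ∈ weylWeight K wt (l.map g).sum := by
  induction l with
  | nil => simpa using one_mem_weylWeight K wt
  | cons i l ih =>
    simp only [List.map_cons, List.prod_cons, List.sum_cons]
    exact mul_mem_weylWeight K (h i) ih

theorem zdMonomial_mem {Γ : Type} [AddCommGroup Γ] (wt : Fin n → Γ) (α β : Fin n → ℕ) :
    zdMonomial K α β ∈ weylWeight K wt (∑ i, ((α i : ℤ) - (β i : ℤ)) • wt i) := by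
  have h1 := list_prod_mem_weylWeight K (fun i => pow_mem_weylWeight K (z_mem K wt i) (α i))
    (List.finRange n)
  have h2 := list_prod_mem_weylWeight K (fun i => pow_mem_weylWeight K (d_mem K wt i) (β i))
    (List.finRange n)
  have h3 := mul_mem_weylWeight K h1 h2
  rw [← Fin.sum_univ_def, ← Fin.sum_univ_def, ← Finset.sum_add_distrib] at h3
  change _ * _ ∈ _
  convert h3 using 2
  refine Finset.sum_congr rfl fun i _ => ?_
  rw [sub_smul, smul_neg, natCast_zsmul, natCast_zsmul, sub_eq_add_neg]

theorem zd_mul_comm (i j : Fin n) :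
    (z K i * d K i) * (z K j * d K j) = (z K j * d K j) * (z K i * d K i) := by
  by_cases h : i = j
  · subst h; rfl
  · have e1 : d K i * z K j = z K j * d K i := by rw [d_mul_z, if_neg h, add_zero]
    have e2 : d K j * z K i = z K i * d K j := by rw [d_mul_z, if_neg (Ne.symm h), add_zero]
    calc (z K i * d K i) * (z K j * d K j) = z K i * (d K i * z K j) * d K j := by
          simp only [mul_assoc]
      _ = (z K i * z K j) * (d K i * d K j) := by rw [e1]; simp only [mul_assoc]
      _ = (z K j * z K i) * (d K j * d K i) := by rw [z_mul_z, d_mul_d]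
      _ = z K j * (z K i * d K j) * d K i := by simp only [mul_assoc]
      _ = _ := by rw [← e2]; simp only [mul_assoc]

end WeylAlgebra

/-! ### The hypertoric enveloping algebra and its central quotients -/

section HypertoricEnvelopingAlgebra

variable (K : Type u) [Field K] {n k : ℕ} (w : Fin n → Fin k → ℤ) (lam : Fin k → ℤ)

/-- The hypertoric enveloping algebra: the `T`-invariants of the Weyl algebra. -/
def HEA : Subalgebra K (Weyl K n) :=
  AlgHom.equalizer (coaction K w) AddMonoidAlgebra.singleZeroAlgHom

theorem mem_HEA {x : Weyl K n} : x ∈ HEA K w ↔ x ∈ weylWeight K w 0 := Iff.rfl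

/-- `hᵢ⁺ = zᵢ ∂ᵢ`. -/
def hPlus (i : Fin n) : HEA K w :=
  ⟨z K i * d K i, by
    have := mul_mem_weylWeight K (z_mem K w i) (d_mem K w i)
    rwa [add_neg_cancel] at this⟩

/-- The relations `μ_q(χ) = λ(χ)`, where `χ` runs over the cocharacters of `T` and
`μ_q(χ) = ∑ᵢ ⟨εᵢ, χ⟩ hᵢ⁺`. -/
inductive HEARel : HEA K w → HEA K w → Prop
  | moment (χ : Fin k → ℤ) :
    HEARel (∑ i, (∑ j, w i j * χ j) • hPlus K w i) ((∑ j, lam j * χ j) • (1 : HEA K w))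

/-- The central quotient `A^λ` of the hypertoric enveloping algebra. -/
def HEAQuot : Type u := RingQuot (HEARel K w lam)

instance : Semiring (HEAQuot K w lam) :=
  inferInstanceAs (Semiring (RingQuot (HEARel K w lam)))

instance : Algebra K (HEAQuot K w lam) :=
  inferInstanceAs (Algebra K (RingQuot (HEARel K w lam)))

instance : Ring (HEAQuot K w lam) := Algebra.semiringToRing K

/-- The quotient map. -/
def toQuot : HEA K w →ₐ[K] HEAQuot K w lam := RingQuot.mkAlgHom K (HEARel K w lam)

/-- The image of `hᵢ⁺` in `A^λ`. -/
def h (i : Fin n) : HEAQuot K w lam := toQuot K w lam (hPlus K w i)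

theorem h_commute (i j : Fin n) : Commute (h K w lam i) (h K w lam j) := by
  change h K w lam i * h K w lam j = h K w lam j * h K w lam i
  rw [h, h, ← map_mul, ← map_mul]
  congr 1
  exact Subtype.ext (zd_mul_comm K i j)

/-- The `D`-weight space `A^λ[b]`; `zᵢ` has weight `εᵢ`, and `∂ᵢ` has weight `-εᵢ`. -/
def quotWeight (b : Fin n → ℤ) : Submodule K (HEAQuot K w lam) :=
  ((weylWeight K (fun i : Fin n => (Pi.single i 1 : Fin n → ℤ)) b).comap
    (HEA K w).val.toLinearMap).map (toQuot K w lam).toLinearMap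

/-- The element `m(b) = ∏_{bᵢ > 0} zᵢ^{bᵢ} ∏_{bᵢ < 0} ∂ᵢ^{-bᵢ}` of `A^λ`, for a character `b` of `D`
that is trivial on `T`. -/
def m (b : Fin n → ℤ) (hb : ∑ i, b i • w i = 0) : HEAQuot K w lam :=
  toQuot K w lam
    ⟨zdMonomial K (fun i => (b i).toNat) (fun i => (-b i).toNat), by
      have := zdMonomial_mem K w (fun i => (b i).toNat) (fun i => (-b i).toNat)
      rw [mem_HEA]
      convert this using 2
      rw [← hb]
      refine Finset.sum_congr rfl fun i _ => ?_
      congr 1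
      omega⟩

/-! ### The pro-objects `Q_a` -/

/-- The left ideal `∑ᵢ A^λ (hᵢ⁺ - aᵢ)^N`. -/
def leftIdeal (a : Fin n → ℤ) (N : ℕ) : Submodule (HEAQuot K w lam) (HEAQuot K w lam) :=
  Submodule.span _ (Set.range fun i => (h K w lam i - (a i : HEAQuot K w lam)) ^ N)

theorem leftIdeal_succ_le (a : Fin n → ℤ) (N : ℕ) :
    leftIdeal K w lam a (N + 1) ≤ leftIdeal K w lam a N := by
  refine Submodule.span_le.2 ?_
  rintro _ ⟨i, rfl⟩
  change _ ∈ leftIdeal K w lam a N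
  simp only [pow_succ']
  exact Submodule.smul_mem _ (h K w lam i - (a i : HEAQuot K w lam))
    (Submodule.subset_span ⟨i, rfl⟩)

/-- `Q_a`, the inverse limit of the modules `A^λ / ∑ᵢ A^λ (hᵢ⁺ - aᵢ)^N`. -/
def Q (a : Fin n → ℤ) :
    Submodule (HEAQuot K w lam) (∀ N : ℕ, HEAQuot K w lam ⧸ leftIdeal K w lam a N) where
  carrier := {q | ∀ N, Submodule.factor (leftIdeal_succ_le K w lam a N) (q (N + 1)) = q N}
  add_mem' := by
    intro x y hx hy N
    rw [Pi.add_apply, Pi.add_apply, map_add, hx N, hy N]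
  zero_mem' := by intro N; rw [Pi.zero_apply, Pi.zero_apply, map_zero]
  smul_mem' := by
    intro c x hx N
    rw [Pi.smul_apply, Pi.smul_apply, map_smul, hx N]

/-- The inverse limit topology on `Q_a`, each `A^λ / ∑ᵢ A^λ (hᵢ⁺ - aᵢ)^N` being discrete. -/
instance (a : Fin n → ℤ) : TopologicalSpace (Q K w lam a) :=
  ⨅ N : ℕ, TopologicalSpace.induced (fun q => q.1 N) ⊥

/-- The subspace of `D`-weight `c` of `Q_a`, where the image of `1` has weight `a`. -/
def QWeight (a c : Fin n → ℤ) : Submodule K (Q K w lam a) where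
  carrier := {q | ∀ N, ∃ x ∈ quotWeight K w lam (c - a), q.1 N = Submodule.Quotient.mk x}
  add_mem' := by
    intro q r hq hr N
    obtain ⟨x, hx, ex⟩ := hq N
    obtain ⟨y, hy, ey⟩ := hr N
    refine ⟨x + y, add_mem hx hy, ?_⟩
    change q.1 N + r.1 N = _
    rw [ex, ey, Submodule.Quotient.mk_add]
  zero_mem' := fun N => ⟨0, zero_mem _, rfl⟩
  smul_mem' := by
    intro c q hq N
    obtain ⟨x, hx, ex⟩ := hq N
    refine ⟨c • x, Submodule.smul_mem _ c hx, ?_⟩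
    change c • q.1 N = _
    rw [ex, Submodule.Quotient.mk_smul]

/-- The generator `1_a` of `Q_a`. -/
def oneQ (a : Fin n → ℤ) : Q K w lam a :=
  ⟨fun _ => Submodule.Quotient.mk 1, fun _ => rfl⟩

/-- Continuous `A^λ`-linear maps `Q_a → Q_a'` compatible with the `D`-action. -/
structure QHom (a a' : Fin n → ℤ) where
  toLin : Q K w lam a →ₗ[HEAQuot K w lam] Q K w lam a'
  cont : Continuous toLin
  map_weight : ∀ c, ∀ q ∈ QWeight K w lam a c, toLin q ∈ QWeight K w lam a' c

/-- `Q_a` and `Q_a'` are isomorphic as topological `A^λ`-modules with `D`-action. -/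
def QIso (a a' : Fin n → ℤ) : Prop :=
  ∃ (f : QHom K w lam a a') (g : QHom K w lam a' a),
    g.toLin ∘ₗ f.toLin = LinearMap.id ∧ f.toLin ∘ₗ g.toLin = LinearMap.id

open Classical in
/-- `q(y, c)`, the power series `1 / (y + c)` if `c ≠ 0` and `1` if `c = 0`. -/
def qSeries (c : K) : PowerSeries K :=
  if c = 0 then 1 else (PowerSeries.X + PowerSeries.C c)⁻¹

/-- `∏_{j = 1}^{b} q(y, a + j)`, an empty product if `b ≤ 0`. -/
def qProd (a b : ℤ) : PowerSeries K :=
  ∏ j ∈ Finset.Icc 1 b.toNat, qSeries K ((a + (j : ℤ) : ℤ) : K)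

/-- The value at `hᵢ⁺ - aᵢ` of the `N`-th truncation of `qProd`. -/
def qTrunc (a b : Fin n → ℤ) (N : ℕ) (i : Fin n) : HEAQuot K w lam :=
  Polynomial.aeval (h K w lam i - (a i : HEAQuot K w lam))
    (PowerSeries.trunc N (qProd K (a i) (b i)))

theorem hsub_commute (a : Fin n → ℤ) (i j : Fin n) :
    Commute (h K w lam i - (a i : HEAQuot K w lam)) (h K w lam j - (a j : HEAQuot K w lam)) :=
  ((h_commute K w lam i j).sub_left (Int.cast_commute _ _)).sub_right
    ((Int.commute_cast _ _))

theorem aeval_commute {R : Type u} [Ring R] [Algebra K R] {x y : R} (hxy : Commute x y)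
    (f : Polynomial K) : Commute (Polynomial.aeval x f) y := by
  induction f using Polynomial.induction_on' with
  | add f g hf hg => rw [map_add]; exact hf.add_left hg
  | monomial e c =>
    rw [Polynomial.aeval_monomial]
    exact Commute.mul_left (Algebra.commutes c y) (hxy.pow_left e)

theorem qTrunc_succ_sub_mem (a b : Fin n → ℤ) (N : ℕ) (l : List (Fin n)) :
    (l.map (qTrunc K w lam a b (N + 1))).prod - (l.map (qTrunc K w lam a b N)).prod ∈
      leftIdeal K w lam a N := by
  induction l with
  | nil => simp
  | cons i l ih =>
    simp only [List.map_cons, List.prod_cons]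
    set P := (l.map (qTrunc K w lam a b N)).prod with hP
    have hcomm : Commute P ((h K w lam i - (a i : HEAQuot K w lam)) ^ N) := by
      refine Commute.pow_right (Commute.list_prod_left _ _ ?_) N
      intro x hx
      obtain ⟨j, -, rfl⟩ := List.mem_map.1 hx
      exact aeval_commute K (hsub_commute K w lam a j i) _
    have hsucc : qTrunc K w lam a b (N + 1) i = qTrunc K w lam a b N i +
        algebraMap K _ (PowerSeries.coeff N (qProd K (a i) (b i))) *
          (h K w lam i - (a i : HEAQuot K w lam)) ^ N := by
      rw [qTrunc, PowerSeries.trunc_succ, map_add, Polynomial.aeval_monomial]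
      rfl
    have hkey : ∀ X' X Y e u : HEAQuot K w lam, X' = X + e * u → Commute P u →
        X' * Y - X * P = X' * (Y - P) + (e * P) * u := by
      intro X' X Y e u hX hu
      have h1 : (e * P) * u = (e * u) * P := by rw [mul_assoc, hu.eq, mul_assoc]
      rw [h1, hX]
      noncomm_ring
    rw [hkey _ _ _ _ _ hsucc hcomm]
    exact add_mem (Submodule.smul_mem _ _ ih)
      (Submodule.smul_mem _ _ (Submodule.subset_span ⟨i, rfl⟩))

/-- The element `m(b) ∏ᵢ ∏_{j = 1}^{bᵢ} q(sᵢ, aᵢ + j)` of the weight `a + b` subspace of `Q_a`, where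
`sᵢ` acts on the generator `1_a` by `hᵢ⁺ - aᵢ`. -/
def cElem (a b : Fin n → ℤ) (hb : ∑ i, b i • w i = 0) : Q K w lam a :=
  ⟨fun N => Submodule.Quotient.mk
      (m K w lam b hb * ((List.finRange n).map (qTrunc K w lam a b N)).prod), by
    intro N
    change Submodule.Quotient.mk _ = Submodule.Quotient.mk _
    rw [Submodule.Quotient.eq]
    change m K w lam b hb * _ - m K w lam b hb * _ ∈ _
    rw [← mul_sub]
    exact Submodule.smul_mem _ _ (qTrunc_succ_sub_mem K w lam a b N _)⟩

end HypertoricEnvelopingAlgebra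

/-! ### Categories of modules over `A^λ` -/

section Modules

variable (K : Type u) [Field K] {n k : ℕ} (w : Fin n → Fin k → ℤ) (lam : Fin k → ℤ)

/-- Finitely generated `A^λ`-modules with a compatible `D`-action (a grading by the characters of
`D`) such that `T` acts by the character `λ` and `hᵢ⁺ - aᵢ` is nilpotent on each vector of weight
`a`. -/
structure WtMod where
  carrier : Type u
  [addCommGroup : AddCommGroup carrier]
  [moduleK : Module K carrier]
  [moduleA : Module (HEAQuot K w lam) carrier]
  [tower : IsScalarTower K (HEAQuot K w lam) carrier]
  finite : Module.Finite (HEAQuot K w lam) carrier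
  weight : (Fin n → ℤ) → Submodule K carrier
  internal : DirectSum.IsInternal weight
  smul_mem : ∀ a b, ∀ x ∈ quotWeight K w lam b, ∀ v ∈ weight a, x • v ∈ weight (a + b)
  weight_eq_bot : ∀ a, ∑ i, a i • w i ≠ lam → weight a = ⊥
  nilpotent : ∀ i a, ∀ v ∈ weight a, ∃ N : ℕ, (h K w lam i - (a i : HEAQuot K w lam)) ^ N • v = 0

attribute [instance] WtMod.addCommGroup WtMod.moduleK WtMod.moduleA WtMod.tower

/-- Morphisms: `A^λ`-linear maps compatible with the `D`-action. -/
@[ext]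
structure WtMod.Hom (M N : WtMod K w lam) where
  toLin : M.carrier →ₗ[HEAQuot K w lam] N.carrier
  map_weight : ∀ a, ∀ v ∈ M.weight a, toLin v ∈ N.weight a

instance : Category (WtMod K w lam) where
  Hom M N := WtMod.Hom K w lam M N
  id M := ⟨LinearMap.id, fun _ _ hv => hv⟩
  comp f g := ⟨g.toLin ∘ₗ f.toLin, fun a v hv => g.map_weight a _ (f.map_weight a v hv)⟩

/-- `Hom(Q_a, M)`: continuous `A^λ`-linear maps compatible with the `D`-action, `M` being
discrete. -/
def HomQ (a : Fin n → ℤ) (M : WtMod K w lam) :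
    Submodule K (Q K w lam a →ₗ[HEAQuot K w lam] M.carrier) where
  carrier := {f | (letI : TopologicalSpace M.carrier := ⊥; Continuous f) ∧
    ∀ c, ∀ q ∈ QWeight K w lam a c, f q ∈ M.weight c}
  add_mem' := by
    rintro f g ⟨hf, hf'⟩ ⟨hg, hg'⟩
    let _ : TopologicalSpace M.carrier := ⊥
    have _ : DiscreteTopology M.carrier := ⟨rfl⟩
    exact ⟨Continuous.add hf hg, fun c q hq => add_mem (hf' c q hq) (hg' c q hq)⟩
  zero_mem' := by
    let _ : TopologicalSpace M.carrier := ⊥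
    exact ⟨continuous_const, fun c q _ => zero_mem _⟩
  smul_mem' := by
    rintro r f ⟨hf, hf'⟩
    let _ : TopologicalSpace M.carrier := ⊥
    have _ : DiscreteTopology M.carrier := ⟨rfl⟩
    exact ⟨(continuous_of_discreteTopology (f := fun v : M.carrier => r • v)).comp hf,
      fun c q hq => Submodule.smul_mem _ _ (hf' c q hq)⟩

/-- A polynomial in `z₁, …, zₙ, w₁, …, wₙ` (`zᵢ` is the variable `Sum.inl i` and `wᵢ` is the
variable `Sum.inr i`) is `T`-invariant. -/
def PolyInvariant (f : MvPolynomial (Fin n ⊕ Fin n) K) : Prop :=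
  ∀ e ∈ f.support, ∑ i, ((e (Sum.inl i) : ℤ) - (e (Sum.inr i) : ℤ)) • w i = 0

/-- The Frobenius map `zᵢ ↦ zᵢ^p`, `wᵢ ↦ ∂ᵢ^p` into the Weyl algebra. -/
def frob (p : ℕ) (f : MvPolynomial (Fin n ⊕ Fin n) K) : Weyl K n :=
  ∑ e ∈ f.support, f.coeff e •
    zdMonomial K (fun i => p * e (Sum.inl i)) (fun i => p * e (Sum.inr i))

theorem frob_mem (p : ℕ) (f : MvPolynomial (Fin n ⊕ Fin n) K) (hf : PolyInvariant K w f) :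
    frob K p f ∈ HEA K w := by
  rw [mem_HEA]
  refine Submodule.sum_mem _ fun e he => Submodule.smul_mem _ _ ?_
  have := zdMonomial_mem K w (fun i => p * e (Sum.inl i)) (fun i => p * e (Sum.inr i))
  convert this using 2
  have h2 := congrArg (fun x => (p : ℤ) • x) (hf e he)
  simp only [smul_zero, Finset.smul_sum, smul_smul] at h2
  rw [← h2]
  refine Finset.sum_congr rfl fun i _ => ?_
  congr 1
  push_cast
  ring

/-- `M` is set-theoretically supported at the point `o = {z = w = 0}` of the affine hypertoric
variety.  The coordinate ring of that variety is a quotient of the ring of `T`-invariant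
polynomials, and acts on `M` through the Frobenius map; the support of `M` is contained in `{o}` iff
the maximal ideal of `o` is contained in the radical of the annihilator of each `v ∈ M`. -/
def WtMod.SupportedAtO (p : ℕ) (M : WtMod K w lam) : Prop :=
  ∀ (f : MvPolynomial (Fin n ⊕ Fin n) K) (hf : PolyInvariant K w f),
    MvPolynomial.constantCoeff f = 0 → ∀ v : M.carrier,
      ∃ N : ℕ, toQuot K w lam ⟨frob K p f, frob_mem K w p f hf⟩ ^ N • v = 0

/-- The objects of `A^λ-mod_o^D` among all objects of `WtMod`. -/
def atO (p : ℕ) : ObjectProperty (WtMod K w lam) := fun M => M.SupportedAtO K w lam p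

end Modules

/-! ### Chambers and the algebra `H^λ` -/

section Combinatorial

variable (K : Type u) [Field K] (p : ℕ) {n k : ℕ} (w : Fin n → Fin k → ℤ) (lam : Fin k → ℤ)

/-- The chamber `Δ_x`: characters `a` of `D` restricting to `λ` on `T` with
`p xᵢ ≤ aᵢ < p xᵢ + p`. -/
def chamber (x : Fin n → ℤ) : Set (Fin n → ℤ) :=
  {a | ∑ i, a i • w i = lam ∧ ∀ i, p * x i ≤ a i ∧ a i < p * x i + p}

/-- `Λ(λ)`, the set of `x` with `Δ_x ≠ ∅`. -/
def Chambers : Type := {x : Fin n → ℤ // (chamber p w lam x).Nonempty}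

/-- `S`, the symmetric algebra over `K` of the Lie algebra of `G = D/T`: polynomials in the
`sᵢ` modulo the linear forms `∑ᵢ ⟨εᵢ, χ⟩ sᵢ` for cocharacters `χ` of `T`. -/
def SymG : Type u :=
  MvPolynomial (Fin n) K ⧸ Ideal.span (Set.range fun χ : Fin k → ℤ =>
    ∑ i, MvPolynomial.C (((∑ j, w i j * χ j : ℤ)) : K) * MvPolynomial.X i)

instance : CommRing (SymG K w) := inferInstanceAs (CommRing (_ ⧸ _))

instance : Algebra K (SymG K w) := inferInstanceAs (Algebra K (_ ⧸ _))

/-- The element `sᵢ` of `S`. -/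
def sS (i : Fin n) : SymG K w := Ideal.Quotient.mk _ (MvPolynomial.X i)

/-- `ηᵢ(x, y, u) = (|xᵢ - yᵢ| + |yᵢ - uᵢ| - |xᵢ - uᵢ|) / 2`, a nonnegative integer. -/
def eta (x y u : ℤ) : ℕ := ((|x - y| + |y - u| - |x - u|) / 2).toNat

/-- The relations `c_{x,y} c_{y,u} = ∏ᵢ sᵢ^{ηᵢ(x,y,u)} c_{x,u}`, and `c_{x,y} c_{y',u} = 0` for
`y ≠ y'`; the idempotent `1_x` is `c_{x,x}`. -/
inductive HRel : FreeAlgebra (SymG K w) (Chambers p w lam × Chambers p w lam) →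
    FreeAlgebra (SymG K w) (Chambers p w lam × Chambers p w lam) → Prop
  | mul (x y u : Chambers p w lam) :
    HRel (FreeAlgebra.ι (SymG K w) (x, y) * FreeAlgebra.ι (SymG K w) (y, u))
      ((∏ i, sS K w i ^ eta (x.1 i) (y.1 i) (u.1 i)) • FreeAlgebra.ι (SymG K w) (x, u))
  | mul_ne (x y y' u : Chambers p w lam) (hy : y ≠ y') :
    HRel (FreeAlgebra.ι (SymG K w) (x, y) * FreeAlgebra.ι (SymG K w) (y', u)) 0

/-- The algebra `H^λ` with a unit adjoined: `HAlg = S ⊕ H^λ`, where the locally unital algebra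
`H^λ` is the ideal spanned over `S` by the `c_{x,y}`.  An `H^λ`-module that is the sum of the images
of the idempotents `1_x` is the same thing as a `HAlg`-module with this property. -/
def HAlg : Type u := RingQuot (HRel K p w lam)

instance : Semiring (HAlg K p w lam) :=
  inferInstanceAs (Semiring (RingQuot (HRel K p w lam)))

instance : Algebra (SymG K w) (HAlg K p w lam) :=
  inferInstanceAs (Algebra (SymG K w) (RingQuot (HRel K p w lam)))

instance : Ring (HAlg K p w lam) := Algebra.semiringToRing (SymG K w)

/-- The generator `c_{x,y}`. -/
def c (x y : Chambers p w lam) : HAlg K p w lam :=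
  RingQuot.mkAlgHom (SymG K w) (HRel K p w lam) (FreeAlgebra.ι (SymG K w) (x, y))

/-- The action of `sᵢ`. -/
def sH (i : Fin n) : HAlg K p w lam := algebraMap (SymG K w) (HAlg K p w lam) (sS K w i)

/-- The scalars `K` in `HAlg`. -/
def scalarH : K →+* HAlg K p w lam :=
  (algebraMap (SymG K w) (HAlg K p w lam)).comp (algebraMap K (SymG K w))

/-- `N` is an `H^λ`-module, that is, the sum of the images of the idempotents `1_x`. -/
def LocallyUnital (N : ModuleCat.{u} (HAlg K p w lam)) : Prop :=
  AddSubgroup.closure {v : N | ∃ (x : Chambers p w lam) (u : N), v = c K p w lam x x • u} = ⊤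

/-- Each `sᵢ` acts nilpotently. -/
def SNilpotent (N : ModuleCat.{u} (HAlg K p w lam)) : Prop :=
  ∀ i : Fin n, ∃ e : ℕ, ∀ v : N, sH K p w lam i ^ e • v = 0

/-- Finitely generated `H^λ`-modules on which each `sᵢ` acts nilpotently. -/
def fgNil : ObjectProperty (ModuleCat.{u} (HAlg K p w lam)) := fun N =>
  LocallyUnital K p w lam N ∧ SNilpotent K p w lam N ∧ Module.Finite (HAlg K p w lam) N

/-- Finite-dimensional `H^λ`-modules on which each `sᵢ` acts nilpotently. -/
def fdNil : ObjectProperty (ModuleCat.{u} (HAlg K p w lam)) := fun N =>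
  LocallyUnital K p w lam N ∧ SNilpotent K p w lam N ∧
    (letI : Module K N := Module.compHom N (scalarH K p w lam); Module.Finite K N)

/-! ### The functor `Hom(⨁ P_x, -)` -/

theorem sub_trivial_of_mem {x y : Fin n → ℤ} {a a' : Fin n → ℤ} (ha : a ∈ chamber p w lam x)
    (ha' : a' ∈ chamber p w lam y) : ∑ i, (a - a') i • w i = 0 := by
  simp only [Pi.sub_apply, sub_smul, Finset.sum_sub_distrib]
  rw [ha.1, ha'.1, sub_self]

/-- The assertion (with its witnesses) that `F` is the functor `Hom(⨁ₓ P_x, -)`, where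
`P_x = Q_{b x}` for a point `b x` of each nonempty chamber `Δ_x`.  The locally unital algebra `H^λ`
acts on `⨁ₓ Hom(P_x, M)`: the element `c_{x,y}` acts by composition with the morphism
`γ x y : P_x → P_y` sending the generator of `P_x` to `cElem`, and `sᵢ` acts by `hᵢ⁺ - aᵢ` on the
values on vectors of weight `a`. -/
structure IsHomFunctor (b : Chambers p w lam → Fin n → ℤ) (hb : ∀ x, b x ∈ chamber p w lam x.1)
    (F : WtMod K w lam ⥤ ModuleCat.{u} (HAlg K p w lam)) where
  γ : ∀ x y, QHom K w lam (b x) (b y)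
  γ_one : ∀ x y, (γ x y).toLin (oneQ K w lam (b x)) =
    cElem K w lam (b y) (b x - b y) (sub_trivial_of_mem p w lam (hb x) (hb y))
  θ : ∀ M, F.obj M ≃+ Π₀ x : Chambers p w lam, HomQ K w lam (b x) M
  θ_scalar : ∀ M (r : K) (v : F.obj M), θ M (scalarH K p w lam r • v) = r • θ M v
  θ_natural : ∀ (M N : WtMod K w lam) (f : M ⟶ N) (v : F.obj M) (x : Chambers p w lam),
    (θ N ((F.map f).hom v) x).1 = f.toLin ∘ₗ (θ M v x).1
  θ_c : ∀ M (x y : Chambers p w lam) (v : F.obj M),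
    (θ M (c K p w lam x y • v) x).1 = (θ M v y).1 ∘ₗ (γ x y).toLin
  θ_c_ne : ∀ M (x y u : Chambers p w lam) (v : F.obj M), u ≠ x →
    θ M (c K p w lam x y • v) u = 0
  θ_s : ∀ M (i : Fin n) (v : F.obj M) (x : Chambers p w lam) (a : Fin n → ℤ),
    ∀ q ∈ QWeight K w lam (b x) a, (θ M (sH K p w lam i • v) x).1 q =
      (h K w lam i - (a i : HEAQuot K w lam)) • (θ M v x).1 q

end Combinatorial

end

end Hypertoric

/-! The point is that a graded module is determined by its weight spaces, the nilpotent operators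
`h_i - a_i` on them, and suitably normalised operators between them, and that these normalised
operators multiply exactly by the rule defining `H^λ`.

In one variable write `z^b` for `∂^{-b}` when `b < 0`. Then `z^{b'} z^b` equals `z^{b'+b}` times the
product of `h + j` over the walls `j` crossed twice by the path from `0` via `b` to `b' + b`
(`zdPow_mul_zdPow`). On a vector of weight `a` the operator `y = h - a` is nilpotent, and `h + j = y
+ (a + j)` is invertible unless `p` divides `a + j`. The factors `q` cancel the invertible terms,
one for each upward crossing. What is left is `y` to the number of chamber boundaries crossed twice,
which is `η` of the chambers of the three weights (`wall_identity`).

Evaluation at `1_a` identifies `Hom(Q_a, M)` with `M_a` (`homEquiv`), so precomposition with the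
maps sending generators to `cElem` becomes a system of maps `Cmap` from `M_a` to `M_{a'}`. They
satisfy the relations of `H^λ` (`Cmap_Cmap`), are isomorphisms inside a chamber (`Cmap_Cmap_of_eq`),
and determine the action of `A^λ` together with that of `S` (`m_smul_eq`). Hence nothing is lost by
keeping one weight per chamber, and the functor is full and faithful.

For essential surjectivity an `H^λ`-module `V` has to be spread out over all weights. The space of
weight `a` should be `1_x V` with `x` the chamber of `a`; but single generators `z_i` and `∂_i` may
pass through weights that do not restrict to `λ` and whose chambers are not in `Λ(λ)`. So the Weyl
algebra first acts on arbitrary families of vectors of `V` indexed by `Λ(λ)`, with coefficients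
recording how each step moves relative to each chamber (`mCoeff`, `weylAct`). The subspace
`localSub` of families compatible with the `c_{u,y}` is a copy of `1_x V`, and the invariant
elements preserve it (`weylAct_mem_psiSub`). Applying the functor to the resulting module gives back
`V` (`psiCompare`).

The version with supports follows because an object is supported at `o` iff it is
finite-dimensional. In one direction, the invariant monomials in each orthant form a finitely
generated monoid, so nilpotency of the Frobenius twists leaves only finitely many monomials acting
nontrivially on a vector (`finite_m_smul_ne_zero`). In the other, Frobenius monomials commute, and
each nonconstant one either shifts weights or is a polynomial divisible by some `h_j - a_j`
(`supportedAtO_of_finite`).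

Finally, within a chamber the elements `cElem` give mutually inverse maps of the `Q_a`, while
distinct chambers are separated by the object built from a one-dimensional `H^λ`-module
(`exists_separating`). -/

namespace Hypertoric

noncomputable section

/-! ### Ordered monomials in one Weyl pair -/

section OneVariable

variable {R : Type*} [Ring R]

/-- `z^b` for `b ≥ 0` and `∂^{-b}` for `b ≤ 0`. -/
def zdPow (x y : R) (b : ℤ) : R := x ^ b.toNat * y ^ (-b).toNat

theorem zdPow_natCast (x y : R) (l : ℕ) : zdPow x y l = x ^ l := by simp [zdPow]

theorem zdPow_neg_natCast (x y : R) (l : ℕ) : zdPow x y (-(l : ℤ)) = y ^ l := by simp [zdPow]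

theorem mul_pow_of_weyl {x y : R} (hxy : y * x = x * y + 1) (l : ℕ) :
    y * x ^ (l + 1) = x ^ l * (x * y + ((l : ℤ) + 1 : ℤ)) := by
  induction l with
  | zero => simp [hxy]
  | succ l ih =>
    rw [pow_succ, ← mul_assoc, ih, mul_assoc, add_mul, mul_assoc x y x, hxy, pow_succ x l]
    push_cast
    have : (l : R) * x = x * l := Nat.cast_comm l x
    noncomm_ring
    simp [this]

theorem pow_mul_of_weyl {x y : R} (hxy : y * x = x * y + 1) (l : ℕ) :
    x * y ^ (l + 1) = y ^ l * (x * y - (l : ℤ)) := by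
  induction l with
  | zero => simp
  | succ l ih =>
    rw [pow_succ, ← mul_assoc, ih, mul_assoc, pow_succ y l]
    have e : x * y * y = y * (x * y) - y := by rw [← mul_assoc, hxy]; noncomm_ring
    have : (l : R) * y = y * l := Nat.cast_comm l y
    rw [sub_mul, e]
    push_cast
    rw [this]
    noncomm_ring

/-- A factor appears only when the step towards larger exponents shortens a power of `y`. It is kept
on the right, so that later factors accumulate as one polynomial in the Euler operator `x * y`. -/
theorem mul_zdPow {x y : R} (hxy : y * x = x * y + 1) (b : ℤ) :
    x * zdPow x y b = zdPow x y (b + 1) * if b < 0 then x * y + (b + 1 : ℤ) else 1 := by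
  split_ifs with hb
  · obtain ⟨l, rfl⟩ : ∃ l : ℕ, b = -((l + 1 : ℕ) : ℤ) := ⟨(-b - 1).toNat, by omega⟩
    rw [zdPow_neg_natCast, pow_mul_of_weyl hxy]
    rw [show -((l + 1 : ℕ) : ℤ) + 1 = -(l : ℤ) by push_cast; ring, zdPow_neg_natCast]
    push_cast
    rw [sub_eq_add_neg]
  · obtain ⟨l, rfl⟩ : ∃ l : ℕ, b = l := ⟨b.toNat, by omega⟩
    rw [zdPow_natCast, ← Nat.cast_succ, zdPow_natCast, pow_succ', mul_one]

theorem mul_zdPow' {x y : R} (hxy : y * x = x * y + 1) (b : ℤ) :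
    y * zdPow x y b = zdPow x y (b - 1) * if 0 < b then x * y + (b : ℤ) else 1 := by
  split_ifs with hb
  · obtain ⟨l, rfl⟩ : ∃ l : ℕ, b = (l + 1 : ℕ) := ⟨(b - 1).toNat, by omega⟩
    rw [zdPow_natCast, mul_pow_of_weyl hxy]
    rw [show ((l + 1 : ℕ) : ℤ) - 1 = (l : ℤ) by push_cast; ring, zdPow_natCast]
    push_cast
    rfl
  · obtain ⟨l, rfl⟩ : ∃ l : ℕ, b = -(l : ℤ) := ⟨(-b).toNat, by omega⟩
    rw [zdPow_neg_natCast, show -(l : ℤ) - 1 = -((l + 1 : ℕ) : ℤ) by push_cast; ring,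
      zdPow_neg_natCast, pow_succ', mul_one]

theorem euler_mul_zdPow {x y : R} (hxy : y * x = x * y + 1) (b : ℤ) :
    x * y * zdPow x y b = zdPow x y b * (x * y + (b : ℤ)) := by
  rw [mul_assoc, mul_zdPow' hxy]
  split_ifs with hb
  · rw [← mul_assoc, mul_zdPow hxy, if_neg (by omega), mul_one, sub_add_cancel]
  · rw [mul_one, mul_zdPow hxy, if_pos (by omega), sub_add_cancel]

/-- The walls between `j - 1` and `j` that are crossed twice on the way from `0` via `b` to
`b' + b`. -/
def walls (b' b : ℤ) : Finset ℤ :=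
  Finset.Ioc (min 0 b) (max 0 b) ∩ Finset.Ioc (min b (b' + b)) (max b (b' + b))

theorem walls_zero (b : ℤ) : walls 0 b = ∅ := by simp [walls]

/-- The extra step of the second leg crosses the wall `b' + b + 1` upwards; the first leg has
crossed this wall exactly when it descended past it, that is, when `b' + b < 0`. -/
theorem walls_add_one {b' : ℤ} (hb' : 0 ≤ b') (b : ℤ) :
    walls (b' + 1) b = if b' + b < 0 then insert (b' + b + 1) (walls b' b) else walls b' b := by
  split_ifs <;> ext j <;> simp [walls] <;> omega

theorem walls_sub_one {b' : ℤ} (hb' : b' ≤ 0) (b : ℤ) :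
    walls (b' - 1) b = if 0 < b' + b then insert (b' + b) (walls b' b) else walls b' b := by
  split_ifs <;> ext j <;> simp [walls] <;> omega

theorem notMem_walls {b' : ℤ} (hb' : 0 ≤ b') (b : ℤ) : b' + b + 1 ∉ walls b' b := by
  simp [walls]; omega

theorem notMem_walls' {b' : ℤ} (hb' : b' ≤ 0) (b : ℤ) : b' + b ∉ walls b' b := by
  simp [walls]; omega

variable (K : Type*) [Field K]

/-- The factor in `z^{b'} z^b = z^{b' + b} · wallPoly b' b`. -/
def wallPoly (b' b : ℤ) : Polynomial K :=
  ∏ j ∈ walls b' b, (Polynomial.X + Polynomial.C (j : K))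

theorem wallPoly_zero (b : ℤ) : wallPoly K 0 b = 1 := by simp [wallPoly, walls_zero]

theorem wallPoly_add_one {b' : ℤ} (hb' : 0 ≤ b') (b : ℤ) :
    wallPoly K (b' + 1) b = wallPoly K b' b *
      if b' + b < 0 then Polynomial.X + Polynomial.C ((b' + b + 1 : ℤ) : K) else 1 := by
  rw [wallPoly, walls_add_one hb']
  split_ifs
  · rw [Finset.prod_insert (notMem_walls hb' b), mul_comm]; rfl
  · rw [mul_one]; rfl

theorem wallPoly_sub_one {b' : ℤ} (hb' : b' ≤ 0) (b : ℤ) :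
    wallPoly K (b' - 1) b = wallPoly K b' b *
      if 0 < b' + b then Polynomial.X + Polynomial.C ((b' + b : ℤ) : K) else 1 := by
  rw [wallPoly, walls_sub_one hb']
  split_ifs
  · rw [Finset.prod_insert (notMem_walls' hb' b), mul_comm]; rfl
  · rw [mul_one]; rfl

/-- Multiply by one letter at a time: each letter moves the exponent across a single wall, and
produces the corresponding linear factor iff that wall is being recrossed. -/
theorem zdPow_mul_zdPow [Algebra K R] {x y : R} (hxy : y * x = x * y + 1) (b' b : ℤ) :
    zdPow x y b' * zdPow x y b =
      zdPow x y (b' + b) * Polynomial.aeval (x * y) (wallPoly K b' b) := by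
  have key : ∀ c : ℤ, Polynomial.aeval (x * y) (Polynomial.X + Polynomial.C (c : K)) =
      x * y + (c : R) := fun c => by simp
  rcases le_total 0 b' with h | h
  · obtain ⟨l, rfl⟩ := Int.eq_ofNat_of_zero_le h
    clear h
    induction l with
    | zero => simp [wallPoly_zero, zdPow]
    | succ l ih =>
      have e : zdPow x y ((l + 1 : ℕ) : ℤ) = x * zdPow x y l := by
        rw [zdPow_natCast, zdPow_natCast, pow_succ']
      rw [e, mul_assoc, ih, ← mul_assoc, mul_zdPow hxy]
      push_cast
      rw [wallPoly_add_one K (Int.natCast_nonneg l), mul_comm (wallPoly K l b), map_mul, mul_assoc,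
        add_right_comm]
      split_ifs
      · rw [key]; push_cast; simp only [add_right_comm]
      · rw [map_one]
  · obtain ⟨l, rfl⟩ : ∃ l : ℕ, b' = -(l : ℤ) := ⟨(-b').toNat, by omega⟩
    clear h
    induction l with
    | zero => simp [wallPoly_zero, zdPow]
    | succ l ih =>
      have e : zdPow x y (-((l + 1 : ℕ) : ℤ)) = y * zdPow x y (-(l : ℤ)) := by
        rw [zdPow_neg_natCast, zdPow_neg_natCast, pow_succ']
      rw [e, mul_assoc, ih, ← mul_assoc, mul_zdPow' hxy]
      push_cast
      rw [neg_add, ← sub_eq_add_neg, wallPoly_sub_one K (by omega), mul_comm (wallPoly K (-l) b),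
        map_mul, mul_assoc, show (-(l : ℤ) + b - 1) = -(l : ℤ) - 1 + b by ring]
      split_ifs
      · rw [key]; push_cast; rfl
      · rw [map_one]

end OneVariable

/-! ### Products over lists -/

/-- Two ordered products can be merged factor by factor because only factors of different index have
to pass each other. The index must not repeat, as `f i` and `g i` need not commute. -/
theorem list_prod_mul_list_prod {ι R : Type*} [Monoid R] {f g : ι → R}
    (hfg : ∀ i j, i ≠ j → Commute (f i) (g j)) {l : List ι} (hl : l.Nodup) :
    (l.map f).prod * (l.map g).prod = (l.map fun i => f i * g i).prod := by
  induction l with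
  | nil => simp
  | cons i l ih =>
    have hc : Commute (l.map f).prod (g i) := by
      refine Commute.list_prod_left _ _ fun x hx => ?_
      obtain ⟨j, hj, rfl⟩ := List.mem_map.1 hx
      exact hfg j i fun e => (List.nodup_cons.1 hl).1 (e ▸ hj)
    simp only [List.map_cons, List.prod_cons]
    rw [← ih (List.nodup_cons.1 hl).2, mul_assoc, ← mul_assoc _ (g i), hc.eq]
    simp only [mul_assoc]

/-! ### Polynomials in commuting elements -/

section CommutingFamily

variable {K R ι : Type*} [Field K] [Ring R] [Algebra K R]

open scoped IsMulCommutative in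
/-- The evaluation of polynomials at a family of commuting elements. -/
def aevalComm (f : ι → R) (hf : ∀ i j, Commute (f i) (f j)) : MvPolynomial ι K →ₐ[K] R :=
  -- The evaluation takes place in the commutative subalgebra generated by the family.
  have : IsMulCommutative (Algebra.adjoin K (Set.range f)) :=
    Algebra.isMulCommutative_adjoin K (by rintro _ ⟨i, rfl⟩ _ ⟨j, rfl⟩; exact hf i j)
  (Algebra.adjoin K (Set.range f)).val.comp
    (MvPolynomial.aeval (R := K) (S₁ := Algebra.adjoin K (Set.range f)) fun i =>
      ⟨f i, Algebra.subset_adjoin ⟨i, rfl⟩⟩)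

@[simp]
theorem aevalComm_X (f : ι → R) (hf : ∀ i j, Commute (f i) (f j)) (i : ι) :
    aevalComm (K := K) f hf (MvPolynomial.X i) = f i := by
  simp [aevalComm]

theorem algHom_aeval {S : Type*} [Ring S] [Algebra K S] (φ : S →ₐ[K] R) (x : S)
    (f : Polynomial K) : φ (Polynomial.aeval x f) = Polynomial.aeval (φ x) f :=
  (Polynomial.aeval_algHom_apply φ x f).symm

theorem aevalComm_list_prod (f : ι → R) (hf : ∀ i j, Commute (f i) (f j))
    (g : ι → Polynomial K) (l : List ι) :
    aevalComm (K := K) f hf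
        (l.map fun i => Polynomial.aeval (MvPolynomial.X i) (g i)).prod =
      (l.map fun i => Polynomial.aeval (f i) (g i)).prod := by
  rw [map_list_prod, List.map_map]
  congr 1
  refine List.map_congr_left fun i _ => ?_
  simp [algHom_aeval]

theorem mvPolynomial_induction {P : MvPolynomial ι K → Prop} (hC : ∀ r, P (MvPolynomial.C r))
    (hX : ∀ i, P (MvPolynomial.X i)) (hadd : ∀ f g, P f → P g → P (f + g))
    (hmul : ∀ f g, P f → P g → P (f * g)) (f : MvPolynomial ι K) : P f :=
  MvPolynomial.induction_on f hC hadd fun f i h => hmul f _ h (hX i)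

/-- If two algebra maps from a polynomial ring are intertwined on the variables, they are
intertwined. -/
theorem intertwine {φ ψ : MvPolynomial ι K →ₐ[K] R} {x : R}
    (hx : ∀ i, φ (MvPolynomial.X i) * x = x * ψ (MvPolynomial.X i)) (f : MvPolynomial ι K) :
    φ f * x = x * ψ f := by
  induction f using mvPolynomial_induction with
  | hC r => rw [← MvPolynomial.algebraMap_eq, AlgHom.commutes, AlgHom.commutes,
      Algebra.commutes]
  | hX i => exact hx i
  | hadd f g hf hg => rw [map_add, map_add, add_mul, mul_add, hf, hg]
  | hmul f g hf hg => rw [map_mul, map_mul, mul_assoc, hg, ← mul_assoc, hf, mul_assoc]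

end CommutingFamily

/-! ### Monomials in the Weyl algebra -/

section WeylMonomials

variable (K : Type u) [Field K] {n : ℕ}

theorem d_mul_z_self (i : Fin n) : d K i * z K i = z K i * d K i + 1 := by
  rw [d_mul_z, if_pos rfl]

theorem commute_z_d {i j : Fin n} (hij : i ≠ j) : Commute (z K i) (d K j) := by
  have := d_mul_z K j i
  rw [if_neg hij.symm, add_zero] at this
  exact this.symm

theorem commute_zdPow {i j : Fin n} (hij : i ≠ j) {x y : Weyl K n}
    (hx : x = z K i ∨ x = d K i) (hy : y = z K j ∨ y = d K j) : Commute x y := by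
  rcases hx with rfl | rfl <;> rcases hy with rfl | rfl
  · exact z_mul_z K i j
  · exact commute_z_d K hij
  · exact (commute_z_d K hij.symm).symm
  · exact d_mul_d K i j

theorem commute_zdPow_left {i j : Fin n} (hij : i ≠ j) (b : ℤ) {y : Weyl K n}
    (hy : y = z K j ∨ y = d K j) : Commute (zdPow (z K i) (d K i) b) y :=
  ((commute_zdPow K hij (Or.inl rfl) hy).pow_left _).mul_left
    ((commute_zdPow K hij (Or.inr rfl) hy).pow_left _)

theorem commute_zdPow_zdPow {i j : Fin n} (hij : i ≠ j) (b c : ℤ) :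
    Commute (zdPow (z K i) (d K i) b) (zdPow (z K j) (d K j) c) :=
  ((commute_zdPow_left K hij b (Or.inl rfl)).pow_right _).mul_right
    ((commute_zdPow_left K hij b (Or.inr rfl)).pow_right _)

theorem commute_zdPow_euler {i j : Fin n} (hij : i ≠ j) (b : ℤ) :
    Commute (zdPow (z K i) (d K i) b) (z K j * d K j) :=
  (commute_zdPow_left K hij b (Or.inl rfl)).mul_right (commute_zdPow_left K hij b (Or.inr rfl))

theorem zdMonomial_eq (α β : Fin n → ℕ) :
    zdMonomial K α β = ((List.finRange n).map fun i => z K i ^ α i * d K i ^ β i).prod :=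
  list_prod_mul_list_prod (fun _ _ hij => (commute_z_d K hij).pow_pow _ _) (List.nodup_finRange n)

/-- `∏_{bᵢ > 0} zᵢ^{bᵢ} ∏_{bᵢ < 0} ∂ᵢ^{-bᵢ}`. -/
def mW (b : Fin n → ℤ) : Weyl K n :=
  zdMonomial K (fun i => (b i).toNat) (fun i => (-b i).toNat)

theorem mW_eq (b : Fin n → ℤ) :
    mW K b = ((List.finRange n).map fun i => zdPow (z K i) (d K i) (b i)).prod :=
  zdMonomial_eq K _ _

theorem mW_mem {Γ : Type} [AddCommGroup Γ] (wt : Fin n → Γ) (b : Fin n → ℤ) :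
    mW K b ∈ weylWeight K wt (∑ i, b i • wt i) := by
  have := zdMonomial_mem K wt (fun i => (b i).toNat) (fun i => (-b i).toNat)
  convert this using 4
  · omega
  · rfl

theorem mW_zero : mW K (0 : Fin n → ℤ) = 1 := by
  rw [mW_eq]
  exact List.prod_eq_one fun x hx => by
    obtain ⟨i, -, rfl⟩ := List.mem_map.1 hx
    simp [zdPow]

theorem list_prod_single {ι R : Type*} [DecidableEq ι] [Monoid R] {f : ι → R} (i : ι)
    (hf : ∀ j, j ≠ i → f j = 1) {l : List ι} (hl : l.Nodup) (hi : i ∈ l) :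
    (l.map f).prod = f i := by
  induction l with
  | nil => simp at hi
  | cons j l ih =>
    rw [List.map_cons, List.prod_cons]
    by_cases hij : j = i
    · subst hij
      rw [List.prod_eq_one, mul_one]
      intro x hx
      obtain ⟨t, ht, rfl⟩ := List.mem_map.1 hx
      exact hf t fun e => (List.nodup_cons.1 hl).1 (e ▸ ht)
    · rw [hf j hij, one_mul]
      exact ih (List.nodup_cons.1 hl).2 ((List.mem_cons.1 hi).resolve_left (Ne.symm hij))

theorem mW_single (i : Fin n) (b : ℤ) : mW K (Pi.single i b) = zdPow (z K i) (d K i) b := by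
  rw [mW_eq, list_prod_single i _ (List.nodup_finRange n) (List.mem_finRange i), Pi.single_eq_same]
  intro j hj
  simp [Pi.single_eq_of_ne hj, zdPow]

theorem euler_commute (i j : Fin n) : Commute (z K i * d K i) (z K j * d K j) :=
  zd_mul_comm K i j

/-- Polynomials in the `zᵢ ∂ᵢ`. -/
def polW : MvPolynomial (Fin n) K →ₐ[K] Weyl K n :=
  aevalComm (fun i => z K i * d K i) (euler_commute K)

theorem polW_X (i : Fin n) : polW K (MvPolynomial.X i) = z K i * d K i := aevalComm_X _ _ i

theorem aevalComm_prod {R : Type*} [Ring R] [Algebra K R] (f : Fin n → R)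
    (hf : ∀ i j, Commute (f i) (f j)) (g : Fin n → Polynomial K) :
    aevalComm (K := K) f hf (∏ i, Polynomial.aeval (MvPolynomial.X i) (g i)) =
      ((List.finRange n).map fun i => Polynomial.aeval (f i) (g i)).prod := by
  rw [Fin.prod_univ_def, aevalComm_list_prod]

/-- The translation `Xᵢ ↦ Xᵢ + bᵢ`. -/
def shift (b : Fin n → ℤ) : MvPolynomial (Fin n) K →ₐ[K] MvPolynomial (Fin n) K :=
  MvPolynomial.aeval fun i => MvPolynomial.X i + (b i : MvPolynomial (Fin n) K)

theorem shift_X (b : Fin n → ℤ) (i : Fin n) :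
    shift K b (MvPolynomial.X i) = MvPolynomial.X i + (b i : MvPolynomial (Fin n) K) := by
  simp [shift]

theorem euler_mul_mW (b : Fin n → ℤ) (i : Fin n) :
    z K i * d K i * mW K b = mW K b * (z K i * d K i + (b i : ℤ)) := by
  rw [mW_eq]
  -- Passing to partial products makes induction possible: the shift by `b i` appears once the index
  -- `i` has entered the list, and the other factors commute with the Euler operator.
  have : ∀ l : List (Fin n), l.Nodup → z K i * d K i *
      (l.map fun i => zdPow (z K i) (d K i) (b i)).prod =
      (l.map fun i => zdPow (z K i) (d K i) (b i)).prod *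
        (z K i * d K i + if i ∈ l then ((b i : ℤ) : Weyl K n) else 0) := by
    intro l hl
    induction l with
    | nil => simp
    | cons j l ih =>
      have ih' := ih (List.nodup_cons.1 hl).2
      rw [List.map_cons, List.prod_cons]
      by_cases hij : i = j
      · subst hij
        rw [if_neg (List.nodup_cons.1 hl).1, add_zero] at ih'
        have hc : Commute ((b i : ℤ) : Weyl K n)
          (l.map fun i => zdPow (z K i) (d K i) (b i)).prod := Int.cast_commute _ _
        rw [if_pos List.mem_cons_self, ← mul_assoc, euler_mul_zdPow (d_mul_z_self K i), mul_assoc,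
          add_mul, ih', mul_assoc, hc.eq, mul_add, mul_add, mul_add]
      · rw [← mul_assoc, ← (commute_zdPow_euler K (Ne.symm hij) (b j)).eq, mul_assoc, ih',
          mul_assoc]
        congr 3
        simp [hij]
  have := this _ (List.nodup_finRange n)
  rwa [if_pos (List.mem_finRange i)] at this

/-- The factor in `m(b') m(b) = m(b' + b) · wallMv b' b`. -/
def wallMv (b' b : Fin n → ℤ) : MvPolynomial (Fin n) K :=
  ∏ i, Polynomial.aeval (MvPolynomial.X i) (wallPoly K (b' i) (b i))

theorem mW_mul_mW (b' b : Fin n → ℤ) :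
    mW K b' * mW K b = mW K (b' + b) * polW K (wallMv K b' b) := by
  rw [mW_eq, mW_eq, mW_eq, wallMv, polW, aevalComm_prod,
    list_prod_mul_list_prod (fun i j hij => commute_zdPow_zdPow K hij _ _) (List.nodup_finRange n),
    list_prod_mul_list_prod (fun i j hij => ?_) (List.nodup_finRange n)]
  · simp only [Pi.add_apply]
    simp_rw [zdPow_mul_zdPow K (d_mul_z_self K _)]
  · exact (aeval_commute K (commute_zdPow_euler K hij _).symm _).symm

/-- The span of the elements `m(b) f(h)` with `b` in a given set. -/
def mSpan (B : Set (Fin n → ℤ)) : Submodule K (Weyl K n) :=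
  Submodule.span K {x | ∃ b ∈ B, ∃ f, x = mW K b * polW K f}

theorem weyl_induction {P : Weyl K n → Prop} (halg : ∀ r : K, P (algebraMap K _ r))
    (hz : ∀ i, P (z K i)) (hd : ∀ i, P (d K i)) (hmul : ∀ x y, P x → P y → P (x * y))
    (hadd : ∀ x y, P x → P y → P (x + y)) (x : Weyl K n) : P x := by
  obtain ⟨x, rfl⟩ := RingQuot.mkAlgHom_surjective K (WeylRel K n) x
  induction x using FreeAlgebra.induction with
  | grade0 r => rw [AlgHom.commutes]; exact halg r
  | grade1 i => rcases i with i | i; exacts [hz i, hd i]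
  | mul a b ha hb => rw [map_mul]; exact hmul _ _ ha hb
  | add a b ha hb => rw [map_add]; exact hadd _ _ ha hb

theorem mW_mul_mem_mSpan (b : Fin n → ℤ) {x : Weyl K n} (hx : x ∈ mSpan K Set.univ) :
    mW K b * x ∈ mSpan K Set.univ := by
  induction hx using Submodule.span_induction with
  | mem x hx =>
    obtain ⟨c, -, f, rfl⟩ := hx
    rw [← mul_assoc, mW_mul_mW, mul_assoc, ← map_mul]
    exact Submodule.subset_span ⟨_, trivial, _, rfl⟩
  | zero => simp
  | add x y _ _ hx hy => rw [mul_add]; exact add_mem hx hy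
  | smul r x _ hx => rw [mul_smul_comm]; exact Submodule.smul_mem _ _ hx

/-- The span contains `1`, and it is stable under left multiplication by the generators because
these are themselves the monomials with exponents `±ε_i`. -/
theorem mSpan_univ : mSpan K (Set.univ : Set (Fin n → ℤ)) = ⊤ := by
  refine eq_top_iff.2 fun x _ => ?_
  suffices h : ∀ x : Weyl K n, ∀ y ∈ mSpan K (Set.univ : Set (Fin n → ℤ)),
      x * y ∈ mSpan K (Set.univ : Set (Fin n → ℤ)) by
    have h1 : (1 : Weyl K n) ∈ mSpan K (Set.univ : Set (Fin n → ℤ)) :=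
      Submodule.subset_span ⟨0, trivial, 1, by rw [mW_zero, map_one, mul_one]⟩
    simpa using h x 1 h1
  intro x
  induction x using weyl_induction with
  | halg r => intro y hy; rw [← Algebra.smul_def]; exact Submodule.smul_mem _ _ hy
  | hz i =>
    intro y hy
    have := mW_mul_mem_mSpan K (Pi.single i 1) hy
    rwa [mW_single, show zdPow (z K i) (d K i) 1 = z K i by simp [zdPow]] at this
  | hd i =>
    intro y hy
    have := mW_mul_mem_mSpan K (Pi.single i (-1)) hy
    rwa [mW_single, show zdPow (z K i) (d K i) (-1) = d K i by simp [zdPow]] at this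
  | hmul x y hx hy => intro t ht; rw [mul_assoc]; exact hx _ (hy _ ht)
  | hadd x y hx hy => intro t ht; rw [add_mul]; exact add_mem (hx _ ht) (hy _ ht)

theorem polW_mem {Γ : Type} [AddCommGroup Γ] (wt : Fin n → Γ) (f : MvPolynomial (Fin n) K) :
    polW K f ∈ weylWeight K wt 0 := by
  induction f using mvPolynomial_induction with
  | hC r =>
    rw [← MvPolynomial.algebraMap_eq, AlgHom.commutes, Algebra.algebraMap_eq_smul_one]
    exact Submodule.smul_mem _ _ (one_mem_weylWeight K wt)
  | hX i =>
    rw [polW_X]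
    simpa using mul_mem_weylWeight K (z_mem K wt i) (d_mem K wt i)
  | hadd f g hf hg => rw [map_add]; exact add_mem hf hg
  | hmul f g hf hg => rw [map_mul]; simpa using mul_mem_weylWeight K hf hg

/-- Taking the coefficient at `γ` of the coaction is a projection: it fixes elements of weight `γ`,
and it keeps or kills each spanning element `m(b) f(h)`, which is homogeneous. -/
theorem mem_mSpan_of_mem_weylWeight {Γ : Type} [AddCommGroup Γ] (wt : Fin n → Γ) (γ : Γ)
    {x : Weyl K n} (hx : x ∈ weylWeight K wt γ) : x ∈ mSpan K {b | ∑ i, b i • wt i = γ} := by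
  have key : ∀ y ∈ mSpan K (Set.univ : Set (Fin n → ℤ)),
      (coaction K wt y).coeff γ ∈ mSpan K {b | ∑ i, b i • wt i = γ} := by
    intro y hy
    induction hy using Submodule.span_induction with
    | mem y hy =>
      obtain ⟨b, -, f, rfl⟩ := hy
      have h1 : coaction K wt (mW K b * polW K f) = AddMonoidAlgebra.single _ _ :=
        mul_mem_weylWeight K (mW_mem K wt b) (polW_mem K wt f)
      rw [add_zero] at h1
      rw [h1]
      classical
      by_cases hb : ∑ i, b i • wt i = γ
      · rw [hb]
        rw [AddMonoidAlgebra.coeff_single, Finsupp.single_eq_same]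
        exact Submodule.subset_span ⟨b, hb, f, rfl⟩
      · rw [AddMonoidAlgebra.coeff_single, Finsupp.single_eq_of_ne (Ne.symm hb)]
        exact zero_mem _
    | zero => rw [map_zero]; exact zero_mem _
    | add x y _ _ hx hy => rw [map_add]; exact add_mem hx hy
    | smul r x _ hx => rw [map_smul]; exact Submodule.smul_mem _ _ hx
  have := key x (by rw [mSpan_univ]; trivial)
  have hx' : coaction K wt x = AddMonoidAlgebra.single γ x := hx
  rw [hx'] at this
  rw [AddMonoidAlgebra.coeff_single, Finsupp.single_eq_same] at this
  exact this

end WeylMonomials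

/-! ### Monomials in the central quotients -/

section QuotientMonomials

variable (K : Type u) [Field K] {n k : ℕ} (w : Fin n → Fin k → ℤ) (lam : Fin k → ℤ)

theorem hPlus_commute (i j : Fin n) : Commute (hPlus K w i) (hPlus K w j) :=
  Subtype.ext (zd_mul_comm K i j)

/-- Polynomials in the `hᵢ⁺` in the hypertoric enveloping algebra. -/
def polH : MvPolynomial (Fin n) K →ₐ[K] HEA K w :=
  aevalComm (hPlus K w) (hPlus_commute K w)

theorem coe_polH (f : MvPolynomial (Fin n) K) : (polH K w f : Weyl K n) = polW K f := by
  have : (HEA K w).val.comp (polH K w) = polW K := by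
    refine MvPolynomial.algHom_ext fun i => ?_
    rw [AlgHom.comp_apply, polH, aevalComm_X, polW_X]
    rfl
  exact DFunLike.congr_fun this f

theorem mW_mem_HEA {b : Fin n → ℤ} (hb : ∑ i, b i • w i = 0) : mW K b ∈ HEA K w := by
  rw [mem_HEA, ← hb]
  exact mW_mem K w b

/-- The monomial `m(b)` in the hypertoric enveloping algebra. -/
def mH (b : Fin n → ℤ) (hb : ∑ i, b i • w i = 0) : HEA K w := ⟨mW K b, mW_mem_HEA K w hb⟩

theorem m_eq (b : Fin n → ℤ) (hb : ∑ i, b i • w i = 0) :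
    m K w lam b hb = toQuot K w lam (mH K w b hb) := rfl

/-- Polynomials in the elements `hᵢ⁺ - aᵢ` of `A^λ`. -/
def sA (a : Fin n → ℤ) : MvPolynomial (Fin n) K →ₐ[K] HEAQuot K w lam :=
  aevalComm (fun i => h K w lam i - (a i : HEAQuot K w lam)) (hsub_commute K w lam a)

@[simp]
theorem sA_X (a : Fin n → ℤ) (i : Fin n) :
    sA K w lam a (MvPolynomial.X i) = h K w lam i - (a i : HEAQuot K w lam) := aevalComm_X _ _ i

theorem sA_shift (a b : Fin n → ℤ) (f : MvPolynomial (Fin n) K) :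
    sA K w lam (a + b) (shift K b f) = sA K w lam a f := by
  have : (sA K w lam (a + b)).comp (shift K b) = sA K w lam a := by
    refine MvPolynomial.algHom_ext fun i => ?_
    rw [AlgHom.comp_apply, shift_X, map_add, map_intCast, sA_X, sA_X, Pi.add_apply, Int.cast_add]
    abel
  exact DFunLike.congr_fun this f

theorem toQuot_polH (f : MvPolynomial (Fin n) K) :
    toQuot K w lam (polH K w f) = sA K w lam 0 f := by
  have : (toQuot K w lam).comp (polH K w) = sA K w lam 0 := by
    refine MvPolynomial.algHom_ext fun i => ?_
    rw [AlgHom.comp_apply, sA_X, polH, aevalComm_X, Pi.zero_apply, Int.cast_zero, sub_zero]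
    rfl
  exact DFunLike.congr_fun this f

theorem toQuot_polH' (a : Fin n → ℤ) (f : MvPolynomial (Fin n) K) :
    toQuot K w lam (polH K w f) = sA K w lam a (shift K a f) := by
  rw [toQuot_polH, ← sA_shift K w lam 0 a, zero_add]

theorem toQuot_surjective : Function.Surjective (toQuot K w lam) :=
  RingQuot.mkAlgHom_surjective K (HEARel K w lam)

theorem toQuot_intCast (r : ℤ) : toQuot K w lam (r : HEA K w) = (r : HEAQuot K w lam) :=
  map_intCast (α := HEA K w) (β := HEAQuot K w lam)
    (show @RingHom (HEA K w) (HEAQuot K w lam) _ Ring.toNonAssocRing.toNonAssocSemiring from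
      (toQuot K w lam).toRingHom) r

theorem h_mul_m (b : Fin n → ℤ) (hb : ∑ i, b i • w i = 0) (i : Fin n) :
    h K w lam i * m K w lam b hb = m K w lam b hb * (h K w lam i + (b i : ℤ)) := by
  rw [m_eq, h, ← map_mul, ← toQuot_intCast]
  refine Eq.trans ?_ ((map_mul _ _ _).trans (congrArg _ (map_add _ _ _)))
  congr 1
  exact Subtype.ext (by simpa using! euler_mul_mW K b i)

theorem sA_mul_m (a b : Fin n → ℤ) (hb : ∑ i, b i • w i = 0) (f : MvPolynomial (Fin n) K) :
    sA K w lam (a + b) f * m K w lam b hb = m K w lam b hb * sA K w lam a f := by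
  refine intertwine (fun i => ?_) f
  rw [sA_X, sA_X, sub_mul, h_mul_m, mul_add, mul_sub, Pi.add_apply, Int.cast_add, add_mul,
    (Int.cast_commute (a i) (m K w lam b hb)).eq, (Int.cast_commute (b i) (m K w lam b hb)).eq]
  abel

theorem sum_add_smul_eq_zero {b b' : Fin n → ℤ} (hb' : ∑ i, b' i • w i = 0)
    (hb : ∑ i, b i • w i = 0) : ∑ i, (b' + b) i • w i = 0 := by
  simp only [Pi.add_apply, add_smul, Finset.sum_add_distrib, hb, hb', add_zero]

theorem mH_mul_mH {b b' : Fin n → ℤ} (hb' : ∑ i, b' i • w i = 0) (hb : ∑ i, b i • w i = 0) :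
    mH K w b' hb' * mH K w b hb =
      mH K w (b' + b) (sum_add_smul_eq_zero w hb' hb) * polH K w (wallMv K b' b) := by
  refine Subtype.ext ?_
  rw [Subalgebra.coe_mul, Subalgebra.coe_mul, coe_polH]
  exact mW_mul_mW K b' b

theorem m_mul_m (a : Fin n → ℤ) {b b' : Fin n → ℤ} (hb' : ∑ i, b' i • w i = 0)
    (hb : ∑ i, b i • w i = 0) :
    m K w lam b' hb' * m K w lam b hb =
      m K w lam (b' + b) (sum_add_smul_eq_zero w hb' hb) *
        sA K w lam a (shift K a (wallMv K b' b)) := by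
  rw [m_eq, m_eq, ← map_mul, mH_mul_mH, map_mul, toQuot_polH' K w lam a]
  rfl

theorem m_zero (h0 : ∑ i, (0 : Fin n → ℤ) i • w i = 0) : m K w lam 0 h0 = 1 := by
  rw [m_eq, ← map_one (toQuot K w lam)]
  congr 1
  exact Subtype.ext (mW_zero K)

theorem HEA_span (x : HEA K w) :
    x ∈ Submodule.span K {y | ∃ b, ∃ hb : ∑ i, b i • w i = 0, ∃ f, y = mH K w b hb * polH K w f} := by
  have hx := mem_mSpan_of_mem_weylWeight K w 0 ((mem_HEA K w).1 x.2)
  have : mSpan K {b | ∑ i, b i • w i = 0} ≤ (Submodule.span K {y : HEA K w | ∃ b,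
      ∃ hb : ∑ i, b i • w i = 0, ∃ f, y = mH K w b hb * polH K w f}).map
        (HEA K w).val.toLinearMap := by
    refine Submodule.span_le.2 ?_
    rintro _ ⟨b, hb, f, rfl⟩
    exact ⟨mH K w b hb * polH K w f, Submodule.subset_span ⟨b, hb, f, rfl⟩, by
      change ((mH K w b hb * polH K w f : HEA K w) : Weyl K n) = _
      rw [Subalgebra.coe_mul, coe_polH]; rfl⟩
  obtain ⟨y, hy, e⟩ := this hx
  have : y = x := Subtype.ext e
  exact this ▸ hy

/-- Scalars are absorbed in the polynomial factor, so closure under addition is enough. -/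
theorem HEA_induction {P : HEA K w → Prop}
    (hm : ∀ b (hb : ∑ i, b i • w i = 0) f, P (mH K w b hb * polH K w f))
    (hadd : ∀ x y, P x → P y → P (x + y)) (x : HEA K w) : P x := by
  have h0 : ∑ i, (0 : Fin n → ℤ) i • w i = 0 := by simp
  refine Submodule.closure_induction (p := fun x _ => P x) ?_ (fun x y _ _ => hadd x y) ?_
    (HEA_span K w x)
  · simpa using hm 0 h0 0
  · rintro r _ ⟨b, hb, f, rfl⟩
    have := hm b hb (r • f)
    rwa [map_smul, mul_smul_comm] at this

theorem HEAQuot_induction (a : Fin n → ℤ) {P : HEAQuot K w lam → Prop}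
    (hm : ∀ b (hb : ∑ i, b i • w i = 0) f, P (m K w lam b hb * sA K w lam a f))
    (hadd : ∀ x y, P x → P y → P (x + y)) (x : HEAQuot K w lam) : P x := by
  obtain ⟨x, rfl⟩ := toQuot_surjective K w lam x
  induction x using HEA_induction with
  | hm b hb f => rw [map_mul, toQuot_polH' K w lam a]; exact hm b hb _
  | hadd x y hx hy => rw [map_add]; exact hadd _ _ hx hy

theorem sum_smul_single (c : Fin n → ℤ) : ∑ i, c i • (Pi.single i 1 : Fin n → ℤ) = c := by
  ext j
  simp [Finset.sum_apply, Pi.single_apply]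

theorem m_mem_quotWeight (b : Fin n → ℤ) (hb : ∑ i, b i • w i = 0) :
    m K w lam b hb ∈ quotWeight K w lam b := by
  refine ⟨mH K w b hb, ?_, rfl⟩
  have := mW_mem K (fun i : Fin n => (Pi.single i 1 : Fin n → ℤ)) b
  rwa [sum_smul_single] at this

theorem m_mul_sA_mem_quotWeight (a b : Fin n → ℤ) (hb : ∑ i, b i • w i = 0)
    (f : MvPolynomial (Fin n) K) :
    m K w lam b hb * sA K w lam a f ∈ quotWeight K w lam b := by
  have e : f = shift K a (shift K (-a) f) := by
    have : (shift K a).comp (shift K (-a)) = AlgHom.id K (MvPolynomial (Fin n) K) := by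
      refine MvPolynomial.algHom_ext fun i => ?_
      rw [AlgHom.comp_apply, shift_X, map_add, map_intCast, shift_X]
      simp
    exact (DFunLike.congr_fun this f).symm
  rw [e, ← toQuot_polH' K w lam a]
  obtain ⟨x, hx, hx'⟩ := m_mem_quotWeight K w lam b hb
  refine ⟨x * polH K w (shift K (-a) f), ?_, ?_⟩
  · change ((x * polH K w (shift K (-a) f) : HEA K w) : Weyl K n) ∈ weylWeight K _ b
    rw [Subalgebra.coe_mul, coe_polH]
    have := mul_mem_weylWeight K hx
      (polW_mem K (fun i : Fin n => (Pi.single i 1 : Fin n → ℤ)) (shift K (-a) f))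
    rwa [add_zero] at this
  · rw [← hx']; exact map_mul (toQuot K w lam) _ _

/-- A lift of `x` to the Weyl algebra has `D`-weight `b`, hence is `m(b)` times a polynomial in the
`h_i`. It is also `T`-invariant, so if `b` is nontrivial on `T` it has two different `T`-weights and
vanishes. -/
theorem mem_quotWeight (a : Fin n → ℤ) {b : Fin n → ℤ} {x : HEAQuot K w lam}
    (hx : x ∈ quotWeight K w lam b) :
    x = 0 ∨ ∃ (hb : ∑ i, b i • w i = 0) (f : MvPolynomial (Fin n) K),
      x = m K w lam b hb * sA K w lam a f := by
  obtain ⟨y, hy, rfl⟩ := hx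
  have hy' := mem_mSpan_of_mem_weylWeight K _ b hy
  have hset : {c : Fin n → ℤ | ∑ i, c i • (Pi.single i 1 : Fin n → ℤ) = b} = {b} := by
    ext c
    rw [Set.mem_ofPred_eq, sum_smul_single, Set.mem_singleton_iff]
  rw [hset] at hy'
  obtain ⟨f, hf⟩ : ∃ f, (y : Weyl K n) = mW K b * polW K f := by
    change (y : Weyl K n) ∈ _ at hy'
    revert hy'
    generalize (y : Weyl K n) = y'
    intro hy'
    induction hy' using Submodule.span_induction with
    | mem x hx => obtain ⟨c, hc, f, rfl⟩ := hx; rw [Set.mem_singleton_iff.1 hc]; exact ⟨f, rfl⟩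
    | zero => exact ⟨0, by simp⟩
    | add x y _ _ hx hy =>
      obtain ⟨f, rfl⟩ := hx
      obtain ⟨g, rfl⟩ := hy
      exact ⟨f + g, by rw [map_add, mul_add]⟩
    | smul r x _ hx =>
      obtain ⟨f, rfl⟩ := hx
      exact ⟨r • f, by rw [map_smul, mul_smul_comm]⟩
  by_cases hb : ∑ i, b i • w i = 0
  · refine Or.inr ⟨hb, shift K a f, ?_⟩
    have : y = mH K w b hb * polH K w f := Subtype.ext (by
      rw [Subalgebra.coe_mul, coe_polH]; exact hf)
    rw [this, m_eq, ← toQuot_polH' K w lam a, ← map_mul]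
    rfl
  · left
    have h1 := mul_mem_weylWeight K (mW_mem K w b) (polW_mem K w f)
    rw [← hf, add_zero] at h1
    have h1' : coaction K w (y : Weyl K n) = AddMonoidAlgebra.single _ _ := h1
    have h2 : coaction K w (y : Weyl K n) = AddMonoidAlgebra.single 0 (y : Weyl K n) :=
      (mem_HEA K w).1 y.2
    rw [h1'] at h2
    have h3 := congrArg (fun t => t.coeff 0) h2
    simp only [AddMonoidAlgebra.coeff_single, Finsupp.single_eq_same] at h3
    rw [Finsupp.single_eq_of_ne (Ne.symm hb)] at h3
    have : y = 0 := Subtype.ext h3.symm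
    rw [this]
    exact map_zero (toQuot K w lam)

/-- Multiplication by an element of `A^λ` of weight `b` intertwines the polynomials in the
`hᵢ⁺ - aᵢ - bᵢ` and those in the `hᵢ⁺ - aᵢ`. -/
theorem sA_mul_of_mem_quotWeight (a : Fin n → ℤ) {b : Fin n → ℤ} {x : HEAQuot K w lam}
    (hx : x ∈ quotWeight K w lam b) (f : MvPolynomial (Fin n) K) :
    sA K w lam (a + b) f * x = x * sA K w lam a f := by
  rcases mem_quotWeight K w lam a hx with rfl | ⟨hb, g, rfl⟩
  · rw [mul_zero, zero_mul]
  · rw [← mul_assoc, sA_mul_m, mul_assoc, mul_assoc, ← map_mul, ← map_mul, mul_comm f g]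

end QuotientMonomials

/-! ### The power series `q` and the walls between chambers -/

section Series

variable (K : Type u) [Field K]

open Classical PowerSeries in
theorem mul_qSeries (c : K) : (X + C c) * qSeries K c = if c = 0 then X else 1 := by
  rw [qSeries]
  split_ifs with h
  · rw [h, map_zero, add_zero, mul_one]
  · exact PowerSeries.mul_inv_cancel _ (by simpa using h)

theorem qProd_add_one {b : ℤ} (hb : 0 ≤ b) (a : ℤ) :
    qProd K a (b + 1) = qProd K a b * qSeries K ((a + b + 1 : ℤ) : K) := by
  obtain ⟨l, rfl⟩ := Int.eq_ofNat_of_zero_le hb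
  rw [qProd, qProd, show ((l : ℤ) + 1).toNat = l + 1 by omega, Finset.prod_Icc_succ_top (by omega)]
  simp [add_assoc]

theorem qProd_of_nonpos {b : ℤ} (hb : b ≤ 0) (a : ℤ) : qProd K a b = 1 := by
  rw [qProd, show b.toNat = 0 by omega]
  simp

open Classical in
/-- An inverse of `qProd`. -/
def qInv (a b : ℤ) : Polynomial K :=
  ∏ j ∈ Finset.Icc 1 b.toNat, if ((a + (j : ℤ) : ℤ) : K) = 0 then 1 else
    Polynomial.X + Polynomial.C ((a + (j : ℤ) : ℤ) : K)

theorem qInv_mul_qProd (a b : ℤ) : (qInv K a b : PowerSeries K) * qProd K a b = 1 := by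
  classical
  have e : (qInv K a b : PowerSeries K) = ∏ j ∈ Finset.Icc 1 b.toNat,
      ((if ((a + (j : ℤ) : ℤ) : K) = 0 then 1 else
        Polynomial.X + Polynomial.C ((a + (j : ℤ) : ℤ) : K) : Polynomial K) : PowerSeries K) := by
    rw [qInv, ← Polynomial.coeToPowerSeries.ringHom_apply, map_prod]
    simp only [Polynomial.coeToPowerSeries.ringHom_apply]
  rw [e, qProd, ← Finset.prod_mul_distrib]
  refine Finset.prod_eq_one fun j _ => ?_
  have := mul_qSeries K ((a + (j : ℤ) : ℤ) : K)
  split_ifs at this ⊢ with h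
  · rw [h, qSeries, if_pos rfl]; simp
  · rwa [Polynomial.coe_add, Polynomial.coe_X, Polynomial.coe_C]

/-- The factor in `z^{b'} z^b = z^{b' + b} · wallPoly b' b` as a polynomial in `h - a`. -/
def wallPolyAt (a b' b : ℤ) : Polynomial K :=
  (wallPoly K b' b).comp (Polynomial.X + Polynomial.C (a : K))

theorem wallPolyAt_zero (a b : ℤ) : wallPolyAt K a 0 b = 1 := by
  simp [wallPolyAt, wallPoly_zero]

theorem wallPolyAt_add_one (a : ℤ) {b' : ℤ} (hb' : 0 ≤ b') (b : ℤ) :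
    wallPolyAt K a (b' + 1) b = wallPolyAt K a b' b *
      if b' + b < 0 then Polynomial.X + Polynomial.C ((a + (b' + b) + 1 : ℤ) : K) else 1 := by
  rw [wallPolyAt, wallPoly_add_one K hb', Polynomial.mul_comp, wallPolyAt]
  congr 1
  split_ifs
  · simp; ring
  · simp

theorem wallPolyAt_sub_one (a : ℤ) {b' : ℤ} (hb' : b' ≤ 0) (b : ℤ) :
    wallPolyAt K a (b' - 1) b = wallPolyAt K a b' b *
      if 0 < b' + b then Polynomial.X + Polynomial.C ((a + (b' + b) : ℤ) : K) else 1 := by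
  rw [wallPolyAt, wallPoly_sub_one K hb', Polynomial.mul_comp, wallPolyAt]
  congr 1
  split_ifs
  · simp; ring
  · simp

/-- The quotient of a coordinate by `p` is its chamber, so this records that a unit step changes
chamber exactly when it arrives at a multiple of `p`. -/
theorem add_one_ediv {p : ℕ} (hp : 0 < p) (c : ℤ) :
    (c + 1) / (p : ℤ) = c / p + if (p : ℤ) ∣ c + 1 then 1 else 0 := by
  have hp' : (0 : ℤ) < p := by exact_mod_cast hp
  have h1 := Int.emod_add_mul_ediv c p
  have h2 := Int.emod_nonneg c hp'.ne'
  have h3 := Int.emod_lt_of_pos c hp'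
  split_ifs with h
  · obtain ⟨t, ht⟩ := h
    rw [ht, Int.mul_ediv_cancel_left _ hp'.ne']
    have h4 : (p : ℤ) * (t - c / p - 1) < p * 1 := by
      have : (p : ℤ) * (t - c / p - 1) = c % p + 1 - p := by rw [mul_sub, mul_sub, ← ht]; omega
      omega
    have h5 : (p : ℤ) * (-1) < p * (t - c / p - 1) := by
      have : (p : ℤ) * (t - c / p - 1) = c % p + 1 - p := by rw [mul_sub, mul_sub, ← ht]; omega
      omega
    have h6 := lt_of_mul_lt_mul_left h4 hp'.le
    have h7 := lt_of_mul_lt_mul_left h5 hp'.le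
    omega
  · have h4 : c % p + 1 ≠ p := by
      intro h4
      exact h ⟨c / p + 1, by rw [mul_add]; omega⟩
    rw [add_zero]
    refine (Int.ediv_eq_iff_of_pos hp').2 ⟨?_, ?_⟩
    · rw [mul_comm]; omega
    · rw [mul_comm]; omega

variable (p : ℕ) [Fact p.Prime] [CharP K p]

-- This is where `η` comes from. A wall at `a + j` crossed twice contributes `X + (a + j)`. If `p`
-- does not divide `a + j`, this is the inverse of the factor `q` belonging to the upward crossing;
-- otherwise `q = 1` and the contribution is `X`. The number of walls of the second kind is `η` of
-- the three chambers. The proof is by unit steps in `b'`.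
open Classical PowerSeries in
theorem wall_identity (a b' b : ℤ) :
    (wallPolyAt K a b' b : PowerSeries K) * (qProd K (a + b) b' * qProd K a b) =
      X ^ eta ((a + (b' + b)) / p) ((a + b) / p) (a / p) * qProd K a (b' + b) := by
  have hp : 0 < p := (Fact.out : p.Prime).pos
  have hp' : (0 : ℤ) < p := by exact_mod_cast hp
  have hmono : ∀ {s t : ℤ}, s ≤ t → s / (p : ℤ) ≤ t / p := fun h => Int.ediv_le_ediv hp' h
  rcases le_total 0 b' with h | h
  · obtain ⟨l, rfl⟩ := Int.eq_ofNat_of_zero_le h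
    clear h
    induction l with
    | zero =>
      have : eta ((a + b) / p) ((a + b) / p) (a / p) = 0 := by simp [eta]
      simp [wallPolyAt_zero, qProd_of_nonpos, this]
    | succ l ih =>
      have hl : (0 : ℤ) ≤ l := Int.natCast_nonneg l
      push_cast
      rw [wallPolyAt_add_one K a hl, qProd_add_one K hl,
        show a + b + (l : ℤ) + 1 = a + (l + b) + 1 by ring,
        show a + ((l : ℤ) + 1 + b) = a + (l + b) + 1 by ring,
        show (l : ℤ) + 1 + b = l + b + 1 by ring, add_one_ediv hp]
      set e := (l : ℤ) + b with he
      have h1 : (a + b) / (p : ℤ) ≤ (a + e) / p := hmono (by omega)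
      rw [Polynomial.coe_mul, mul_right_comm (qProd K (a + b) l),
        mul_mul_mul_comm, ih]
      -- The cases are whether the wall is being recrossed and whether it bounds a chamber.
      -- Recrossing a boundary raises `η` by one; recrossing another wall cancels its factor `q`; a
      -- wall crossed for the first time extends the product on the right and leaves `η` unchanged.
      split_ifs with hlt hd hd
      · have h2 : (a + e + 1) / (p : ℤ) ≤ a / p := hmono (by omega)
        rw [add_one_ediv hp, if_pos hd] at h2
        have h3 : eta ((a + e) / p + 1) ((a + b) / p) (a / p) =
            eta ((a + e) / p) ((a + b) / p) (a / p) + 1 := by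
          simp only [eta, abs_eq_max_neg]; omega
        rw [Polynomial.coe_add, Polynomial.coe_X, Polynomial.coe_C, mul_qSeries,
          if_pos ((CharP.intCast_eq_zero_iff K p _).2 hd), h3, qProd_of_nonpos K (by omega),
          qProd_of_nonpos K (by omega), pow_succ]
        ring
      · rw [Polynomial.coe_add, Polynomial.coe_X, Polynomial.coe_C, mul_qSeries,
          if_neg (fun h => hd ((CharP.intCast_eq_zero_iff K p _).1 h)), add_zero,
          qProd_of_nonpos K (show e ≤ 0 by omega), qProd_of_nonpos K (by omega), mul_one]
      · have h2 : a / (p : ℤ) ≤ (a + e) / p := hmono (by omega)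
        have h3 : eta ((a + e) / p + 1) ((a + b) / p) (a / p) =
            eta ((a + e) / p) ((a + b) / p) (a / p) := by
          simp only [eta, abs_eq_max_neg]; omega
        rw [h3, qProd_add_one K (by omega), Polynomial.coe_one]
        ring
      · rw [qProd_add_one K (by omega), Polynomial.coe_one, add_zero]
        ring
  · obtain ⟨l, rfl⟩ : ∃ l : ℕ, b' = -(l : ℤ) := ⟨(-b').toNat, by omega⟩
    clear h
    induction l with
    | zero =>
      have : eta ((a + b) / p) ((a + b) / p) (a / p) = 0 := by simp [eta]
      simp [wallPolyAt_zero, qProd_of_nonpos, this]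
    | succ l ih =>
      rw [qProd_of_nonpos K (by omega), one_mul] at ih ⊢
      push_cast
      rw [neg_add, ← sub_eq_add_neg, wallPolyAt_sub_one K a (by omega),
        show -(l : ℤ) - 1 + b = -(l : ℤ) + b - 1 by ring]
      set e := -(l : ℤ) + b with he
      have h1 : (a + e) / (p : ℤ) ≤ (a + b) / p := hmono (by omega)
      have hdiv := add_one_ediv hp (a + (e - 1))
      rw [show a + (e - 1) + 1 = a + e by ring] at hdiv
      rw [Polynomial.coe_mul, mul_right_comm, ih, hdiv]
      rw [hdiv] at h1
      by_cases hlt : 0 < e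
      · rw [if_pos hlt, Polynomial.coe_add, Polynomial.coe_X, Polynomial.coe_C]
        -- A downward step with `e > 0` undoes the last upward step of the first leg, so the factor
        -- `q` of that step must be cancelled from the right-hand side.
        have h4 : qProd K a e = qProd K a (e - 1) * qSeries K ((a + e : ℤ) : K) := by
          have := qProd_add_one K (show 0 ≤ e - 1 by omega) a
          rwa [show e - 1 + 1 = e by ring, show a + (e - 1) + 1 = a + e by ring] at this
        have h5 : ∀ t : PowerSeries K, t * qProd K a e * (X + C ((a + e : ℤ) : K)) =
            t * qProd K a (e - 1) * if ((a + e : ℤ) : K) = 0 then X else 1 := fun t => by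
          rw [h4, ← mul_qSeries]; ring
        rw [h5]
        have h2 : a / (p : ℤ) ≤ (a + (e - 1)) / p := hmono (by omega)
        by_cases hd : (p : ℤ) ∣ a + e
        · rw [if_pos hd] at h1 ⊢
          rw [if_pos ((CharP.intCast_eq_zero_iff K p _).2 hd)]
          have h3 : eta ((a + (e - 1)) / p) ((a + b) / p) (a / p) =
              eta ((a + (e - 1)) / p + 1) ((a + b) / p) (a / p) + 1 := by
            simp only [eta, abs_eq_max_neg]; omega
          rw [h3, pow_succ]
          ring
        · rw [if_neg hd, if_neg (fun h => hd ((CharP.intCast_eq_zero_iff K p _).1 h)), add_zero, mul_one]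
      · rw [if_neg hlt, Polynomial.coe_one, mul_one, qProd_of_nonpos K (show e ≤ 0 by omega),
          qProd_of_nonpos K (show e - 1 ≤ 0 by omega)]
        congr 2
        have h2 : (a + e) / (p : ℤ) ≤ a / p := hmono (by omega)
        rw [hdiv] at h2
        split_ifs at h1 h2 ⊢
        · simp only [eta, abs_eq_max_neg]; omega
        · rw [add_zero]

end Series

/-! ### Truncation -/

section Truncation

variable (K : Type u) [Field K]

/-- Congruence of polynomials modulo `X ^ N`. -/
theorem X_pow_dvd_of_coe {N : ℕ} {f g : Polynomial K}
    (hfg : (PowerSeries.X : PowerSeries K) ^ N ∣ (f : PowerSeries K) - g) :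
    (Polynomial.X : Polynomial K) ^ N ∣ f - g := by
  rw [Polynomial.X_pow_dvd_iff]
  intro e he
  have := PowerSeries.X_pow_dvd_iff.1 hfg e he
  simpa using this

theorem X_pow_dvd_trunc_sub (N : ℕ) (f : PowerSeries K) :
    (PowerSeries.X : PowerSeries K) ^ N ∣ (PowerSeries.trunc N f : PowerSeries K) - f := by
  rw [PowerSeries.X_pow_dvd_iff]
  intro e he
  simp [PowerSeries.coeff_trunc, he]

variable {n : ℕ}

/-- The ideal generated by the `N`-th powers of the variables. -/
def powIdeal (n : ℕ) (N : ℕ) : Ideal (MvPolynomial (Fin n) K) :=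
  Ideal.span (Set.range fun i => MvPolynomial.X i ^ N)

theorem aeval_sub_mem_powIdeal {N : ℕ} {f g : Polynomial K}
    (hfg : (Polynomial.X : Polynomial K) ^ N ∣ f - g) (i : Fin n) :
    Polynomial.aeval (MvPolynomial.X i) f - Polynomial.aeval (MvPolynomial.X i) g ∈
      powIdeal K n N := by
  obtain ⟨t, ht⟩ := hfg
  rw [← map_sub, ht, map_mul, map_pow, Polynomial.aeval_X, mul_comm]
  exact Ideal.mul_mem_left _ _ (Ideal.subset_span ⟨i, rfl⟩)

theorem prod_aeval_sub_mem_powIdeal {N : ℕ} {f g : Fin n → Polynomial K}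
    (hfg : ∀ i, (Polynomial.X : Polynomial K) ^ N ∣ f i - g i) :
    ∏ i, Polynomial.aeval (MvPolynomial.X i : MvPolynomial (Fin n) K) (f i) -
      ∏ i, Polynomial.aeval (MvPolynomial.X i) (g i) ∈ powIdeal K n N := by
  rw [← Ideal.Quotient.eq, map_prod, map_prod]
  exact Finset.prod_congr rfl fun i _ => Ideal.Quotient.eq.2 (aeval_sub_mem_powIdeal K (hfg i) i)

/-- The truncation of `∏ᵢ ∏_{j = 1}^{bᵢ} q(Xᵢ, aᵢ + j)`. -/
def qMv (a b : Fin n → ℤ) (N : ℕ) : MvPolynomial (Fin n) K :=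
  ∏ i, Polynomial.aeval (MvPolynomial.X i) (PowerSeries.trunc N (qProd K (a i) (b i)))

/-- An inverse of `qMv`. -/
def qInvMv (a b : Fin n → ℤ) : MvPolynomial (Fin n) K :=
  ∏ i, Polynomial.aeval (MvPolynomial.X i) (qInv K (a i) (b i))

theorem qInvMv_mul_qMv (a b : Fin n → ℤ) (N : ℕ) :
    qInvMv K a b * qMv K a b N - 1 ∈ powIdeal K n N := by
  have := prod_aeval_sub_mem_powIdeal K (N := N)
    (f := fun i => qInv K (a i) (b i) * PowerSeries.trunc N (qProd K (a i) (b i)))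
    (g := fun _ => 1) (fun i => X_pow_dvd_of_coe K ?_)
  · simpa [qInvMv, qMv, Finset.prod_mul_distrib] using this
  · rw [Polynomial.coe_mul, Polynomial.coe_one, ← qInv_mul_qProd K (a i) (b i), ← mul_sub]
    exact Dvd.dvd.mul_left (X_pow_dvd_trunc_sub K N _) _

theorem shift_wallMv (a b' b : Fin n → ℤ) : shift K a (wallMv K b' b) =
    ∏ i, Polynomial.aeval (MvPolynomial.X i) (wallPolyAt K (a i) (b' i) (b i)) := by
  rw [wallMv, map_prod]
  refine Finset.prod_congr rfl fun i _ => ?_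
  rw [algHom_aeval, shift_X, wallPolyAt, Polynomial.aeval_comp]
  simp

variable (p : ℕ) [Fact p.Prime] [CharP K p]

/-- The monomial `∏ᵢ Xᵢ^{ηᵢ(x, y, u)}`. -/
def etaMv (x y u : Fin n → ℤ) : MvPolynomial (Fin n) K :=
  ∏ i, MvPolynomial.X i ^ eta (x i) (y i) (u i)

/-- After truncation the power series identity holds only modulo `N`-th powers of the variables,
which is all that is seen by vectors killed by those powers. -/
theorem wallMv_identity (a b' b : Fin n → ℤ) (N : ℕ) :
    shift K a (wallMv K b' b) * (qMv K (a + b) b' N * qMv K a b N) -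
      etaMv K (fun i => (a i + (b' i + b i)) / p) (fun i => (a i + b i) / p) (fun i => a i / p) *
        qMv K a (b' + b) N ∈ powIdeal K n N := by
  have := prod_aeval_sub_mem_powIdeal K (N := N)
    (f := fun i => wallPolyAt K (a i) (b' i) (b i) *
      (PowerSeries.trunc N (qProd K (a i + b i) (b' i)) *
        PowerSeries.trunc N (qProd K (a i) (b i))))
    (g := fun i => Polynomial.X ^ eta ((a i + (b' i + b i)) / p) ((a i + b i) / p) (a i / p) *
      PowerSeries.trunc N (qProd K (a i) (b' i + b i))) (fun i => X_pow_dvd_of_coe K ?_)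
  · simpa [shift_wallMv, etaMv, qMv, Finset.prod_mul_distrib] using this
  -- Modulo `X ^ N` a series and its truncation coincide, so the untruncated identity can be
  -- applied.
  · rw [← Ideal.mem_span_singleton, ← Ideal.Quotient.eq]
    have ht : ∀ f : PowerSeries K, Ideal.Quotient.mk (Ideal.span {PowerSeries.X ^ N})
        (PowerSeries.trunc N f : PowerSeries K) = Ideal.Quotient.mk _ f := fun f =>
      Ideal.Quotient.eq.2 (Ideal.mem_span_singleton.2 (X_pow_dvd_trunc_sub K N f))
    simp only [Polynomial.coe_mul, Polynomial.coe_pow, Polynomial.coe_X, map_mul, ht]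
    rw [← map_mul, ← map_mul, ← map_mul, wall_identity K p]

end Truncation

/-! ### Generalized weight vectors -/

section Vectors

variable {K : Type u} [Field K] {n k : ℕ} {w : Fin n → Fin k → ℤ} {lam : Fin k → ℤ}
  {M : Type u} [AddCommGroup M] [Module (HEAQuot K w lam) M]

variable (K w lam) in
/-- `v` is killed by the `N`-th powers of the `hᵢ⁺ - aᵢ`. -/
def Kills (a : Fin n → ℤ) (N : ℕ) (v : M) : Prop :=
  ∀ i, (h K w lam i - (a i : HEAQuot K w lam)) ^ N • v = 0

theorem Kills.sA_smul_eq_zero {a : Fin n → ℤ} {N : ℕ} {v : M} (hv : Kills K w lam a N v)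
    {f : MvPolynomial (Fin n) K} (hf : f ∈ powIdeal K n N) : sA K w lam a f • v = 0 := by
  induction hf using Submodule.span_induction with
  | mem f hf => obtain ⟨i, rfl⟩ := hf; rw [map_pow, sA_X]; exact hv i
  | zero => rw [map_zero, zero_smul]
  | add f g _ _ hf hg => rw [map_add, add_smul, hf, hg, add_zero]
  | smul f g _ hg => rw [smul_eq_mul, map_mul, mul_smul, hg, smul_zero]

theorem Kills.sA_smul_congr {a : Fin n → ℤ} {N : ℕ} {v : M} (hv : Kills K w lam a N v)
    {f g : MvPolynomial (Fin n) K} (hfg : f - g ∈ powIdeal K n N) :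
    sA K w lam a f • v = sA K w lam a g • v := by
  rw [← sub_eq_zero, ← sub_smul, ← map_sub, hv.sA_smul_eq_zero hfg]

theorem kills_iff {a : Fin n → ℤ} {N : ℕ} {v : M} : Kills K w lam a N v ↔
    ∀ i, sA K w lam a (MvPolynomial.X i ^ N) • v = 0 := by
  simp only [map_pow, sA_X]
  rfl

theorem Kills.sA_smul {a : Fin n → ℤ} {N : ℕ} {v : M} (hv : Kills K w lam a N v)
    (f : MvPolynomial (Fin n) K) : Kills K w lam a N (sA K w lam a f • v) := by
  rw [kills_iff] at hv ⊢
  intro i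
  rw [← mul_smul, ← map_mul, mul_comm, map_mul, mul_smul, hv i, smul_zero]

/-- An element of weight `b` intertwines `h_i - a_i` with `h_i - a_i - b_i`, so the exponent `N`
does not grow. This is why all constructions can be made at one level `N` at a time. -/
theorem Kills.quotWeight_smul {a b a' : Fin n → ℤ} {N : ℕ} {v : M}
    (hv : Kills K w lam a N v) {x : HEAQuot K w lam}
    (hx : x ∈ quotWeight K w lam b) (ha' : a' = a + b) :
    Kills K w lam a' N (x • v) := by
  subst ha'
  rw [kills_iff] at hv ⊢
  intro i
  rw [← mul_smul, sA_mul_of_mem_quotWeight K w lam a hx, mul_smul, hv i, smul_zero]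

theorem Kills.leftIdeal_smul {a : Fin n → ℤ} {N : ℕ} {v : M}
    (hv : Kills K w lam a N v) {x : HEAQuot K w lam} (hx : x ∈ leftIdeal K w lam a N) :
    x • v = 0 := by
  induction hx using Submodule.span_induction with
  | mem f hf => obtain ⟨i, rfl⟩ := hf; exact hv i
  | zero => exact zero_smul _ v
  | add f g _ _ hf hg => rw [add_smul, hf, hg, add_zero]
  | smul f g _ hg => rw [smul_eq_mul, mul_smul, hg, smul_zero]

variable (K w lam)

theorem kills_mk_one (a : Fin n → ℤ) (N : ℕ) : Kills K w lam a N
    (Submodule.Quotient.mk 1 : HEAQuot K w lam ⧸ leftIdeal K w lam a N) := by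
  intro i
  rw [← Submodule.Quotient.mk_smul, Submodule.Quotient.mk_eq_zero, smul_eq_mul, mul_one]
  exact Submodule.subset_span ⟨i, rfl⟩

/-- The `N`-th truncation of the element `cElem`. -/
def cTrunc (a b : Fin n → ℤ) (hb : ∑ i, b i • w i = 0) (N : ℕ) : HEAQuot K w lam :=
  m K w lam b hb * sA K w lam a (qMv K a b N)

theorem cElem_val (a b : Fin n → ℤ) (hb : ∑ i, b i • w i = 0) (N : ℕ) :
    (cElem K w lam a b hb).1 N = Submodule.Quotient.mk (cTrunc K w lam a b hb N) := by
  rw [cTrunc, qMv, sA, aevalComm_prod]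
  rfl

theorem cTrunc_mem_quotWeight (a b : Fin n → ℤ) (hb : ∑ i, b i • w i = 0) (N : ℕ) :
    cTrunc K w lam a b hb N ∈ quotWeight K w lam b :=
  m_mul_sA_mem_quotWeight K w lam a b hb _

variable {K w lam}

/-- The normalising factors are units with polynomial inverse, so the original monomials can be
recovered from the normalised ones and the action of `S`. -/
theorem Kills.m_smul {a b : Fin n → ℤ} (hb : ∑ i, b i • w i = 0) {N : ℕ} {v : M}
    (hv : Kills K w lam a N v) :
    m K w lam b hb • v = cTrunc K w lam a b hb N • sA K w lam a (qInvMv K a b) • v := by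
  rw [cTrunc, mul_smul, ← mul_smul (sA K w lam a _), ← map_mul, mul_comm (qMv K a b N),
    hv.sA_smul_congr (qInvMv_mul_qMv K a b N), map_one, one_smul]

theorem cTrunc_sA_smul {a b a' : Fin n → ℤ} (hb : ∑ i, b i • w i = 0) (ha' : a' = a + b) (N : ℕ)
    (v : M) (f : MvPolynomial (Fin n) K) :
    cTrunc K w lam a b hb N • sA K w lam a f • v =
      sA K w lam a' f • cTrunc K w lam a b hb N • v := by
  subst ha'
  rw [← mul_smul, ← mul_smul, sA_mul_of_mem_quotWeight K w lam a
    (cTrunc_mem_quotWeight K w lam a b hb N)]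

theorem Kills.cTrunc_zero_smul {a : Fin n → ℤ} (h0 : ∑ i, (0 : Fin n → ℤ) i • w i = 0) {N : ℕ}
    {v : M} (hv : Kills K w lam a N v) :
    cTrunc K w lam a 0 h0 N • v = v := by
  have h1 := hv.m_smul h0
  rw [m_zero, one_smul] at h1
  have : qInvMv K a 0 = 1 := by simp [qInvMv, qInv]
  rwa [this, map_one, one_smul, eq_comm] at h1

/-- The chamber containing `a`. -/
def floor (p : ℕ) (a : Fin n → ℤ) : Fin n → ℤ := fun i => a i / p

variable (p : ℕ) [Fact p.Prime] [CharP K p]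

/-- The multiplication rule of `H^λ` on vectors: move all polynomials to the right past the
monomials, multiply the monomials, and apply `wallMv_identity`. The weights `a'` and `a''` and the
exponent `b''` are separate variables with equations, so that the result can be used when they are
only propositionally equal to sums. -/
theorem Kills.cTrunc_comp {a b b' b'' a' a'' : Fin n → ℤ} (hb : ∑ i, b i • w i = 0)
    (hb' : ∑ i, b' i • w i = 0) (hb'' : ∑ i, b'' i • w i = 0) (e : b'' = b' + b)
    (ha' : a' = a + b) (ha'' : a'' = a + b'') {N : ℕ} {v : M}
    (hv : Kills K w lam a N v) :
    cTrunc K w lam a' b' hb' N • cTrunc K w lam a b hb N • v =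
      sA K w lam a'' (etaMv K (floor p a'') (floor p a') (floor p a)) •
        cTrunc K w lam a b'' hb'' N • v := by
  subst e ha' ha''
  rw [← cTrunc_sA_smul hb'' rfl]
  simp only [cTrunc, ← mul_smul]
  rw [show m K w lam b' hb' * sA K w lam (a + b) (qMv K (a + b) b' N) *
      (m K w lam b hb * sA K w lam a (qMv K a b N)) =
      m K w lam (b' + b) hb'' * sA K w lam a (shift K a (wallMv K b' b) *
        (qMv K (a + b) b' N * qMv K a b N)) by
    rw [mul_assoc, ← mul_assoc _ (m K w lam b hb), sA_mul_m, mul_assoc, ← map_mul, ← mul_assoc,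
      m_mul_m K w lam a hb' hb, mul_assoc, ← map_mul]]
  rw [mul_smul, hv.sA_smul_congr (wallMv_identity K p a b' b N), ← mul_smul, map_mul, mul_assoc,
    ← map_mul, ← map_mul, mul_comm]
  rfl

end Vectors

/-! ### Homomorphisms out of the `Q_a` -/

section QLift

variable (K : Type u) [Field K] {n k : ℕ} (w : Fin n → Fin k → ℤ) (lam : Fin k → ℤ)

theorem mul_mem_quotWeight {b c : Fin n → ℤ} {x y : HEAQuot K w lam}
    (hx : x ∈ quotWeight K w lam b) (hy : y ∈ quotWeight K w lam c) :
    x * y ∈ quotWeight K w lam (b + c) := by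
  obtain ⟨x, hx, rfl⟩ := hx
  obtain ⟨y, hy, rfl⟩ := hy
  exact ⟨x * y, mul_mem_weylWeight K hx hy, map_mul (toQuot K w lam) x y⟩

theorem one_mem_quotWeight : (1 : HEAQuot K w lam) ∈ quotWeight K w lam 0 :=
  ⟨1, one_mem_weylWeight K _, map_one (toQuot K w lam)⟩

theorem oneQ_mem (a : Fin n → ℤ) : oneQ K w lam a ∈ QWeight K w lam a a := fun _ =>
  ⟨1, by rw [sub_self]; exact one_mem_quotWeight K w lam, rfl⟩

theorem cElem_mem (a b : Fin n → ℤ) (hb : ∑ i, b i • w i = 0) :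
    cElem K w lam a b hb ∈ QWeight K w lam a (a + b) := fun N =>
  ⟨cTrunc K w lam a b hb N, by
    rw [add_sub_cancel_left]; exact cTrunc_mem_quotWeight K w lam a b hb N,
    cElem_val K w lam a b hb N⟩

variable {K w lam}

/-- The homomorphism from `A^λ / ∑ᵢ A^λ (hᵢ⁺ - aᵢ)^N` defined by a vector. -/
def Kills.lift {M : Type u} [AddCommGroup M] [Module (HEAQuot K w lam) M] {a : Fin n → ℤ}
    {N : ℕ} {v : M} (hv : Kills K w lam a N v) :
    (HEAQuot K w lam ⧸ leftIdeal K w lam a N) →ₗ[HEAQuot K w lam] M :=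
  Submodule.liftQ _ (LinearMap.toSpanSingleton _ M v) fun _ hx => hv.leftIdeal_smul hx

@[simp]
theorem Kills.lift_mk {M : Type u} [AddCommGroup M] [Module (HEAQuot K w lam) M] {a : Fin n → ℤ}
    {N : ℕ} {v : M} (hv : Kills K w lam a N v) (x : HEAQuot K w lam) :
    hv.lift (Submodule.Quotient.mk x) = x • v := rfl

/-- The projection of `Q_a` to `A^λ / ∑ᵢ A^λ (hᵢ⁺ - aᵢ)^N`. -/
def QProj (a : Fin n → ℤ) (N : ℕ) :
    Q K w lam a →ₗ[HEAQuot K w lam] HEAQuot K w lam ⧸ leftIdeal K w lam a N :=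
  LinearMap.proj N ∘ₗ (Q K w lam a).subtype

theorem continuous_QProj (a : Fin n → ℤ) (N : ℕ) :
    @Continuous _ _ _ ⊥ (QProj (K := K) (w := w) (lam := lam) a N) :=
  continuous_iInf_dom (i := N) continuous_induced_dom

theorem exists_QProj_eq (a : Fin n → ℤ) (q : Q K w lam a) (N : ℕ) :
    ∃ x : HEAQuot K w lam, QProj a N q = Submodule.Quotient.mk x :=
  ⟨_, (Submodule.Quotient.mk_surjective _ (QProj a N q)).choose_spec.symm⟩

theorem QProj_of_le (a : Fin n → ℤ) (q : Q K w lam a) {N N' : ℕ} (h : N ≤ N') {x : HEAQuot K w lam}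
    (hx : QProj a N' q = Submodule.Quotient.mk x) : QProj a N q = Submodule.Quotient.mk x := by
  induction N', h using Nat.le_induction with
  | base => exact hx
  | succ N' h ih =>
    refine ih ?_
    have := q.2 N'
    change Submodule.factor _ (QProj a (N' + 1) q) = QProj a N' q at this
    rw [← this, hx]
    rfl

/-- The kernels of the projections to the finite levels form a neighbourhood basis of zero, and a
fibre of a continuous map to a discrete space is open. -/
theorem exists_QProj_ker_le {a : Fin n → ℤ} {X : Type*} [TopologicalSpace X] [DiscreteTopology X]
    {f : Q K w lam a → X} (hf : Continuous f) :
    ∃ N, ∀ q, QProj a N q = 0 → f q = f 0 := by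
  have h1 : f ⁻¹' {f 0} ∈ nhds (0 : Q K w lam a) :=
    (hf.isOpen_preimage _ (isOpen_discrete _)).mem_nhds rfl
  change _ ∈ @nhds _ (⨅ N : ℕ, TopologicalSpace.induced (QProj a N) ⊥) 0 at h1
  rw [nhds_iInf, Filter.mem_iInf_of_directed] at h1
  · obtain ⟨N, hN⟩ := h1
    refine ⟨N, fun q hq => ?_⟩
    rw [@nhds_induced _ _ ⊥] at hN
    obtain ⟨t, ht, ht'⟩ := hN
    refine ht' (show QProj a N q ∈ t from ?_)
    rw [hq]
    have := @mem_of_mem_nhds _ ⊥ _ _ ht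
    rwa [map_zero] at this
  -- Level `N` is a function of level `N + 1`, so the induced neighbourhood filters decrease with
  -- `N` and their infimum is directed.
  · refine Antitone.directed_ge (antitone_nat_of_succ_le fun N => ?_)
    rw [@nhds_induced _ _ ⊥, @nhds_induced _ _ ⊥]
    have : (QProj (K := K) (w := w) (lam := lam) a N : Q K w lam a → _) =
        Submodule.factor (leftIdeal_succ_le K w lam a N) ∘ QProj a (N + 1) :=
      funext fun q => (q.2 N).symm
    rw [this, ← Filter.comap_comap]
    refine Filter.comap_mono ?_
    let _ : TopologicalSpace (HEAQuot K w lam ⧸ leftIdeal K w lam a N) := ⊥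
    let _ : TopologicalSpace (HEAQuot K w lam ⧸ leftIdeal K w lam a (N + 1)) := ⊥
    have _ : DiscreteTopology (HEAQuot K w lam ⧸ leftIdeal K w lam a (N + 1)) := ⟨rfl⟩
    have := (continuous_of_discreteTopology
      (f := Submodule.factor (leftIdeal_succ_le K w lam a N))).tendsto (QProj a (N + 1) 0)
    exact this.le_comap

/-- The generator spans a dense submodule: at any prescribed level `q` agrees with a multiple of
`1_a`, and continuous maps to discrete modules see only one level. -/
theorem ext_of_oneQ {M : Type u} [AddCommGroup M] [Module (HEAQuot K w lam) M]
    [TopologicalSpace M] [DiscreteTopology M] {a : Fin n → ℤ}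
    {f g : Q K w lam a →ₗ[HEAQuot K w lam] M} (hf : Continuous f) (hg : Continuous g)
    (hfg : f (oneQ K w lam a) = g (oneQ K w lam a)) : f = g := by
  obtain ⟨N, hN⟩ := exists_QProj_ker_le hf
  obtain ⟨N', hN'⟩ := exists_QProj_ker_le hg
  ext q
  obtain ⟨x, hx⟩ := exists_QProj_eq a q (max N N')
  have h0 : ∀ N₀ ≤ max N N', QProj a N₀ (q - x • oneQ K w lam a) = 0 := by
    intro N₀ h
    refine ((QProj a N₀).toAddMonoidHom.map_sub q _).trans ?_
    change QProj a N₀ q - x • Submodule.Quotient.mk 1 = 0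
    rw [QProj_of_le a q h hx]
    rw [← Submodule.Quotient.mk_smul, smul_eq_mul, mul_one, sub_self]
  have h1 := hN _ (h0 N (le_max_left _ _))
  have h2 := hN' _ (h0 N' (le_max_right _ _))
  replace h1 := (f.toAddMonoidHom.map_sub q _).symm.trans h1
  replace h2 := (g.toAddMonoidHom.map_sub q _).symm.trans h2
  change f q - f (x • oneQ K w lam a) = f 0 at h1
  change g q - g (x • oneQ K w lam a) = g 0 at h2
  rw [map_smul, map_zero, sub_eq_zero] at h1 h2
  rw [h1, h2, hfg]

/-- At level `N` the element `c` is a multiple of the generator by an element of weight `a - a'`,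
which turns `h_i - a'_i` into `h_i - a_i`. Thus level `N` of `Q_a` maps to level `N` of `Q_a'`,
which makes `QLift` well defined and continuous. -/
theorem kills_QProj {a a' : Fin n → ℤ} {c : Q K w lam a'} (hc : c ∈ QWeight K w lam a' a)
    (N : ℕ) : Kills K w lam a N (QProj a' N c) := by
  obtain ⟨y, hy, e⟩ := hc N
  have e' : QProj a' N c = y • Submodule.Quotient.mk 1 := by
    rw [← Submodule.Quotient.mk_smul, smul_eq_mul, mul_one]
    exact e
  rw [e']
  exact (kills_mk_one K w lam a' N).quotWeight_smul hy (by abel)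

/-- The homomorphism `Q_a → Q_a'` defined by an element of weight `a`. -/
def QLift {a a' : Fin n → ℤ} (c : Q K w lam a') (hc : c ∈ QWeight K w lam a' a) :
    QHom K w lam a a' where
  toLin := LinearMap.codRestrict _
    (LinearMap.pi fun N => (kills_QProj hc N).lift ∘ₗ QProj a N) fun q N => by
      obtain ⟨x, hx⟩ := exists_QProj_eq a q (N + 1)
      have hx' := QProj_of_le a q (Nat.le_succ N) hx
      change Submodule.factor _ ((kills_QProj hc (N + 1)).lift (QProj a (N + 1) q)) =
        (kills_QProj hc N).lift (QProj a N q)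
      rw [hx, hx', Kills.lift_mk, Kills.lift_mk, map_smul]
      congr 1
      exact c.2 N
  cont := by
    refine continuous_iInf_rng.2 fun N => continuous_induced_rng.2 ?_
    let _ : TopologicalSpace (HEAQuot K w lam ⧸ leftIdeal K w lam a N) := ⊥
    have _ : DiscreteTopology (HEAQuot K w lam ⧸ leftIdeal K w lam a N) := ⟨rfl⟩
    let _ : TopologicalSpace (HEAQuot K w lam ⧸ leftIdeal K w lam a' N) := ⊥
    exact (continuous_of_discreteTopology (f := (kills_QProj hc N).lift)).comp
      (continuous_QProj a N)
  map_weight := by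
    intro b q hq N
    obtain ⟨x, hx, ex⟩ := hq N
    obtain ⟨y, hy, ey⟩ := hc N
    refine ⟨x * y, ?_, ?_⟩
    · have := mul_mem_quotWeight K w lam hx hy
      rwa [sub_add_sub_cancel] at this
    · change (kills_QProj hc N).lift (q.1 N) = _
      rw [ex, Kills.lift_mk]
      change x • c.1 N = _
      rw [ey]
      rfl

theorem QLift_val {a a' : Fin n → ℤ} {c : Q K w lam a'} (hc : c ∈ QWeight K w lam a' a)
    {q : Q K w lam a} {N : ℕ} {x : HEAQuot K w lam} (hx : q.1 N = Submodule.Quotient.mk x) :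
    ((QLift c hc).toLin q).1 N = x • c.1 N := by
  change (kills_QProj hc N).lift (q.1 N) = _
  rw [hx, Kills.lift_mk]
  rfl

theorem QLift_oneQ {a a' : Fin n → ℤ} {c : Q K w lam a'} (hc : c ∈ QWeight K w lam a' a) :
    (QLift c hc).toLin (oneQ K w lam a) = c :=
  Subtype.ext (funext fun _ => (QLift_val hc rfl).trans (one_smul _ _))

end QLift

/-! ### `Hom(Q_a, M)` and weight spaces -/

section HomQ

variable {K : Type u} [Field K] {n k : ℕ} {w : Fin n → Fin k → ℤ} {lam : Fin k → ℤ}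
  (M : WtMod K w lam)

theorem exists_kills {a : Fin n → ℤ} {v : M.carrier} (hv : v ∈ M.weight a) :
    ∃ N, Kills K w lam a N v := by
  choose N hN using fun i => M.nilpotent i a v hv
  refine ⟨Finset.univ.sup N, fun i => ?_⟩
  rw [← Nat.sub_add_cancel (Finset.le_sup (f := N) (Finset.mem_univ i)), pow_add, mul_smul, hN i,
    smul_zero]

theorem sA_smul_mem {a : Fin n → ℤ} (f : MvPolynomial (Fin n) K) {v : M.carrier}
    (hv : v ∈ M.weight a) : sA K w lam a f • v ∈ M.weight a := by
  have h0 : ∑ i, (0 : Fin n → ℤ) i • w i = 0 := by simp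
  have h1 := m_mul_sA_mem_quotWeight K w lam a 0 h0 f
  rw [m_zero, one_mul] at h1
  simpa using M.smul_mem a 0 _ h1 v hv

/-- Evaluation at the generator, as a map `Hom(Q_a, M) → M_a`. -/
def evalOne (a : Fin n → ℤ) : HomQ K w lam a M →ₗ[K] M.weight a where
  toFun f := ⟨f.1 (oneQ K w lam a), f.2.2 a _ (oneQ_mem K w lam a)⟩
  map_add' _ _ := rfl
  map_smul' _ _ := rfl

theorem evalOne_injective (a : Fin n → ℤ) : Function.Injective (evalOne M a) := by
  intro f g hfg
  let _ : TopologicalSpace M.carrier := ⊥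
  have _ : DiscreteTopology M.carrier := ⟨rfl⟩
  exact Subtype.ext (ext_of_oneQ f.2.1 g.2.1 (congrArg Subtype.val hfg))

variable {M}

/-- The homomorphism `Q_a → M` defined by a vector of weight `a`. -/
def homOfKills {a : Fin n → ℤ} {v : M.carrier} (hv : v ∈ M.weight a) {N : ℕ}
    (hN : Kills K w lam a N v) : HomQ K w lam a M :=
  ⟨hN.lift ∘ₗ QProj a N, by
    let _ : TopologicalSpace (HEAQuot K w lam ⧸ leftIdeal K w lam a N) := ⊥
    have _ : DiscreteTopology (HEAQuot K w lam ⧸ leftIdeal K w lam a N) := ⟨rfl⟩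
    let _ : TopologicalSpace M.carrier := ⊥
    refine ⟨(continuous_of_discreteTopology (f := hN.lift)).comp (continuous_QProj a N), ?_⟩
    intro c q hq
    obtain ⟨x, hx, ex⟩ := hq N
    change hN.lift (q.1 N) ∈ _
    rw [ex, Kills.lift_mk]
    have := M.smul_mem a _ x hx v hv
    rwa [add_sub_cancel] at this⟩

theorem evalOne_homOfKills {a : Fin n → ℤ} {v : M.carrier} (hv : v ∈ M.weight a) {N : ℕ}
    (hN : Kills K w lam a N v) :
    evalOne M a (homOfKills hv hN) = ⟨v, hv⟩ :=
  Subtype.ext ((hN.lift_mk 1).trans (one_smul _ _))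

variable (M) in
/-- `Hom(Q_a, M) ≃ M_a`. -/
def homEquiv (a : Fin n → ℤ) : HomQ K w lam a M ≃ₗ[K] M.weight a :=
  LinearEquiv.ofBijective (evalOne M a) ⟨evalOne_injective M a, fun v => by
    obtain ⟨N, hN⟩ := exists_kills M v.2
    exact ⟨homOfKills v.2 hN, evalOne_homOfKills v.2 hN⟩⟩

/-- By uniqueness, `f` factors through every level `N` whose powers kill the image of the generator,
so its values can be computed at any such level. -/
theorem homQ_apply {a : Fin n → ℤ} (f : HomQ K w lam a M) {N : ℕ}
    (hN : Kills K w lam a N (f.1 (oneQ K w lam a))) {q : Q K w lam a}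
    {x : HEAQuot K w lam} (hx : q.1 N = Submodule.Quotient.mk x) :
    f.1 q = x • f.1 (oneQ K w lam a) := by
  have hv := f.2.2 a _ (oneQ_mem K w lam a)
  have : f = homOfKills hv hN := evalOne_injective M a (evalOne_homOfKills hv hN).symm
  conv_lhs => rw [this]
  change hN.lift (q.1 N) = _
  rw [hx, Kills.lift_mk]

theorem homEquiv_symm_apply {a : Fin n → ℤ} (v : M.weight a) {N : ℕ}
    (hN : Kills K w lam a N v.1) {q : Q K w lam a}
    {x : HEAQuot K w lam} (hx : q.1 N = Submodule.Quotient.mk x) :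
    ((homEquiv M a).symm v).1 q = x • v.1 := by
  have h1 : ((homEquiv M a).symm v).1 (oneQ K w lam a) = v.1 :=
    congrArg Subtype.val ((homEquiv M a).apply_symm_apply v)
  have := homQ_apply ((homEquiv M a).symm v) (N := N) (by rw [h1]; exact hN) hx
  rwa [h1] at this

end HomQ

/-! ### Transition maps between weight spaces -/

section Transition

variable {K : Type u} [Field K] {n k : ℕ} {w : Fin n → Fin k → ℤ} {lam : Fin k → ℤ}

variable (w lam) in
/-- The characters of `D` restricting to `λ` on `T`. -/
abbrev LamPt : Type := {a : Fin n → ℤ // ∑ i, a i • w i = lam}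

theorem LamPt.sub_trivial (a a' : LamPt w lam) : ∑ i, (a'.1 - a.1) i • w i = 0 := by
  simp only [Pi.sub_apply, sub_smul, Finset.sum_sub_distrib]
  rw [a.2, a'.2, sub_self]

variable (M : WtMod K w lam)

/-- The transition map `M_a → M_a'`, the value of homomorphisms from `Q_a` at `cElem`. -/
def Cmap (a a' : LamPt w lam) : M.weight a.1 →ₗ[K] M.weight a'.1 where
  toFun v := ⟨((homEquiv M a.1).symm v).1 (cElem K w lam a.1 (a'.1 - a.1) (a.sub_trivial a')),
    ((homEquiv M a.1).symm v).2.2 _ _ (by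
      have := cElem_mem K w lam a.1 (a'.1 - a.1) (a.sub_trivial a')
      rwa [add_sub_cancel] at this)⟩
  map_add' v v' := Subtype.ext (by rw [map_add]; rfl)
  map_smul' r v := Subtype.ext (by rw [map_smul]; rfl)

/-- Freedom in the choice of `N` allows one common truncation for a vector and for its images. -/
theorem coe_Cmap (a a' : LamPt w lam) (v : M.weight a.1) {N : ℕ} (hN : Kills K w lam a.1 N v.1) :
    (Cmap M a a' v).1 = cTrunc K w lam a.1 (a'.1 - a.1) (a.sub_trivial a') N • v.1 :=
  homEquiv_symm_apply v hN (cElem_val K w lam _ _ _ N)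

/-- The action of polynomials on a weight space, the variables acting by `hᵢ⁺ - aᵢ`. -/
def mvAct (a : Fin n → ℤ) : MvPolynomial (Fin n) K →ₐ[K] Module.End K (M.weight a) :=
  AlgHom.ofLinearMap
    { toFun f :=
        { toFun v := ⟨sA K w lam a f • v.1, sA_smul_mem M f v.2⟩
          map_add' v v' := Subtype.ext (smul_add _ _ _)
          map_smul' r v := Subtype.ext (smul_comm _ _ _) }
      map_add' f g := by
        ext v
        change sA K w lam a (f + g) • v.1 = sA K w lam a f • v.1 + sA K w lam a g • v.1
        rw [map_add, add_smul]
      map_smul' r f := by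
        ext v
        change sA K w lam a (r • f) • v.1 = r • sA K w lam a f • v.1
        rw [map_smul, smul_assoc] }
    (by
      ext v
      change sA K w lam a 1 • v.1 = v.1
      rw [map_one, one_smul])
    (fun f g => by
      ext v
      change sA K w lam a (f * g) • v.1 = sA K w lam a f • sA K w lam a g • v.1
      rw [map_mul, mul_smul])

theorem coe_mvAct (a : Fin n → ℤ) (f : MvPolynomial (Fin n) K) (v : M.weight a) :
    (mvAct M a f v).1 = sA K w lam a f • v.1 := rfl

theorem toQuot_moment (χ : Fin k → ℤ) :
    ∑ i, (∑ j, w i j * χ j) • h K w lam i = (∑ j, lam j * χ j) • (1 : HEAQuot K w lam) := by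
  have h1 := RingQuot.mkAlgHom_rel K (HEARel.moment (K := K) (w := w) (lam := lam) χ)
  change toQuot K w lam _ = toQuot K w lam _ at h1
  have hz : ∀ (r : ℤ) (x : HEA K w), toQuot K w lam (r • x) = r • toQuot K w lam x := fun r x =>
    map_zsmul (toQuot K w lam).toLinearMap.toAddMonoidHom r x
  rw [map_sum, hz, map_one] at h1
  simp only [hz] at h1
  exact h1

theorem sum_weight_mul {a : Fin n → ℤ} (ha : ∑ i, a i • w i = lam) (χ : Fin k → ℤ) :
    ∑ i, (∑ j, w i j * χ j) * a i = ∑ j, lam j * χ j := by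
  rw [← ha]
  simp only [Finset.sum_apply, Pi.smul_apply, smul_eq_mul, Finset.sum_mul]
  rw [Finset.sum_comm]
  exact Finset.sum_congr rfl fun j _ => Finset.sum_congr rfl fun i _ => by ring

/-- In `A^λ` the sum of the `⟨ε_i, χ⟩ h_i` is `λ(χ)`, which equals the sum of the `⟨ε_i, χ⟩ a_i`.
Hence the action of polynomials on a weight space descends to `S`. -/
theorem sA_moment {a : Fin n → ℤ} (ha : ∑ i, a i • w i = lam) (χ : Fin k → ℤ) :
    sA K w lam a (∑ i, MvPolynomial.C (((∑ j, w i j * χ j : ℤ)) : K) * MvPolynomial.X i) = 0 := by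
  rw [map_sum]
  have : ∀ i, sA K w lam a (MvPolynomial.C (((∑ j, w i j * χ j : ℤ)) : K) * MvPolynomial.X i) =
      (∑ j, w i j * χ j) • h K w lam i - (((∑ j, w i j * χ j) * a i : ℤ) : HEAQuot K w lam) := by
    intro i
    rw [map_mul, sA_X, map_intCast, map_intCast, Int.cast_mul, mul_sub, zsmul_eq_mul]
  rw [Finset.sum_congr rfl fun i _ => this i, Finset.sum_sub_distrib, toQuot_moment,
    ← Int.cast_sum, sum_weight_mul ha, zsmul_one, sub_self]

variable (K w) in
/-- The quotient map to `S`. -/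
def mkS : MvPolynomial (Fin n) K →ₐ[K] SymG K w := Ideal.Quotient.mkₐ K _

theorem mkS_surjective : Function.Surjective (mkS K w) := Ideal.Quotient.mkₐ_surjective K _

theorem mkS_etaMv (x y u : Fin n → ℤ) :
    mkS K w (etaMv K x y u) = ∏ i, sS K w i ^ eta (x i) (y i) (u i) := by
  rw [etaMv, map_prod]
  exact Finset.prod_congr rfl fun i _ => map_pow _ _ _

/-- The action of `S` on a weight space. -/
def symAct (a : Fin n → ℤ) : SymG K w →ₐ[K] Module.End K (M.weight a) :=
  Ideal.Quotient.liftₐ _ (mvAct M a) (by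
    intro f hf
    induction hf using Submodule.span_induction with
    | mem f hf =>
      obtain ⟨χ, rfl⟩ := hf
      ext v
      rw [coe_mvAct]
      by_cases ha : ∑ i, a i • w i = lam
      · rw [sA_moment ha, zero_smul]; rfl
      · have : v.1 ∈ (⊥ : Submodule K M.carrier) := M.weight_eq_bot a ha ▸ v.2
        rw [(Submodule.mem_bot K).1 this, smul_zero]
        rfl
    | zero => exact map_zero _
    | add f g _ _ hf hg => rw [map_add, hf, hg, add_zero]
    | smul f g _ hg => rw [smul_eq_mul, map_mul, hg, mul_zero])

instance (a : Fin n → ℤ) : Module (SymG K w) (M.weight a) :=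
  Module.compHom (M.weight a) (symAct M a).toRingHom

theorem coe_mkS_smul (a : Fin n → ℤ) (f : MvPolynomial (Fin n) K) (v : M.weight a) :
    (mkS K w f • v).1 = sA K w lam a f • v.1 := rfl

theorem algebraMap_smul_weight (a : Fin n → ℤ) (r : K) (v : M.weight a) :
    algebraMap K (SymG K w) r • v = r • v := by
  change symAct M a (algebraMap K (SymG K w) r) v = _
  rw [AlgHom.commutes]
  rfl

theorem Cmap_smul (a a' : LamPt w lam) (s : SymG K w) (v : M.weight a.1) :
    Cmap M a a' (s • v) = s • Cmap M a a' v := by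
  obtain ⟨f, rfl⟩ := mkS_surjective s
  obtain ⟨N, hN⟩ := exists_kills M v.2
  ext
  rw [coe_mkS_smul, coe_Cmap M a a' v hN,
    coe_Cmap M a a' _ (by rw [coe_mkS_smul]; exact hN.sA_smul f),
    coe_mkS_smul, cTrunc_sA_smul (a' := a'.1) _ (by abel)]

theorem Cmap_self (a : LamPt w lam) (v : M.weight a.1) : Cmap M a a v = v := by
  obtain ⟨N, hN⟩ := exists_kills M v.2
  ext
  rw [coe_Cmap M a a v hN]
  have : ∀ (b : Fin n → ℤ) (hb : ∑ i, b i • w i = 0), b = 0 →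
      cTrunc K w lam a.1 b hb N • v.1 = v.1 := by
    rintro b hb rfl
    exact hN.cTrunc_zero_smul hb
  exact this _ _ (sub_self _)

/-- Since the monomials times polynomials span `A^λ`, this recovers the whole action of `A^λ` from
the transition maps and `S`. -/
theorem m_smul_eq (a a' : LamPt w lam) {b : Fin n → ℤ} (hb : ∑ i, b i • w i = 0)
    (hab : a'.1 = a.1 + b) (v : M.weight a.1) :
    m K w lam b hb • v.1 = (Cmap M a a' (mkS K w (qInvMv K a.1 b) • v)).1 := by
  obtain rfl : b = a'.1 - a.1 := by rw [hab]; abel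
  obtain ⟨N, hN⟩ := exists_kills M v.2
  rw [coe_Cmap M a a' _ (by rw [coe_mkS_smul]; exact hN.sA_smul _), hN.m_smul, coe_mkS_smul]

variable (p : ℕ) [Fact p.Prime] [CharP K p]

theorem Cmap_Cmap (a a' a'' : LamPt w lam) (v : M.weight a.1) :
    Cmap M a' a'' (Cmap M a a' v) =
      (∏ i, sS K w i ^ eta (floor p a''.1 i) (floor p a'.1 i) (floor p a.1 i)) •
        Cmap M a a'' v := by
  obtain ⟨N, hN⟩ := exists_kills M v.2
  ext
  rw [← mkS_etaMv, coe_mkS_smul, coe_Cmap M a a'' v hN, coe_Cmap M a' a'' _ (N := N)]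
  · rw [coe_Cmap M a a' v hN]
    exact hN.cTrunc_comp p _ _ _ (by abel) (by abel) (by abel)
  · rw [coe_Cmap M a a' v hN]
    exact hN.quotWeight_smul (cTrunc_mem_quotWeight K w lam _ _ _ N) (by abel)

theorem eta_self_left (x y : ℤ) : eta x x y = 0 := by simp [eta]

theorem eta_self_right (x y : ℤ) : eta x y y = 0 := by simp [eta]

/-- If the intermediate weight lies in the chamber of one of the ends, no boundary is crossed twice.
Taking `a'' = a`, the transition maps inside a chamber are mutually inverse. -/
theorem Cmap_Cmap_of_eq (a a' a'' : LamPt w lam) (v : M.weight a.1)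
    (h : floor p a'.1 = floor p a''.1 ∨ floor p a'.1 = floor p a.1) :
    Cmap M a' a'' (Cmap M a a' v) = Cmap M a a'' v := by
  rw [Cmap_Cmap M p, Finset.prod_eq_one, one_smul]
  intro i _
  rcases h with h | h <;> rw [h]
  · rw [eta_self_left, pow_zero]
  · rw [eta_self_right, pow_zero]

end Transition

/-- The restriction of a morphism to a weight space. -/
def WtMod.Hom.onWeight {K : Type u} [Field K] {n k : ℕ} {w : Fin n → Fin k → ℤ}
    {lam : Fin k → ℤ} {M N : WtMod K w lam} (f : M ⟶ N) (a : Fin n → ℤ) :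
    M.weight a →ₗ[SymG K w] N.weight a where
  toFun v := ⟨WtMod.Hom.toLin f v.1, WtMod.Hom.map_weight f a _ v.2⟩
  map_add' v v' := Subtype.ext (map_add _ _ _)
  map_smul' s v := by
    obtain ⟨g, rfl⟩ := mkS_surjective s
    ext
    exact map_smul f.toLin (sA K w lam a g) v.1

theorem onWeight_Cmap {K : Type u} [Field K] {n k : ℕ} {w : Fin n → Fin k → ℤ}
    {lam : Fin k → ℤ} {M N : WtMod K w lam} (f : M ⟶ N) (a a' : LamPt w lam) (v : M.weight a.1) :
    WtMod.Hom.onWeight f a'.1 (Cmap M a a' v) = Cmap N a a' (WtMod.Hom.onWeight f a.1 v) := by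
  obtain ⟨e, hN⟩ := exists_kills M v.2
  ext
  rw [coe_Cmap N a a' _ (N := e)]
  · change f.toLin (Cmap M a a' v).1 = _
    rw [coe_Cmap M a a' v hN, map_smul]
    rfl
  · intro i
    change _ • f.toLin v.1 = 0
    rw [← map_smul, hN i, map_zero]

/-! ### The functor `Hom(⨁ P_x, -)` -/

section HomFunctor

variable {K : Type u} [Field K] {p : ℕ} {n k : ℕ}
  {w : Fin n → Fin k → ℤ} {lam : Fin k → ℤ}

theorem HAlg_induction {P : HAlg K p w lam → Prop}
    (halg : ∀ s : SymG K w, P (algebraMap _ _ s)) (hc : ∀ x y, P (c K p w lam x y))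
    (hmul : ∀ x y, P x → P y → P (x * y)) (hadd : ∀ x y, P x → P y → P (x + y))
    (x : HAlg K p w lam) : P x := by
  obtain ⟨x, rfl⟩ := RingQuot.mkAlgHom_surjective (SymG K w) (HRel K p w lam) x
  induction x using FreeAlgebra.induction with
  | grade0 r => rw [AlgHom.commutes]; exact halg r
  | grade1 i => exact hc i.1 i.2
  | mul a b ha hb => rw [map_mul]; exact hmul _ _ ha hb
  | add a b ha hb => rw [map_add]; exact hadd _ _ ha hb

/-- An additive map commuting with the generators of `HAlg` is linear. -/
theorem HAlg_map_smul {V V' : Type*} [AddCommGroup V] [AddCommGroup V'] [Module (HAlg K p w lam) V]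
    [Module (HAlg K p w lam) V'] (g : V →+ V')
    (halg : ∀ (s : SymG K w) v, g (algebraMap _ (HAlg K p w lam) s • v) =
      algebraMap _ (HAlg K p w lam) s • g v)
    (hc : ∀ x y v, g (c K p w lam x y • v) = c K p w lam x y • g v) (x : HAlg K p w lam) (v : V) :
    g (x • v) = x • g v := by
  induction x using HAlg_induction generalizing v with
  | halg s => exact halg s v
  | hc x y => exact hc x y v
  | hmul x y hx hy => rw [mul_smul, hx, hy, mul_smul]
  | hadd x y hx hy => rw [add_smul, map_add, hx, hy, add_smul]

theorem c_mul_c (x y u : Chambers p w lam) : c K p w lam x y * c K p w lam y u =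
    algebraMap _ _ (∏ i, sS K w i ^ eta (x.1 i) (y.1 i) (u.1 i)) * c K p w lam x u := by
  have := RingQuot.mkAlgHom_rel (SymG K w) (HRel.mul (K := K) (p := p) (w := w) (lam := lam) x y u)
  rw [map_mul, map_smul, Algebra.smul_def] at this
  exact this

theorem c_mul_c_ne {x y y' u : Chambers p w lam} (hy : y ≠ y') :
    c K p w lam x y * c K p w lam y' u = 0 := by
  have := RingQuot.mkAlgHom_rel (SymG K w)
    (HRel.mul_ne (K := K) (p := p) (w := w) (lam := lam) x y y' u hy)
  rw [map_mul, map_zero] at this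
  exact this

theorem c_mul_c_left (x u : Chambers p w lam) :
    c K p w lam x x * c K p w lam x u = c K p w lam x u := by
  rw [c_mul_c, Finset.prod_eq_one fun i _ => by rw [eta_self_left, pow_zero], map_one, one_mul]

theorem c_mul_c_right (x u : Chambers p w lam) :
    c K p w lam x u * c K p w lam u u = c K p w lam x u := by
  rw [c_mul_c, Finset.prod_eq_one fun i _ => by rw [eta_self_right, pow_zero], map_one, one_mul]

instance : DecidableEq (Chambers p w lam) := Classical.decEq _

variable (b : Chambers p w lam → LamPt w lam)

/-- `⨁ₓ M_{b x}`. -/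
def HomSum (M : WtMod K w lam) : Type u := Π₀ x, M.weight (b x).1

variable (M : WtMod K w lam)

instance : AddCommGroup (HomSum b M) := inferInstanceAs (AddCommGroup (Π₀ x, M.weight (b x).1))

instance : Module (SymG K w) (HomSum b M) :=
  inferInstanceAs (Module (SymG K w) (Π₀ x, M.weight (b x).1))

/-- The transition map as a map of `S`-modules. -/
def CmapS (a a' : LamPt w lam) : M.weight a.1 →ₗ[SymG K w] M.weight a'.1 where
  toFun := Cmap M a a'
  map_add' := map_add _
  map_smul' s v := Cmap_smul M a a' s v

/-- The inclusion of a summand. -/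
def inc (x : Chambers p w lam) : M.weight (b x).1 →ₗ[SymG K w] HomSum b M :=
  DFinsupp.lsingle (R := SymG K w) (M := fun x => M.weight (b x).1) x

/-- The projection to a summand. -/
def prj (x : Chambers p w lam) : HomSum b M →ₗ[SymG K w] M.weight (b x).1 :=
  DFinsupp.lapply (R := SymG K w) (M := fun x => M.weight (b x).1) x

theorem prj_inc (x : Chambers p w lam) (v : M.weight (b x).1) : prj b M x (inc b M x v) = v :=
  DFinsupp.single_eq_same

theorem prj_inc_ne {x y : Chambers p w lam} (h : y ≠ x) (v : M.weight (b x).1) :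
    prj b M y (inc b M x v) = 0 :=
  DFinsupp.single_eq_of_ne h

theorem HomSum_ext {v v' : HomSum b M} (h : ∀ x, prj b M x v = prj b M x v') : v = v' :=
  DFinsupp.ext h

theorem HomSum_induction {P : HomSum b M → Prop} (h0 : P 0) (hinc : ∀ x v, P (inc b M x v))
    (hadd : ∀ v v', P v → P v' → P (v + v')) (v : HomSum b M) : P v :=
  DFinsupp.induction v h0 fun x v _ _ _ hf => hadd _ _ (hinc x v) hf

/-- The action of `c_{x,y}`. -/
def cOp (x y : Chambers p w lam) : Module.End (SymG K w) (HomSum b M) :=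
  inc b M x ∘ₗ CmapS M (b y) (b x) ∘ₗ prj b M y

/-- The functor on morphisms, as a map of direct sums. -/
def homMap {M N : WtMod K w lam} (f : M ⟶ N) : HomSum b M →ₗ[SymG K w] HomSum b N :=
  DFinsupp.mapRange.linearMap fun x => WtMod.Hom.onWeight f (b x).1

theorem prj_homMap {M N : WtMod K w lam} (f : M ⟶ N) (x : Chambers p w lam) (v : HomSum b M) :
    prj b N x (homMap b f v) = WtMod.Hom.onWeight f (b x).1 (prj b M x v) :=
  DFinsupp.mapRange_apply (fun x => WtMod.Hom.onWeight f (b x).1) (fun _ => map_zero _) v x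

theorem homMap_inc {M N : WtMod K w lam} (f : M ⟶ N) (x : Chambers p w lam)
    (v : M.weight (b x).1) :
    homMap b f (inc b M x v) = inc b N x (WtMod.Hom.onWeight f (b x).1 v) :=
  DFinsupp.mapRange_single (f := fun x => WtMod.Hom.onWeight f (b x).1)
    (hf := fun _ => map_zero _)

end HomFunctor

/-! ### The action of `H^λ` and functoriality -/

section HomFunctor

variable {K : Type u} [Field K] {p : ℕ} [Fact p.Prime] [CharP K p] {n k : ℕ}
  {w : Fin n → Fin k → ℤ} {lam : Fin k → ℤ} (b : Chambers p w lam → LamPt w lam)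
  (hb : ∀ x, floor p (b x).1 = x.1) (M : WtMod K w lam)

/-- The action of `HAlg`. -/
def HAct : HAlg K p w lam →ₐ[SymG K w] Module.End (SymG K w) (HomSum b M) :=
  RingQuot.liftAlgHom (SymG K w)
    ⟨FreeAlgebra.lift (SymG K w) fun xy => cOp b M xy.1 xy.2, by
      intro f g hfg
      cases hfg with
      | mul x y u =>
        rw [map_mul, map_smul]
        simp only [FreeAlgebra.lift_ι_apply]
        ext v : 1
        change inc b M x (Cmap M (b y) (b x) (prj b M y (inc b M y
          (Cmap M (b u) (b y) (prj b M u v))))) =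
            (_ : SymG K w) • inc b M x (Cmap M (b u) (b x) (prj b M u v))
        rw [prj_inc, Cmap_Cmap M p, map_smul, hb, hb, hb]
      | mul_ne x y y' u hy =>
        rw [map_mul, map_zero]
        simp only [FreeAlgebra.lift_ι_apply]
        ext v : 1
        change inc b M x (Cmap M (b y) (b x) (prj b M y (inc b M y'
          (Cmap M (b u) (b y') (prj b M u v))))) = 0
        rw [prj_inc_ne b M hy, map_zero, map_zero]⟩

theorem HAct_c (x y : Chambers p w lam) : HAct b hb M (c K p w lam x y) = cOp b M x y := by
  refine (RingQuot.liftAlgHom_mkAlgHom_apply _ _ _ _).trans ?_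
  exact FreeAlgebra.lift_ι_apply _ _

/-- `⨁ₓ M_{b x}` as an `H^λ`-module. -/
@[reducible]
def HomSum.module : Module (HAlg K p w lam) (HomSum b M) :=
  Module.compHom _ (HAct b hb M).toRingHom

/-- The functor on objects. -/
def homObj : ModuleCat.{u} (HAlg K p w lam) :=
  @ModuleCat.of _ _ (HomSum b M) _ (HomSum.module b hb M)

variable {M}

/-- Elements of `homObj` as elements of the direct sum. -/
def toSum : homObj b hb M ≃+ HomSum b M := AddEquiv.refl _

theorem toSum_c_smul (x y : Chambers p w lam) (v : homObj b hb M) :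
    toSum b hb (c K p w lam x y • v) =
      inc b M x (Cmap M (b y) (b x) (prj b M y (toSum b hb v))) := by
  change HAct b hb M (c K p w lam x y) v = _
  rw [HAct_c]
  rfl

theorem toSum_algebraMap_smul (s : SymG K w) (v : homObj b hb M) :
    toSum b hb (algebraMap _ (HAlg K p w lam) s • v) = s • toSum b hb v := by
  change HAct b hb M (algebraMap _ _ s) v = _
  rw [AlgHom.commutes]
  rfl

/-- The functor on morphisms. -/
def homMapH {M N : WtMod K w lam} (f : M ⟶ N) :
    homObj b hb M →ₗ[HAlg K p w lam] homObj b hb N where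
  toFun v := (toSum b hb).symm (homMap b f (toSum b hb v))
  map_add' v v' := map_add (homMap b f) v v'
  map_smul' := HAlg_map_smul (V := homObj b hb M) (V' := homObj b hb N)
    (homMap b f).toAddMonoidHom (fun s v => by
      refine (toSum b hb).injective ?_
      rw [toSum_algebraMap_smul]
      change homMap b f (toSum b hb (algebraMap _ (HAlg K p w lam) s • v)) = _
      rw [toSum_algebraMap_smul]
      exact map_smul (homMap b f) s _) fun x y v => by
      refine (toSum b hb).injective ?_
      rw [toSum_c_smul]
      change homMap b f (toSum b hb (c K p w lam x y • v)) = _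
      rw [toSum_c_smul, homMap_inc, onWeight_Cmap]
      rw [← prj_homMap]
      rfl

theorem toSum_homMapH {M N : WtMod K w lam} (f : M ⟶ N) (v : homObj b hb M) :
    toSum b hb (homMapH b hb f v) = homMap b f (toSum b hb v) := rfl

variable (K) in
/-- The functor `Hom(⨁ₓ P_x, -)`. -/
def homFunctor : WtMod K w lam ⥤ ModuleCat.{u} (HAlg K p w lam) where
  obj M := homObj b hb M
  map {M N} f := ModuleCat.ofHom (X := homObj b hb M) (Y := homObj b hb N) (homMapH b hb f)
  map_id M := ModuleCat.hom_ext <| LinearMap.ext fun v =>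
    HomSum_ext b M fun x => prj_homMap b (𝟙 M) x v
  map_comp {M N P} f g := by
    refine ModuleCat.hom_ext <| LinearMap.ext fun v => HomSum_ext b P fun x => ?_
    refine (prj_homMap b (f ≫ g) x v).trans ?_
    refine Eq.trans ?_ (prj_homMap b g x _).symm
    exact congrArg (WtMod.Hom.onWeight g (b x).1) (prj_homMap b f x v).symm

end HomFunctor

/-! ### Identification with homomorphisms out of the `P_x` -/

section IsHomFunctor

variable {K : Type u} [Field K] {p : ℕ} [Fact p.Prime] [CharP K p] {n k : ℕ}
  {w : Fin n → Fin k → ℤ} {lam : Fin k → ℤ}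

theorem floor_eq_of_mem {a x : Fin n → ℤ} (ha : a ∈ chamber p w lam x) : floor p a = x := by
  have hp : (0 : ℤ) < p := by exact_mod_cast (Fact.out : p.Prime).pos
  ext i
  refine (Int.ediv_eq_iff_of_pos hp).2 ⟨?_, ?_⟩
  · rw [mul_comm]; exact (ha.2 i).1
  · rw [mul_comm]; exact (ha.2 i).2

theorem mem_chamber_floor (a : LamPt w lam) : a.1 ∈ chamber p w lam (floor p a.1) := by
  have hp : (0 : ℤ) < p := by exact_mod_cast (Fact.out : p.Prime).pos
  refine ⟨a.2, fun i => ⟨Int.mul_ediv_self_le hp.ne', ?_⟩⟩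
  exact Int.lt_mul_ediv_self_add hp

variable (p) in
/-- The chamber of a point. -/
def LamPt.chamberOf (a : LamPt w lam) : Chambers p w lam :=
  ⟨floor p a.1, a.1, mem_chamber_floor a⟩

variable (b : Chambers p w lam → Fin n → ℤ) (hb : ∀ x, b x ∈ chamber p w lam x.1)

/-- The points `b x` as characters restricting to `λ`. -/
abbrev ptOf (x : Chambers p w lam) : LamPt w lam := ⟨b x, (hb x).1⟩

theorem floor_ptOf (x : Chambers p w lam) : floor p (ptOf b hb x).1 = x.1 := floor_eq_of_mem (hb x)

variable (K) in
/-- The morphism `γ_{x,y} : P_x → P_y`. -/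
def gammaHom (x y : Chambers p w lam) : QHom K w lam (b x) (b y) :=
  QLift (cElem K w lam (b y) (b x - b y) (sub_trivial_of_mem p w lam (hb x) (hb y))) (by
    have := cElem_mem K w lam (b y) (b x - b y) (sub_trivial_of_mem p w lam (hb x) (hb y))
    rwa [add_sub_cancel] at this)

/-- The identification of `homObj` with `⨁ₓ Hom(P_x, M)`. -/
def homTheta (M : WtMod K w lam) : homObj (ptOf b hb) (floor_ptOf b hb) M ≃+
    Π₀ x : Chambers p w lam, HomQ K w lam (b x) M :=
  (toSum _ (floor_ptOf b hb)).trans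
    (DFinsupp.mapRange.addEquiv fun x => (homEquiv M (b x)).symm.toAddEquiv)

theorem homTheta_apply (M : WtMod K w lam) (v : homObj (ptOf b hb) (floor_ptOf b hb) M)
    (x : Chambers p w lam) : homTheta b hb M v x =
      (homEquiv M (b x)).symm (prj (ptOf b hb) M x (toSum _ (floor_ptOf b hb) v)) :=
  DFinsupp.mapRange_apply (fun x => (homEquiv M (b x)).symm) (fun _ => map_zero _) _ _

theorem homEquiv_symm_oneQ (M : WtMod K w lam) (a : Fin n → ℤ) (v : M.weight a) :
    ((homEquiv M a).symm v).1 (oneQ K w lam a) = v.1 :=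
  congrArg Subtype.val ((homEquiv M a).apply_symm_apply v)

theorem homTheta_scalar (M : WtMod K w lam) (r : K)
    (v : homObj (ptOf b hb) (floor_ptOf b hb) M) :
    homTheta b hb M (scalarH K p w lam r • v) = r • homTheta b hb M v := by
  refine DFinsupp.ext fun x => ?_
  rw [homTheta_apply, DFinsupp.smul_apply, homTheta_apply, ← map_smul]
  congr 1
  change prj _ M x (toSum _ _ (algebraMap _ _ (algebraMap K (SymG K w) r) • v)) = _
  rw [toSum_algebraMap_smul, map_smul, algebraMap_smul_weight]

theorem homTheta_natural {M N : WtMod K w lam} (f : M ⟶ N)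
    (v : homObj (ptOf b hb) (floor_ptOf b hb) M) (x : Chambers p w lam) :
    (homTheta b hb N (homMapH _ (floor_ptOf b hb) f v) x).1 =
      f.toLin ∘ₗ (homTheta b hb M v x).1 := by
  let _ : TopologicalSpace M.carrier := ⊥
  let _ : TopologicalSpace N.carrier := ⊥
  have _ : DiscreteTopology M.carrier := ⟨rfl⟩
  have _ : DiscreteTopology N.carrier := ⟨rfl⟩
  rw [homTheta_apply, homTheta_apply]
  refine ext_of_oneQ ((homEquiv N (b x)).symm _).2.1
    ((continuous_of_discreteTopology (f := f.toLin)).comp ((homEquiv M (b x)).symm _).2.1) ?_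
  rw [homEquiv_symm_oneQ, LinearMap.comp_apply, homEquiv_symm_oneQ]
  exact congrArg Subtype.val (prj_homMap _ f x (toSum _ (floor_ptOf b hb) v))

/-- Both sides are continuous on `P_x`, so they need only be compared at the generator, where both
give the value at `cElem`. -/
theorem homTheta_c (M : WtMod K w lam) (x y : Chambers p w lam)
    (v : homObj (ptOf b hb) (floor_ptOf b hb) M) :
    (homTheta b hb M (c K p w lam x y • v) x).1 =
      (homTheta b hb M v y).1 ∘ₗ (gammaHom K b hb x y).toLin := by
  let _ : TopologicalSpace M.carrier := ⊥
  have _ : DiscreteTopology M.carrier := ⟨rfl⟩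
  rw [homTheta_apply, homTheta_apply, toSum_c_smul, prj_inc]
  refine ext_of_oneQ ((homEquiv M (b x)).symm _).2.1
    (((homEquiv M (b y)).symm _).2.1.comp (gammaHom K b hb x y).cont) ?_
  refine (homEquiv_symm_oneQ M (b x) _).trans ?_
  rw [LinearMap.comp_apply]
  exact congrArg _ (QLift_oneQ _).symm

theorem homTheta_c_ne (M : WtMod K w lam) (x y u : Chambers p w lam)
    (v : homObj (ptOf b hb) (floor_ptOf b hb) M) (hu : u ≠ x) :
    homTheta b hb M (c K p w lam x y • v) u = 0 := by
  rw [homTheta_apply, toSum_c_smul, prj_inc_ne _ _ hu]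
  exact map_zero _

theorem homTheta_s (M : WtMod K w lam) (i : Fin n) (v : homObj (ptOf b hb) (floor_ptOf b hb) M)
    (x : Chambers p w lam) (a : Fin n → ℤ) (q : Q K w lam (b x)) (hq : q ∈ QWeight K w lam (b x) a) :
    (homTheta b hb M (sH K p w lam i • v) x).1 q =
      (h K w lam i - (a i : HEAQuot K w lam)) • (homTheta b hb M v x).1 q := by
  rw [homTheta_apply, homTheta_apply, sH, toSum_algebraMap_smul, map_smul]
  set u := prj (ptOf b hb) M x (toSum _ _ v)
  obtain ⟨N, hN⟩ := exists_kills M u.2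
  obtain ⟨y, hy, e⟩ := hq N
  have hs : (sS K w i • u).1 = sA K w lam (b x) (MvPolynomial.X i) • u.1 := rfl
  refine (homEquiv_symm_apply (a := b x) (sS K w i • u) (N := N)
    (by rw [hs]; exact hN.sA_smul _) e).trans ?_
  refine Eq.trans ?_ (congrArg _ (homEquiv_symm_apply (a := b x) u hN e)).symm
  -- At level `N` the element `q` is represented by `y` of weight `a - b x`; moving the operator
  -- past `y` changes `h_i - b_i` into `h_i - a_i`.
  rw [hs, ← mul_smul, ← sA_mul_of_mem_quotWeight K w lam (b x) hy, mul_smul, add_sub_cancel, sA_X]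

/-- The functor `homFunctor` is `Hom(⨁ₓ P_x, -)`. -/
def isHomFunctor : IsHomFunctor K p w lam b hb (homFunctor K (ptOf b hb) (floor_ptOf b hb)) where
  γ := gammaHom K b hb
  γ_one _ _ := QLift_oneQ _
  θ M := homTheta b hb M
  θ_scalar M r v := homTheta_scalar b hb M r v
  θ_natural _ _ f v x := homTheta_natural b hb f v x
  θ_c M x y v := homTheta_c b hb M x y v
  θ_c_ne M x y u v hu := homTheta_c_ne b hb M x y u v hu
  θ_s M i v x a q hq := homTheta_s b hb M i v x a q hq

end IsHomFunctor

/-! ### Decomposition into weight spaces -/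

section Decomposition

variable {K : Type u} [Field K] {n k : ℕ} {w : Fin n → Fin k → ℤ} {lam : Fin k → ℤ}
  (M : WtMod K w lam)

theorem weight_induction {P : M.carrier → Prop} (h0 : P 0)
    (hw : ∀ (a : LamPt w lam), ∀ v ∈ M.weight a.1, P v) (hadd : ∀ v v', P v → P v' → P (v + v'))
    (v : M.carrier) : P v := by
  have hv : v ∈ ⨆ a, M.weight a := by rw [M.internal.submodule_iSup_eq_top]; trivial
  refine Submodule.iSup_induction M.weight (motive := P) hv (fun a v hv => ?_) h0 hadd
  by_cases ha : ∑ i, a i • w i = lam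
  · exact hw ⟨a, ha⟩ v hv
  · rw [M.weight_eq_bot a ha, Submodule.mem_bot] at hv
    exact hv ▸ h0

/-- The isomorphism of the sum of the weight spaces with `M`. -/
def decomp : (DirectSum (Fin n → ℤ) fun a => M.weight a) ≃ₗ[K] M.carrier :=
  LinearEquiv.ofBijective (DirectSum.coeLinearMap M.weight) M.internal

theorem decomp_symm_apply {a : Fin n → ℤ} (v : M.weight a) :
    (decomp M).symm v.1 = DirectSum.lof K _ (fun a => M.weight a) a v := by
  rw [LinearEquiv.symm_apply_eq]
  exact (DirectSum.coeLinearMap_lof M.weight a v).symm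

/-- The projection to a weight space. -/
def component (a : Fin n → ℤ) : M.carrier →ₗ[K] M.weight a :=
  DirectSum.component K _ (fun a => M.weight a) a ∘ₗ (decomp M).symm.toLinearMap

theorem component_self {a : Fin n → ℤ} (v : M.weight a) : component M a v.1 = v := by
  rw [component, LinearMap.comp_apply, LinearEquiv.coe_coe, decomp_symm_apply,
    DirectSum.component.lof_self]

theorem component_ne {a a' : Fin n → ℤ} (h : a ≠ a') (v : M.weight a) :
    component M a' v.1 = 0 := by
  rw [component, LinearMap.comp_apply, LinearEquiv.coe_coe, decomp_symm_apply,
    DirectSum.component.of, dif_neg h]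

/-- By `m_smul_eq`, the submodule generated by a homogeneous vector is additively generated by the
images of its `S`-multiples under the transition maps. -/
theorem component_smul_induction (a : LamPt w lam) (v : M.weight a.1) {P : M.carrier → Prop}
    (hadd : ∀ v v', P v → P v' → P (v + v'))
    (hC : ∀ (a' : LamPt w lam) (s : SymG K w), P (Cmap M a a' (s • v)).1)
    (x : HEAQuot K w lam) : P (x • v.1) := by
  induction x using HEAQuot_induction K w lam a.1 with
  | hm b hb f =>
    have ha' : ∑ i, (a.1 + b) i • w i = lam := by
      simp only [Pi.add_apply, add_smul, Finset.sum_add_distrib]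
      rw [hb, a.2, add_zero]
    have := m_smul_eq M a ⟨a.1 + b, ha'⟩ hb rfl (mkS K w f • v)
    rw [coe_mkS_smul] at this
    rw [mul_smul, this, ← mul_smul]
    exact hC _ _
  | hadd x y hx hy => rw [add_smul]; exact hadd _ _ hx hy

theorem exists_homogeneous_generators : ∃ G : Set M.carrier, G.Finite ∧
    (∀ v ∈ G, ∃ a : LamPt w lam, v ∈ M.weight a.1) ∧
      Submodule.span (HEAQuot K w lam) G = ⊤ := by
  have key : ∀ t : M.carrier, ∃ G : Set M.carrier, G.Finite ∧
      (∀ v ∈ G, ∃ a : LamPt w lam, v ∈ M.weight a.1) ∧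
        t ∈ Submodule.span (HEAQuot K w lam) G := by
    intro t
    induction t using weight_induction M with
    | h0 => exact ⟨∅, Set.finite_empty, by simp, zero_mem _⟩
    | hw a v hv =>
      exact ⟨{v}, Set.finite_singleton v, by rintro _ rfl; exact ⟨a, hv⟩,
        Submodule.mem_span_singleton_self v⟩
    | hadd v v' hv hv' =>
      obtain ⟨G, hG, h1, h2⟩ := hv
      obtain ⟨G', hG', h1', h2'⟩ := hv'
      refine ⟨G ∪ G', hG.union hG', ?_, add_mem (Submodule.span_mono Set.subset_union_left h2)
        (Submodule.span_mono Set.subset_union_right h2')⟩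
      rintro v (hv | hv)
      exacts [h1 v hv, h1' v hv]
  choose G hG h1 h2 using key
  obtain ⟨T, hT⟩ := M.finite
  refine ⟨⋃ t ∈ T, G t, T.finite_toSet.biUnion fun t _ => hG t, ?_, ?_⟩
  · intro v hv
    obtain ⟨t, -, hv⟩ := Set.mem_iUnion₂.1 hv
    exact h1 t v hv
  · rw [← top_le_iff, ← hT, Submodule.span_le]
    intro t ht
    exact Submodule.span_mono (Set.subset_biUnion_of_mem (u := G) ht) (h2 t)

variable {M} {N : WtMod K w lam}

open Classical in
/-- Extension by zero of a family of maps of weight spaces. -/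
def extendFamily (φ : ∀ a : LamPt w lam, M.weight a.1 →ₗ[SymG K w] N.weight a.1)
    (a : Fin n → ℤ) : M.weight a →ₗ[K] N.carrier :=
  if ha : ∑ i, a i • w i = lam then
    { toFun v := (φ ⟨a, ha⟩ v).1
      map_add' v v' := by rw [map_add]; rfl
      map_smul' r v := by
        rw [← algebraMap_smul_weight, map_smul, algebraMap_smul_weight]; rfl }
  else 0

/-- The linear map defined by a family of maps of weight spaces. -/
def ofFamilyLin (φ : ∀ a : LamPt w lam, M.weight a.1 →ₗ[SymG K w] N.weight a.1) :
    M.carrier →ₗ[K] N.carrier :=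
  DirectSum.toModule K _ _ (extendFamily φ) ∘ₗ (decomp M).symm.toLinearMap

theorem ofFamilyLin_apply (φ : ∀ a : LamPt w lam, M.weight a.1 →ₗ[SymG K w] N.weight a.1)
    (a : LamPt w lam) (v : M.weight a.1) : ofFamilyLin φ v.1 = (φ a v).1 := by
  rw [ofFamilyLin, LinearMap.comp_apply, LinearEquiv.coe_coe, decomp_symm_apply,
    DirectSum.toModule_lof, extendFamily, dif_pos a.2]
  rfl

/-- A morphism defined on weight spaces by maps commuting with the transition maps. -/
def homOfFamily (φ : ∀ a : LamPt w lam, M.weight a.1 →ₗ[SymG K w] N.weight a.1)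
    (hφ : ∀ a a' v, φ a' (Cmap M a a' v) = Cmap N a a' (φ a v)) : M ⟶ N where
  toLin :=
    { toFun := ofFamilyLin φ
      map_add' := map_add _
      map_smul' := by
        intro x v
        rw [RingHom.id_apply]
        induction v using weight_induction M with
        | h0 => rw [smul_zero, map_zero, smul_zero]
        | hw a v hv =>
          induction x using HEAQuot_induction K w lam a.1 with
          | hm b hb f =>
            have ha' : ∑ i, (a.1 + b) i • w i = lam := by
              simp only [Pi.add_apply, add_smul, Finset.sum_add_distrib]
              rw [hb, a.2, add_zero]
            have e1 := m_smul_eq M a ⟨a.1 + b, ha'⟩ hb rfl (mkS K w f • ⟨v, hv⟩)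
            have e2 := m_smul_eq N a ⟨a.1 + b, ha'⟩ hb rfl (mkS K w f • φ a ⟨v, hv⟩)
            rw [coe_mkS_smul] at e1 e2
            -- The action of `m(b) f` is expressed through `S` and a transition map on both sides,
            -- and the family commutes with these by assumption.
            rw [mul_smul, mul_smul, e1, ofFamilyLin_apply, hφ, (φ a).map_smul,
              (φ a).map_smul, ← e2]
            congr 2
            exact (ofFamilyLin_apply φ a ⟨v, hv⟩).symm
          | hadd x y hx hy => rw [add_smul, map_add, hx, hy, add_smul]
        | hadd v v' hv hv' => rw [smul_add, map_add, hv, hv', map_add, smul_add] }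
  map_weight a v hv := by
    by_cases ha : ∑ i, a i • w i = lam
    · have := ofFamilyLin_apply φ ⟨a, ha⟩ ⟨v, hv⟩
      change ofFamilyLin φ v ∈ _
      rw [this]
      exact Subtype.prop _
    · rw [M.weight_eq_bot a ha, Submodule.mem_bot] at hv
      rw [hv, map_zero]
      exact zero_mem _

theorem homOfFamily_apply (φ : ∀ a : LamPt w lam, M.weight a.1 →ₗ[SymG K w] N.weight a.1)
    (hφ : ∀ a a' v, φ a' (Cmap M a a' v) = Cmap N a a' (φ a v)) (a : LamPt w lam)
    (v : M.weight a.1) : WtMod.Hom.onWeight (homOfFamily φ hφ) a.1 v = φ a v :=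
  Subtype.ext (ofFamilyLin_apply φ a v)

theorem hom_ext_weight {f g : M ⟶ N}
    (hfg : ∀ a : LamPt w lam, WtMod.Hom.onWeight f a.1 = WtMod.Hom.onWeight g a.1) : f = g := by
  refine WtMod.Hom.ext (LinearMap.ext fun v => ?_)
  induction v using weight_induction M with
  | h0 => rw [map_zero, map_zero]
  | hw a v hv => exact congrArg Subtype.val (LinearMap.congr_fun (hfg a) ⟨v, hv⟩)
  | hadd v v' hv hv' => rw [map_add, map_add, hv, hv']

end Decomposition

/-! ### Nilpotent modules -/

section Nilpotent

variable {K : Type u} [Field K] {p n k : ℕ} {w : Fin n → Fin k → ℤ} {lam : Fin k → ℤ}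

/-- The `s_i` are central, so an exponent that works on finitely many generators works everywhere.
-/
theorem sNilpotent_of_generators {V : ModuleCat.{u} (HAlg K p w lam)} {G : Set V} (hG : G.Finite)
    (hN : ∀ v ∈ G, ∃ N : ℕ, ∀ i, sH K p w lam i ^ N • v = 0)
    (hspan : Submodule.span (HAlg K p w lam) G = ⊤) : SNilpotent K p w lam V := by
  intro i
  choose! N hN using hN
  refine ⟨hG.toFinset.sup N, fun v => ?_⟩
  have hv : v ∈ Submodule.span (HAlg K p w lam) G := by rw [hspan]; trivial
  induction hv using Submodule.span_induction with
  | mem v hv =>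
    rw [← Nat.sub_add_cancel (Finset.le_sup (f := N) (hG.mem_toFinset.2 hv)), pow_add, mul_smul,
      hN v hv, smul_zero]
  | zero => rw [smul_zero]
  | add v v' _ _ hv hv' => rw [smul_add, hv, hv', add_zero]
  | smul t v _ hv =>
    rw [← mul_smul, sH, ← map_pow, Algebra.commutes, mul_smul, map_pow]
    change t • sH K p w lam i ^ _ • v = 0
    rw [hv, smul_zero]

end Nilpotent

/-! ### The functor is fully faithful -/

section FullyFaithful

variable {K : Type u} [Field K] {p : ℕ} [Fact p.Prime] [CharP K p] {n k : ℕ}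
  {w : Fin n → Fin k → ℤ} {lam : Fin k → ℤ} (b : Chambers p w lam → LamPt w lam)
  (hb : ∀ x, floor p (b x).1 = x.1)

/-- Each weight space is identified by a transition map with that of the base point of its chamber,
compatibly with morphisms; so the restriction to base points determines the morphism. -/
theorem homFunctor_faithful : (homFunctor K b hb).Faithful where
  map_injective {M N} f g hfg := by
    refine hom_ext_weight fun a => LinearMap.ext fun v => ?_
    have hx : floor p (b (a.chamberOf p)).1 = floor p a.1 := hb _
    have h1 : ∀ f : M ⟶ N, Cmap N (b (a.chamberOf p)) a (prj b N (a.chamberOf p) (homMap b f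
        (inc b M (a.chamberOf p) (Cmap M a (b (a.chamberOf p)) v)))) =
        WtMod.Hom.onWeight f a.1 v := by
      intro f
      rw [homMap_inc, prj_inc, onWeight_Cmap, Cmap_Cmap_of_eq N p _ _ _ _ (Or.inl hx), Cmap_self]
    rw [← h1 f, ← h1 g]
    congr 2
    have := congrArg (fun t => t.hom ((toSum b hb).symm (inc b M (a.chamberOf p)
      (Cmap M a (b (a.chamberOf p)) v)))) hfg
    exact this

variable {M N : WtMod K w lam}

section Full

variable (g : homObj b hb M →ₗ[HAlg K p w lam] homObj b hb N)

/-- The component of a map of `H^λ`-modules. -/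
def hComponent (x : Chambers p w lam) : M.weight (b x).1 →ₗ[SymG K w] N.weight (b x).1 where
  toFun v := prj b N x (toSum b hb (g ((toSum b hb).symm (inc b M x v))))
  map_add' v v' := by simp only [map_add]
  map_smul' s v := by
    have : (toSum b hb).symm (inc b M x (s • v)) =
        algebraMap _ (HAlg K p w lam) s • (toSum b hb).symm (inc b M x v) := by
      refine (toSum b hb).injective ?_
      rw [toSum_algebraMap_smul, map_smul]
      rfl
    rw [this, map_smul, toSum_algebraMap_smul, map_smul]
    rfl

theorem hComponent_Cmap (x y : Chambers p w lam) (v : M.weight (b y).1) :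
    hComponent b hb g x (Cmap M (b y) (b x) v) = Cmap N (b y) (b x) (hComponent b hb g y v) := by
  have h1 : (toSum b hb).symm (inc b M x (Cmap M (b y) (b x) v)) =
      c K p w lam x y • (toSum b hb).symm (inc b M y v) := by
    refine (toSum b hb).injective ?_
    rw [toSum_c_smul, AddEquiv.apply_symm_apply, AddEquiv.apply_symm_apply, prj_inc]
  change prj b N x (toSum b hb (g _)) = _
  rw [h1, map_smul, toSum_c_smul, prj_inc]
  rfl

theorem toSum_apply_inc (x : Chambers p w lam) (v : M.weight (b x).1) :
    toSum b hb (g ((toSum b hb).symm (inc b M x v))) = inc b N x (hComponent b hb g x v) := by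
  have h1 : (toSum b hb).symm (inc b M x v) =
      c K p w lam x x • (toSum b hb).symm (inc b M x v) := by
    refine (toSum b hb).injective ?_
    rw [toSum_c_smul, AddEquiv.apply_symm_apply, prj_inc, Cmap_self]
  rw [h1, map_smul, toSum_c_smul, Cmap_self]
  rfl

/-- The morphism with given image under the functor. -/
def preimageFamily (a : LamPt w lam) : M.weight a.1 →ₗ[SymG K w] N.weight a.1 :=
  CmapS N (b (a.chamberOf p)) a ∘ₗ hComponent b hb g (a.chamberOf p) ∘ₗ
    CmapS M a (b (a.chamberOf p))

/-- Every path used here passes through a base point lying in the chamber of one of its ends, so all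
structure constants are `1`, and the claim reduces to the compatibility of the map with `c_{x,y}`.
-/
theorem preimageFamily_Cmap (a a' : LamPt w lam) (v : M.weight a.1) :
    preimageFamily b hb g a' (Cmap M a a' v) = Cmap N a a' (preimageFamily b hb g a v) := by
  have hx : floor p (b (a.chamberOf p)).1 = floor p a.1 := hb _
  have hx' : floor p (b (a'.chamberOf p)).1 = floor p a'.1 := hb _
  change Cmap N _ _ (hComponent b hb g _ (Cmap M _ _ (Cmap M a a' v))) =
    Cmap N a a' (Cmap N _ _ (hComponent b hb g _ (Cmap M _ _ v)))
  rw [Cmap_Cmap_of_eq M p a a' _ v (Or.inl hx'.symm),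
    ← Cmap_Cmap_of_eq M p a (b (a.chamberOf p)) _ v (Or.inr hx), hComponent_Cmap,
    Cmap_Cmap_of_eq N p _ _ _ _ (Or.inl hx'), Cmap_Cmap_of_eq N p _ _ _ _ (Or.inr hx.symm)]

theorem preimageFamily_base (x : Chambers p w lam) (v : M.weight (b x).1) :
    preimageFamily b hb g (b x) v = hComponent b hb g x v := by
  have hx : (b x).chamberOf p = x := Subtype.ext (hb x)
  change Cmap N (b ((b x).chamberOf p)) _ (hComponent b hb g _ (Cmap M _ _ v)) = _
  rw [hx, Cmap_self, Cmap_self]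

theorem homMapH_preimage (v : homObj b hb M) :
    homMapH b hb (homOfFamily (preimageFamily b hb g) (preimageFamily_Cmap b hb g)) v = g v := by
  have key : ∀ v : HomSum b M, homMap b (homOfFamily (preimageFamily b hb g)
      (preimageFamily_Cmap b hb g)) v = toSum b hb (g ((toSum b hb).symm v)) := by
    intro v
    induction v using HomSum_induction with
    | h0 => simp only [map_zero]
    | hinc x v => rw [homMap_inc, homOfFamily_apply, preimageFamily_base, toSum_apply_inc]
    | hadd v v' hv hv' => simp only [map_add, hv, hv']
  exact (toSum b hb).injective ((toSum_homMapH b hb _ v).trans (key _))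

end Full

theorem homFunctor_full : (homFunctor K b hb).Full where
  map_surjective {M N} g :=
    ⟨homOfFamily (preimageFamily b hb (M := M) (N := N) g.hom) (preimageFamily_Cmap b hb g.hom),
      ModuleCat.hom_ext (LinearMap.ext fun v => homMapH_preimage b hb (M := M) (N := N) g.hom v)⟩

/-! ### Finiteness of the values of the functor -/

theorem toSum_symm_inc_smul (x : Chambers p w lam) (s : SymG K w) (v : M.weight (b x).1) :
    (toSum b hb).symm (inc b M x (s • v)) =
      algebraMap _ (HAlg K p w lam) s • (toSum b hb).symm (inc b M x v) := by
  refine (toSum b hb).injective ?_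
  rw [toSum_algebraMap_smul, map_smul]
  rfl

theorem toSum_symm_inc_Cmap (x y : Chambers p w lam) (v : M.weight (b y).1) :
    (toSum b hb).symm (inc b M x (Cmap M (b y) (b x) v)) =
      c K p w lam x y • (toSum b hb).symm (inc b M y v) := by
  refine (toSum b hb).injective ?_
  rw [toSum_c_smul, AddEquiv.apply_symm_apply, AddEquiv.apply_symm_apply, prj_inc]

variable (M)

theorem homObj_locallyUnital : LocallyUnital K p w lam (homObj b hb M) := by
  rw [LocallyUnital, eq_top_iff]
  intro v _
  have key : ∀ v : HomSum b M, (toSum b hb).symm v ∈ AddSubgroup.closure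
      {v : homObj b hb M | ∃ (x : Chambers p w lam) (u : homObj b hb M),
        v = c K p w lam x x • u} := by
    intro v
    induction v using HomSum_induction with
    | h0 => rw [map_zero]; exact zero_mem _
    | hinc x v =>
      refine AddSubgroup.subset_closure ⟨x, (toSum b hb).symm (inc b M x v), ?_⟩
      rw [← toSum_symm_inc_Cmap, Cmap_self]
    | hadd v v' hv hv' => rw [map_add]; exact add_mem hv hv'
  exact key v

/-- Transport homogeneous generators of `M` to the base points of their chambers. The transition map
from a generator to any base point factors through this transport without structure constant, so it
is the action of some `c_{x,y}`. -/
theorem exists_homObj_generators : ∃ G : Set (homObj b hb M), G.Finite ∧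
    (∀ v ∈ G, ∃ N : ℕ, ∀ i, sH K p w lam i ^ N • v = 0) ∧
      Submodule.span (HAlg K p w lam) G = ⊤ := by
  obtain ⟨G, hG, hw, hspan⟩ := exists_homogeneous_generators M
  choose a ha using hw
  let gen : G → homObj b hb M := fun v => (toSum b hb).symm (inc b M ((a v.1 v.2).chamberOf p)
    (Cmap M (a v.1 v.2) (b ((a v.1 v.2).chamberOf p)) ⟨v.1, ha v.1 v.2⟩))
  have : Finite G := hG
  refine ⟨Set.range gen, Set.finite_range gen, ?_, ?_⟩
  · rintro _ ⟨v, rfl⟩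
    obtain ⟨N, hN⟩ := exists_kills M (ha v.1 v.2)
    refine ⟨N, fun i => ?_⟩
    have : sS K w i ^ N • (⟨v.1, ha v.1 v.2⟩ : M.weight (a v.1 v.2).1) = 0 := by
      have e := coe_mkS_smul M (a v.1 v.2).1 (MvPolynomial.X i ^ N) ⟨v.1, ha v.1 v.2⟩
      rw [map_pow, map_pow, sA_X, hN i] at e
      exact Subtype.ext e
    change sH K p w lam i ^ N • (toSum b hb).symm (inc b M _ _) = 0
    rw [sH, ← map_pow, ← toSum_symm_inc_smul, ← Cmap_smul, this, map_zero, map_zero, map_zero]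
  -- The multiplier `r` belongs to the statement because taking components is not `A^λ`-linear; with
  -- it, the induction on the span passes through scalar multiples.
  · have key : ∀ (v : M.carrier) (r : HEAQuot K w lam) (x : Chambers p w lam),
        (toSum b hb).symm (inc b M x (component M (b x).1 (r • v))) ∈
          Submodule.span (HAlg K p w lam) (Set.range gen) := by
      intro v
      have hv : v ∈ Submodule.span (HEAQuot K w lam) G := by rw [hspan]; trivial
      induction hv using Submodule.span_induction with
      | mem v hv =>
        intro r x
        refine component_smul_induction M (a v hv) ⟨v, ha v hv⟩ (P := fun t => (toSum b hb).symm
          (inc b M x (component M (b x).1 t)) ∈ Submodule.span (HAlg K p w lam) (Set.range gen))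
          (fun v v' h h' => by simp only [map_add]; exact add_mem h h') (fun a' s => ?_) r
        by_cases hax : a'.1 = (b x).1
        · obtain rfl : a' = b x := Subtype.ext hax
          have hx : floor p (b ((a v hv).chamberOf p)).1 = floor p (a v hv).1 := hb _
          rw [component_self, Cmap_smul, toSum_symm_inc_smul,
            ← Cmap_Cmap_of_eq M p (a v hv) (b ((a v hv).chamberOf p)) _ _ (Or.inr hx),
            toSum_symm_inc_Cmap]
          exact Submodule.smul_mem _ _ (Submodule.smul_mem _ _
            (Submodule.subset_span ⟨⟨v, hv⟩, rfl⟩))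
        · rw [component_ne M hax, map_zero, map_zero]
          exact zero_mem _
      | zero => intro r x; rw [smul_zero, map_zero, map_zero, map_zero]; exact zero_mem _
      | add v v' _ _ hv hv' =>
        intro r x
        simp only [smul_add, map_add]
        exact add_mem (hv r x) (hv' r x)
      | smul t v _ hv => intro r x; rw [← mul_smul]; exact hv _ x
    have key' : ∀ v : HomSum b M, (toSum b hb).symm v ∈
        Submodule.span (HAlg K p w lam) (Set.range gen) := by
      intro v
      induction v using HomSum_induction with
      | h0 => rw [map_zero]; exact zero_mem _
      | hinc x v =>
        have := key v.1 1 x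
        rwa [one_smul, component_self] at this
      | hadd v v' hv hv' => rw [map_add]; exact add_mem hv hv'
    exact eq_top_iff.2 fun v _ => key' v

theorem homObj_fgNil : fgNil K p w lam (homObj b hb M) := by
  obtain ⟨G, hG, hN, hspan⟩ := exists_homObj_generators b hb M
  exact ⟨homObj_locallyUnital b hb M, sNilpotent_of_generators hG hN hspan,
    ⟨hG.toFinset, by rwa [hG.coe_toFinset]⟩⟩

end FullyFaithful

/-! ### A module over the Weyl algebra built from an `H^λ`-module -/

section Coefficients

variable (K : Type u) [Field K] (p : ℕ) {n k : ℕ} (w : Fin n → Fin k → ℤ)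

/-- The coefficient of `z_i^β` (or `∂_i^{-β}`) from weight `α` to weight `α + β`, seen from the
chamber `t`. -/
def mCoeff (i : Fin n) (t α β : ℤ) : SymG K w :=
  Polynomial.aeval (sS K w i) (qInv K α β) * sS K w i ^ eta t ((α + β) / p) (α / p)

theorem qInv_add_one {β : ℤ} (hβ : 0 ≤ β) (α : ℤ) :
    qInv K α (β + 1) = qInv K α β * qInv K (α + β) 1 := by
  classical
  obtain ⟨l, rfl⟩ := Int.eq_ofNat_of_zero_le hβ
  have hF : ∀ a b, qInv K a b = ∏ j ∈ Finset.Icc 1 b.toNat,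
      (fun c : ℤ => if (c : K) = 0 then 1 else Polynomial.X + Polynomial.C (c : K)) (a + (j : ℤ)) :=
    fun a b => by rw [qInv]
  rw [hF, hF, hF, show ((l : ℤ) + 1).toNat = l + 1 by omega,
    Finset.prod_Icc_succ_top (by omega), Int.toNat_one, Finset.Icc_self, Finset.prod_singleton,
    Nat.cast_succ, Nat.cast_one, add_assoc, Int.toNat_natCast]

theorem qInv_of_nonpos {β : ℤ} (hβ : β ≤ 0) (α : ℤ) : qInv K α β = 1 := by
  rw [qInv, show β.toNat = 0 by omega]
  simp

theorem mCoeff_zero (i : Fin n) (t α : ℤ) : mCoeff K p w i t α 0 = 1 := by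
  simp [mCoeff, qInv_of_nonpos, eta]

variable [Fact p.Prime]

/-- For steps in one direction the distances between successive chambers add, so the exponents `η`
seen from `t` telescope. -/
theorem mCoeff_add_one (i : Fin n) (t α : ℤ) {β : ℤ} (hβ : 0 ≤ β) :
    mCoeff K p w i t α (β + 1) = mCoeff K p w i t (α + β) 1 * mCoeff K p w i t α β := by
  have hp' : (0 : ℤ) < p := by exact_mod_cast (Fact.out : p.Prime).pos
  have h1 : α / (p : ℤ) ≤ (α + β) / p := Int.ediv_le_ediv hp' (by omega)
  have h2 : (α + β) / (p : ℤ) ≤ (α + (β + 1)) / p := Int.ediv_le_ediv hp' (by omega)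
  have h3 : eta t ((α + (β + 1)) / p) (α / p) =
      eta t ((α + β + 1) / p) ((α + β) / p) + eta t ((α + β) / p) (α / p) := by
    rw [show α + β + 1 = α + (β + 1) by ring]
    simp only [eta, abs_eq_max_neg]; omega
  rw [mCoeff, mCoeff, mCoeff, qInv_add_one K hβ, map_mul, h3, pow_add]
  ring

theorem mCoeff_sub_one (i : Fin n) (t α : ℤ) {β : ℤ} (hβ : β ≤ 0) :
    mCoeff K p w i t α (β - 1) = mCoeff K p w i t (α + β) (-1) * mCoeff K p w i t α β := by
  have hp' : (0 : ℤ) < p := by exact_mod_cast (Fact.out : p.Prime).pos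
  have h1 : (α + β) / (p : ℤ) ≤ α / p := Int.ediv_le_ediv hp' (by omega)
  have h2 : (α + (β - 1)) / (p : ℤ) ≤ (α + β) / p := Int.ediv_le_ediv hp' (by omega)
  have h3 : eta t ((α + (β - 1)) / p) (α / p) =
      eta t ((α + β + -1) / p) ((α + β) / p) + eta t ((α + β) / p) (α / p) := by
    rw [show α + β + -1 = α + (β - 1) by ring]
    simp only [eta, abs_eq_max_neg]; omega
  rw [mCoeff, mCoeff, mCoeff, qInv_of_nonpos K hβ, qInv_of_nonpos K (by omega),
    qInv_of_nonpos K (by omega), h3, pow_add, map_one, one_mul, one_mul, one_mul]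

variable [CharP K p]

/-- If `p` does not divide `α + 1`, the chamber is unchanged and `qInv` supplies the factor.
Otherwise exactly one of the two steps moves away from `t`, and that one contributes `s_i`, while `α
+ 1` vanishes in `K`. -/
theorem mCoeff_down_up (i : Fin n) (t α : ℤ) :
    mCoeff K p w i t (α + 1) (-1) * mCoeff K p w i t α 1 = sS K w i + ((α + 1 : ℤ) : SymG K w) := by
  classical
  have hp : 0 < p := (Fact.out : p.Prime).pos
  rw [mCoeff, mCoeff, qInv_of_nonpos K (by omega), map_one, one_mul, add_neg_cancel_right, qInv]
  have hdiv := add_one_ediv hp α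
  have hc : ((α + 1 : ℤ) : SymG K w) = algebraMap K (SymG K w) ((α + 1 : ℤ) : K) :=
    (map_intCast _ _).symm
  by_cases hd : (p : ℤ) ∣ α + 1
  · have h0 := (CharP.intCast_eq_zero_iff K p (α + 1)).2 hd
    rw [if_pos hd] at hdiv
    have h1 : eta t (α / p) ((α + 1) / p) + eta t ((α + 1) / p) (α / p) = 1 := by
      rw [hdiv]
      simp only [eta, abs_eq_max_neg]; omega
    rw [hc, h0, map_zero, add_zero]
    rw [Int.toNat_one, Finset.Icc_self, Finset.prod_singleton, Nat.cast_one, if_pos h0, map_one,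
      one_mul, ← pow_add, h1, pow_one]
  · have h0 := fun h => hd ((CharP.intCast_eq_zero_iff K p (α + 1)).1 h)
    rw [if_neg hd, add_zero] at hdiv
    have h1 : ∀ x, eta t x x = 0 := fun x => by simp [eta]
    rw [Int.toNat_one, Finset.Icc_self, Finset.prod_singleton, Nat.cast_one, if_neg h0, hdiv, h1,
      hc]
    simp

theorem mCoeff_up_down (i : Fin n) (t α : ℤ) :
    mCoeff K p w i t (α + -1) 1 * mCoeff K p w i t α (-1) = sS K w i + (α : SymG K w) := by
  have := mCoeff_down_up K p w i t (α + -1)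
  rwa [neg_add_cancel_right, mul_comm] at this

end Coefficients

/-! ### The Weyl algebra acting on families indexed by weights and chambers -/

section WeylAction

variable {K : Type u} [Field K] {p n k : ℕ} {w : Fin n → Fin k → ℤ} {lam : Fin k → ℤ}
  {V : Type u} [AddCommGroup V] [Module K V] [Module (SymG K w) V] [IsScalarTower K (SymG K w) V]

theorem smul_symG_comm (r : K) (s : SymG K w) (v : V) : s • r • v = r • s • v := by
  rw [← algebraMap_smul (SymG K w) r v, smul_smul, mul_comm, ← smul_smul, algebraMap_smul]

variable (K p w lam V) in
/-- Finitely supported families, indexed by the weights, of families of vectors indexed by the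
chambers. -/
abbrev Fam : Type u := (Fin n → ℤ) →₀ (Chambers p w lam → V)

/-- Componentwise multiplication. -/
def mulFam (r : Chambers p w lam → SymG K w) :
    (Chambers p w lam → V) →ₗ[K] (Chambers p w lam → V) where
  toFun f y := r y • f y
  map_add' _ _ := funext fun _ => smul_add _ _ _
  map_smul' _ _ := funext fun _ => smul_symG_comm _ _ _

/-- The operator of degree `e` with given coefficients. -/
def famOp (κ : (Fin n → ℤ) → Chambers p w lam → SymG K w) (e : Fin n → ℤ) :
    Module.End K (Fam p w lam V) :=
  Finsupp.lsum K fun a => Finsupp.lsingle (a + e) ∘ₗ mulFam (κ a)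

theorem famOp_single (κ : (Fin n → ℤ) → Chambers p w lam → SymG K w) (e a : Fin n → ℤ)
    (f : Chambers p w lam → V) :
    (famOp κ e : Module.End K (Fam p w lam V)) (Finsupp.single a f) =
      Finsupp.single (a + e) fun y => κ a y • f y :=
  Finsupp.lsum_single _ _ _ _

theorem famOp_mul (κ κ' : (Fin n → ℤ) → Chambers p w lam → SymG K w) (e e' : Fin n → ℤ) :
    (famOp κ' e' * famOp κ e : Module.End K (Fam p w lam V)) =
      famOp (fun a y => κ' (a + e) y * κ a y) (e + e') := by
  refine Finsupp.lhom_ext fun a f => ?_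
  rw [Module.End.mul_apply, famOp_single, famOp_single, famOp_single, add_assoc]
  simp only [mul_smul]

theorem famOp_one : (famOp (fun _ _ => 1) 0 : Module.End K (Fam p w lam V)) = 1 := by
  refine Finsupp.lhom_ext fun a f => ?_
  rw [famOp_single]
  simp

theorem famOp_add (κ κ' : (Fin n → ℤ) → Chambers p w lam → SymG K w) (e : Fin n → ℤ) :
    (famOp κ e + famOp κ' e : Module.End K (Fam p w lam V)) =
      famOp (fun a y => κ a y + κ' a y) e := by
  refine Finsupp.lhom_ext fun a f => ?_
  rw [LinearMap.add_apply, famOp_single, famOp_single, famOp_single, ← Finsupp.single_add]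
  simp only [add_smul]
  rfl

variable (K p w lam V) in
/-- The action of `z_i^β`, or of `∂_i^{-β}`. -/
def stepOp (i : Fin n) (β : ℤ) : Module.End K (Fam p w lam V) :=
  famOp (fun a y => mCoeff K p w i (y.1 i) (a i) β) (Pi.single i β)

theorem stepOp_commute {i j : Fin n} (hij : i ≠ j) (β β' : ℤ) :
    Commute (stepOp K p w lam V i β) (stepOp K p w lam V j β') := by
  rw [Commute, SemiconjBy, stepOp, stepOp, famOp_mul, famOp_mul, add_comm]
  congr 1
  funext a y
  rw [Pi.add_apply, Pi.add_apply, Pi.single_eq_of_ne hij, Pi.single_eq_of_ne hij.symm, add_zero,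
    add_zero, mul_comm]

variable [Fact p.Prime]

theorem stepOp_pow (i : Fin n) (l : ℕ) :
    stepOp K p w lam V i 1 ^ l = stepOp K p w lam V i l := by
  induction l with
  | zero =>
    rw [pow_zero, ← famOp_one, stepOp]
    simp [mCoeff_zero]
  | succ l ih =>
    rw [pow_succ', ih, stepOp, stepOp, stepOp, famOp_mul, ← Pi.single_add]
    congr 1
    funext a y
    rw [Pi.add_apply, Pi.single_eq_same, Nat.cast_succ, mCoeff_add_one K p w i _ _ (by omega)]

theorem stepOp_pow_neg (i : Fin n) (l : ℕ) :
    stepOp K p w lam V i (-1) ^ l = stepOp K p w lam V i (-(l : ℤ)) := by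
  induction l with
  | zero =>
    rw [pow_zero, ← famOp_one, stepOp]
    simp [mCoeff_zero]
  | succ l ih =>
    rw [pow_succ', ih, stepOp, stepOp, stepOp, famOp_mul, ← Pi.single_add, Nat.cast_succ, neg_add]
    congr 1
    funext a y
    rw [Pi.add_apply, Pi.single_eq_same, ← sub_eq_add_neg _ (1 : ℤ),
      mCoeff_sub_one K p w i _ _ (by omega)]

theorem zdPow_stepOp (i : Fin n) (β : ℤ) :
    zdPow (stepOp K p w lam V i 1) (stepOp K p w lam V i (-1)) β = stepOp K p w lam V i β := by
  rcases le_total 0 β with h | h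
  · obtain ⟨l, rfl⟩ := Int.eq_ofNat_of_zero_le h
    rw [zdPow_natCast, stepOp_pow]
  · obtain ⟨l, rfl⟩ : ∃ l : ℕ, β = -(l : ℤ) := ⟨(-β).toNat, by omega⟩
    rw [zdPow_neg_natCast, stepOp_pow_neg]

variable [CharP K p]

theorem stepOp_up_down (i : Fin n) :
    stepOp K p w lam V i 1 * stepOp K p w lam V i (-1) =
      famOp (fun a _ => sS K w i + (a i : SymG K w)) 0 := by
  rw [stepOp, stepOp, famOp_mul, ← Pi.single_add, neg_add_cancel, Pi.single_zero]
  congr 1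
  funext a y
  rw [Pi.add_apply, Pi.single_eq_same, mCoeff_up_down]

theorem stepOp_down_up (i : Fin n) :
    stepOp K p w lam V i (-1) * stepOp K p w lam V i 1 =
      stepOp K p w lam V i 1 * stepOp K p w lam V i (-1) + 1 := by
  rw [stepOp_up_down, stepOp, stepOp, famOp_mul, ← Pi.single_add, add_neg_cancel, Pi.single_zero,
    ← famOp_one, famOp_add]
  congr 1
  funext a y
  rw [Pi.add_apply, Pi.single_eq_same, mCoeff_down_up]
  push_cast
  ring

variable (K p w lam V) in
/-- The action of the Weyl algebra. -/
def weylAct : Weyl K n →ₐ[K] Module.End K (Fam p w lam V) :=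
  RingQuot.liftAlgHom K
    ⟨FreeAlgebra.lift K (Sum.elim (fun i => stepOp K p w lam V i 1)
      (fun i => stepOp K p w lam V i (-1))), by
      intro x y hxy
      cases hxy with
      | zz i j =>
        simp only [map_mul, FreeAlgebra.lift_ι_apply, Sum.elim_inl]
        by_cases hij : i = j
        · rw [hij]
        · exact stepOp_commute hij _ _
      | dd i j =>
        simp only [map_mul, FreeAlgebra.lift_ι_apply, Sum.elim_inr]
        by_cases hij : i = j
        · rw [hij]
        · exact stepOp_commute hij _ _
      | dz i j =>
        simp only [map_mul, map_add, FreeAlgebra.lift_ι_apply, Sum.elim_inr, Sum.elim_inl]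
        by_cases hij : i = j
        · subst hij
          rw [if_pos rfl, map_one, stepOp_down_up]
        · rw [if_neg hij, map_zero, add_zero]
          exact stepOp_commute hij _ _⟩

theorem weylAct_z (i : Fin n) : weylAct K p w lam V (z K i) = stepOp K p w lam V i 1 := by
  simp [weylAct, z, RingQuot.liftAlgHom_mkAlgHom_apply]

theorem weylAct_d (i : Fin n) : weylAct K p w lam V (d K i) = stepOp K p w lam V i (-1) := by
  simp [weylAct, d, RingQuot.liftAlgHom_mkAlgHom_apply]

theorem weylAct_zdPow (i : Fin n) (β : ℤ) :
    weylAct K p w lam V (zdPow (z K i) (d K i) β) = stepOp K p w lam V i β := by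
  rw [← zdPow_stepOp, zdPow, zdPow, map_mul, map_pow, map_pow, weylAct_z, weylAct_d]

theorem weylAct_mW (b : Fin n → ℤ) : weylAct K p w lam V (mW K b) =
    famOp (fun a y => ∏ i, mCoeff K p w i (y.1 i) (a i) (b i)) b := by
  have key : ∀ l : List (Fin n), l.Nodup →
      (l.map fun i => stepOp K p w lam V i (b i)).prod =
        famOp (fun a y => (l.map fun i => mCoeff K p w i (y.1 i) (a i) (b i)).prod)
          (l.map fun i => (Pi.single i (b i) : Fin n → ℤ)).sum := by
    intro l hl
    induction l with
    | nil => simp [famOp_one]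
    | cons i l ih =>
      rw [List.map_cons, List.prod_cons, ih (List.nodup_cons.1 hl).2, stepOp, famOp_mul,
        List.map_cons, List.sum_cons, add_comm]
      congr 1
      funext a y
      -- Steps in the other coordinates do not change `a i`, so every coefficient may be read at the
      -- initial weight.
      have h0 : (l.map fun i => (Pi.single i (b i) : Fin n → ℤ)).sum i = 0 := by
        rw [Pi.list_sum_apply, List.map_map]
        refine List.sum_eq_zero fun t ht => ?_
        obtain ⟨j, hj, rfl⟩ := List.mem_map.1 ht
        exact Pi.single_eq_of_ne (by rintro rfl; exact (List.nodup_cons.1 hl).1 hj) _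
      rw [Pi.add_apply, h0, add_zero, List.map_cons, List.prod_cons]
  rw [mW_eq, map_list_prod, List.map_map]
  simp only [Function.comp_def, weylAct_zdPow]
  rw [key _ (List.nodup_finRange n), ← Fin.sum_univ_def]
  rw [Finset.univ_sum_single]
  simp only [Fin.prod_univ_def]

theorem weylAct_polW (f : MvPolynomial (Fin n) K) : weylAct K p w lam V (polW K f) =
    famOp (fun a _ => mkS K w (shift K a f)) 0 := by
  induction f using mvPolynomial_induction with
  | hC r =>
    rw [← MvPolynomial.algebraMap_eq, AlgHom.commutes, AlgHom.commutes]
    refine Finsupp.lhom_ext fun a f => ?_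
    rw [famOp_single, add_zero, Module.algebraMap_end_apply, Finsupp.smul_single]
    congr 1
    funext y
    rw [AlgHom.commutes, AlgHom.commutes]
    exact (algebraMap_smul (SymG K w) r (f y)).symm
  | hX i =>
    rw [polW_X, map_mul, weylAct_z, weylAct_d, stepOp_up_down]
    congr 1
    funext a _
    rw [shift_X, map_add, map_intCast]
    rfl
  | hadd f g hf hg => rw [map_add, map_add, hf, hg, famOp_add]; simp only [map_add]
  | hmul f g hf hg =>
    rw [map_mul, map_mul, hf, hg, famOp_mul, add_zero]
    simp only [map_mul, add_zero]

end WeylAction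

/-! ### The `A^λ`-module built from an `H^λ`-module -/

section Psi

variable {K : Type u} [Field K] {p n k : ℕ} {w : Fin n → Fin k → ℤ} {lam : Fin k → ℤ}
  {V : Type u} [AddCommGroup V] [Module (SymG K w) V]

variable (K w) in
/-- The structure constants of `H^λ`. -/
def etaS (x y u : Fin n → ℤ) : SymG K w := ∏ i, sS K w i ^ eta (x i) (y i) (u i)

theorem etaS_self_right (x y : Fin n → ℤ) : etaS K w x y y = 1 :=
  Finset.prod_eq_one fun i _ => by rw [eta_self_right, pow_zero]

/-- Both exponents are half the length of the path from `u` via `y` and `x'` to `x`, minus half the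
distance from `u` to `x`. This is the associativity of `H^λ`. -/
theorem etaS_cocycle (u y x' x : Fin n → ℤ) :
    etaS K w y x' x * etaS K w u y x = etaS K w u y x' * etaS K w u x' x := by
  simp only [etaS, ← Finset.prod_mul_distrib, ← pow_add]
  refine Finset.prod_congr rfl fun i _ => congrArg _ ?_
  simp only [eta, abs_eq_max_neg]
  omega

theorem mkS_smul_eq_zero {N : ℕ} (hN : ∀ i (v : V), sS K w i ^ N • v = 0)
    {g : MvPolynomial (Fin n) K} (hg : g ∈ powIdeal K n N) (v : V) : mkS K w g • v = 0 := by
  induction hg using Submodule.span_induction with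
  | mem g hg => obtain ⟨i, rfl⟩ := hg; rw [map_pow]; exact hN i v
  | zero => rw [map_zero, zero_smul]
  | add f g _ _ hf hg => rw [map_add, add_smul, hf, hg, add_zero]
  | smul f g _ hg => rw [smul_eq_mul, map_mul, mul_smul, hg, smul_zero]

theorem prod_mCoeff (a b : Fin n → ℤ) (y : Fin n → ℤ) : ∏ i, mCoeff K p w i (y i) (a i) (b i) =
    mkS K w (qInvMv K a b) * etaS K w y (floor p (a + b)) (floor p a) := by
  simp only [mCoeff]
  rw [Finset.prod_mul_distrib, qInvMv, map_prod]
  congr 1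
  refine Finset.prod_congr rfl fun i _ => ?_
  rw [algHom_aeval]
  rfl

variable [Module (HAlg K p w lam) V] [IsScalarTower (SymG K w) (HAlg K p w lam) V]

theorem c_smul_c_smul (x y u : Chambers p w lam) (v : V) :
    c K p w lam x y • c K p w lam y u • v = etaS K w x.1 y.1 u.1 • c K p w lam x u • v := by
  rw [← mul_smul, c_mul_c, mul_smul, algebraMap_smul]
  rfl

theorem c_smul_symG_smul (x y : Chambers p w lam) (s : SymG K w) (v : V) :
    c K p w lam x y • s • v = s • c K p w lam x y • v := by
  rw [← algebraMap_smul (HAlg K p w lam) s v, ← mul_smul, ← Algebra.commutes, mul_smul,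
    algebraMap_smul]

variable (K p w lam V) in
/-- The weight space of weight `a`. -/
def localSub (a : Fin n → ℤ) : Submodule (SymG K w) (Chambers p w lam → V) where
  -- The model is the family `y ↦ c_{y,x} v` with `x` the chamber of `a`. The condition is the
  -- relation these vectors satisfy, written so that it makes sense for every weight `a`.
  carrier := {f | (∑ i, a i • w i ≠ lam → f = 0) ∧
    ∀ u y, c K p w lam u y • f y = etaS K w u.1 y.1 (floor p a) • f u}
  add_mem' := by
    rintro f g ⟨hf, hf'⟩ ⟨hg, hg'⟩
    refine ⟨fun h => by rw [hf h, hg h, add_zero], fun u y => ?_⟩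
    rw [Pi.add_apply, Pi.add_apply, smul_add, smul_add, hf', hg']
  zero_mem' := ⟨fun _ => rfl, fun u y => by simp⟩
  smul_mem' := by
    rintro s f ⟨hf, hf'⟩
    refine ⟨fun h => by rw [hf h, smul_zero], fun u y => ?_⟩
    rw [Pi.smul_apply, Pi.smul_apply, c_smul_symG_smul, hf', smul_smul, smul_smul, mul_comm]

/-- The factors come from a cocycle, so they carry the compatibility condition at `a` to the one at
`a + e`. -/
theorem etaS_smul_mem_localSub {a e : Fin n → ℤ} (he : ∑ i, e i • w i = 0)
    {f : Chambers p w lam → V} (hf : f ∈ localSub K p w lam V a) :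
    (fun y => etaS K w y.1 (floor p (a + e)) (floor p a) • f y) ∈
      localSub K p w lam V (a + e) := by
  refine ⟨fun h => ?_, fun u y => ?_⟩
  · have ha : ∑ i, a i • w i ≠ lam := by
      intro ha
      apply h
      simp only [Pi.add_apply, add_smul, Finset.sum_add_distrib]
      rw [he, ha, add_zero]
    rw [hf.1 ha]
    funext y
    exact smul_zero _
  · rw [c_smul_symG_smul, hf.2, smul_smul, smul_smul, etaS_cocycle]

variable [Module K V] [IsScalarTower K (SymG K w) V]

variable (K p w lam V) in
/-- The families whose member of index `a` lies in `localSub a`. -/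
def psiSub : Submodule K (Fam p w lam V) where
  carrier := {f | ∀ a, f a ∈ localSub K p w lam V a}
  add_mem' hf hg a := add_mem (hf a) (hg a)
  zero_mem' _ := zero_mem _
  smul_mem' r f hf a := by
    rw [Finsupp.smul_apply, ← algebraMap_smul (SymG K w)]
    exact Submodule.smul_mem _ _ (hf a)

theorem single_mem_psiSub {a : Fin n → ℤ} {f : Chambers p w lam → V}
    (hf : f ∈ localSub K p w lam V a) : Finsupp.single a f ∈ psiSub K p w lam V := by
  intro a'
  by_cases h : a = a'
  · subst h
    rwa [Finsupp.single_eq_same]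
  · rw [Finsupp.single_eq_of_ne (Ne.symm h)]
    exact zero_mem _

theorem famOp_mem_psiSub {κ : (Fin n → ℤ) → Chambers p w lam → SymG K w} {e : Fin n → ℤ}
    (hκ : ∀ a, ∀ f ∈ localSub K p w lam V a,
      (fun y => κ a y • f y) ∈ localSub K p w lam V (a + e))
    {f : Fam p w lam V} (hf : f ∈ psiSub K p w lam V) :
    (famOp κ e : Module.End K (Fam p w lam V)) f ∈ psiSub K p w lam V := by
  rw [← Finsupp.sum_single f, Finsupp.sum, map_sum]
  refine Submodule.sum_mem _ fun a _ => ?_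
  rw [famOp_single]
  exact single_mem_psiSub (hκ a _ (hf a))

variable (K p w lam V) in
/-- The space of the `A^λ`-module built from the `H^λ`-module `V`. -/
def Psi : Type u := psiSub K p w lam V

instance : AddCommGroup (Psi K p w lam V) := inferInstanceAs (AddCommGroup (psiSub K p w lam V))

instance : Module K (Psi K p w lam V) := inferInstanceAs (Module K (psiSub K p w lam V))

/-- The inclusion of a weight space. -/
def psiSingle (a : Fin n → ℤ) : localSub K p w lam V a →ₗ[K] Psi K p w lam V where
  toFun f := ⟨Finsupp.single a f.1, single_mem_psiSub f.2⟩
  map_add' f g := Subtype.ext (Finsupp.single_add a f.1 g.1)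
  map_smul' r f := Subtype.ext (Finsupp.smul_single r a f.1).symm

/-- The projection to a weight space. -/
def psiEval (a : Fin n → ℤ) : Psi K p w lam V →ₗ[K] localSub K p w lam V a where
  toFun f := ⟨f.1 a, f.2 a⟩
  map_add' _ _ := rfl
  map_smul' _ _ := rfl

theorem psiEval_psiSingle (a : Fin n → ℤ) (f : localSub K p w lam V a) :
    psiEval a (psiSingle a f) = f := Subtype.ext Finsupp.single_eq_same

theorem psiEval_psiSingle_ne {a a' : Fin n → ℤ} (h : a' ≠ a) (f : localSub K p w lam V a) :
    psiEval a' (psiSingle a f) = 0 := Subtype.ext (Finsupp.single_eq_of_ne h)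

theorem Psi_induction {P : Psi K p w lam V → Prop} (h0 : P 0) (hs : ∀ a f, P (psiSingle a f))
    (hadd : ∀ f g, P f → P g → P (f + g)) (f : Psi K p w lam V) : P f := by
  have e : f = ∑ a ∈ f.1.support, psiSingle a (psiEval a f) := by
    refine Subtype.ext ((Finsupp.sum_single f.1).symm.trans ?_)
    exact (map_sum (psiSub K p w lam V).subtype (fun a => psiSingle a (psiEval a f)) _).symm
  rw [e]
  exact Finset.sum_induction _ P hadd h0 fun a _ => hs a _

variable [Fact p.Prime] [CharP K p]

/-- A monomial acts by an element of `S`, common to all chambers, times the cocycle factor.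
Invariance matters only because the spaces at weights not restricting to `λ` are zero. -/
theorem weylAct_mem_psiSub (x : HEA K w) {f : Fam p w lam V} (hf : f ∈ psiSub K p w lam V) :
    weylAct K p w lam V x.1 f ∈ psiSub K p w lam V := by
  induction x using HEA_induction with
  | hm b hb g =>
    rw [Subalgebra.coe_mul, map_mul, Module.End.mul_apply, coe_polH, weylAct_polW]
    change weylAct K p w lam V (mW K b) _ ∈ _
    rw [weylAct_mW]
    refine famOp_mem_psiSub (fun a f hf => ?_) (famOp_mem_psiSub (fun a f hf => ?_) hf)
    · simp only [prod_mCoeff, mul_smul]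
      exact Submodule.smul_mem _ _ (etaS_smul_mem_localSub hb hf)
    · rw [add_zero]
      exact Submodule.smul_mem _ _ hf
  | hadd x y hx hy =>
    rw [Subalgebra.coe_add, map_add]
    exact add_mem hx hy

variable (K p w lam V) in
/-- The action of the hypertoric enveloping algebra. -/
def heaAct : HEA K w →ₐ[K] Module.End K (Psi K p w lam V) :=
  AlgHom.ofLinearMap
    { toFun x := LinearMap.restrict (weylAct K p w lam V x.1)
        (fun _ hf => weylAct_mem_psiSub x hf)
      map_add' x y := by
        refine LinearMap.ext fun f => Subtype.ext ?_
        change weylAct K p w lam V (x.1 + y.1) f.1 = _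
        rw [map_add]
        rfl
      map_smul' r x := by
        refine LinearMap.ext fun f => Subtype.ext ?_
        change weylAct K p w lam V (r • x.1) f.1 = _
        rw [map_smul]
        rfl }
    (by
      refine LinearMap.ext fun f => Subtype.ext ?_
      change weylAct K p w lam V 1 f.1 = _
      rw [map_one]
      rfl)
    (fun x y => by
      refine LinearMap.ext fun f => Subtype.ext ?_
      change weylAct K p w lam V (x.1 * y.1) f.1 = _
      rw [map_mul]
      rfl)

theorem heaAct_polH (g : MvPolynomial (Fin n) K) (a : Fin n → ℤ) (f : localSub K p w lam V a) :
    heaAct K p w lam V (polH K w g) (psiSingle a f) = psiSingle a (mkS K w (shift K a g) • f) := by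
  refine Subtype.ext ?_
  change weylAct K p w lam V (polH K w g).1 (Finsupp.single a f.1) = _
  rw [coe_polH, weylAct_polW, famOp_single, add_zero]
  rfl

theorem heaAct_mH (b : Fin n → ℤ) (hb : ∑ i, b i • w i = 0) (a : Fin n → ℤ)
    (f : localSub K p w lam V a) :
    heaAct K p w lam V (mH K w b hb) (psiSingle a f) = psiSingle (a + b)
      (mkS K w (qInvMv K a b) • ⟨_, etaS_smul_mem_localSub hb f.2⟩) := by
  refine Subtype.ext ?_
  change weylAct K p w lam V (mW K b) (Finsupp.single a f.1) = _
  rw [weylAct_mW, famOp_single]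
  simp only [prod_mCoeff, mul_smul]
  rfl

theorem heaAct_moment (χ : Fin k → ℤ) :
    heaAct K p w lam V (∑ i, (∑ j, w i j * χ j) • hPlus K w i) =
      heaAct K p w lam V ((∑ j, lam j * χ j) • (1 : HEA K w)) := by
  have hz : ∀ (r : ℤ) (x : MvPolynomial (Fin n) K), polH K w (r • x) = r • polH K w x :=
    fun r x => map_zsmul (polH K w).toLinearMap.toAddMonoidHom r x
  have h1 : ∑ i, (∑ j, w i j * χ j) • hPlus K w i =
      polH K w (∑ i, MvPolynomial.C (((∑ j, w i j * χ j : ℤ)) : K) * MvPolynomial.X i) := by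
    rw [map_sum]
    refine Finset.sum_congr rfl fun i _ => ?_
    rw [map_intCast, ← zsmul_eq_mul, hz, polH, aevalComm_X]
  have h2 : (∑ j, lam j * χ j) • (1 : HEA K w) =
      polH K w (MvPolynomial.C (((∑ j, lam j * χ j : ℤ)) : K)) := by
    rw [map_intCast, ← zsmul_one, hz, map_one]
  rw [h1, h2]
  refine LinearMap.ext fun f => ?_
  induction f using Psi_induction with
  | h0 => rw [map_zero, map_zero]
  | hs a f =>
    rw [heaAct_polH, heaAct_polH]
    congr 1
    by_cases ha : ∑ i, a i • w i = lam
    · congr 1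
      have h3 : mkS K w (∑ i, MvPolynomial.C (((∑ j, w i j * χ j : ℤ)) : K) * MvPolynomial.X i) =
          0 := Ideal.Quotient.eq_zero_iff_mem.2 (Ideal.subset_span ⟨χ, rfl⟩)
      -- On weight `a` the variables become `s_i + a_i`; the linear part dies in `S`, and the
      -- constant is `λ(χ)` because `a` restricts to `λ`.
      have h4 : shift K a (∑ i, MvPolynomial.C (((∑ j, w i j * χ j : ℤ)) : K) *
          MvPolynomial.X i) = ∑ i, MvPolynomial.C (((∑ j, w i j * χ j : ℤ)) : K) *
            MvPolynomial.X i + (((∑ j, lam j * χ j : ℤ)) : MvPolynomial (Fin n) K) := by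
        rw [map_sum, ← sum_weight_mul ha, Int.cast_sum, ← Finset.sum_add_distrib]
        refine Finset.sum_congr rfl fun i _ => ?_
        rw [map_mul, map_intCast, map_intCast, shift_X, mul_add, Int.cast_mul]
      rw [h4, map_add, h3, zero_add, map_intCast, map_intCast, map_intCast]
      exact (map_intCast _ _).symm
    · have : f = 0 := Subtype.ext (f.2.1 ha)
      rw [this, smul_zero, smul_zero]
  | hadd f g hf hg => rw [map_add, map_add, hf, hg]

variable (K p w lam V) in
/-- The action of `A^λ`. -/
def quotAct : HEAQuot K w lam →ₐ[K] Module.End K (Psi K p w lam V) :=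
  RingQuot.liftAlgHom K ⟨heaAct K p w lam V, by
    intro x y hxy
    cases hxy with
    | moment χ => exact heaAct_moment χ⟩

theorem quotAct_toQuot (x : HEA K w) :
    quotAct K p w lam V (toQuot K w lam x) = heaAct K p w lam V x :=
  RingQuot.liftAlgHom_mkAlgHom_apply _ _ _ _

instance : Module (HEAQuot K w lam) (Psi K p w lam V) :=
  Module.compHom _ (quotAct K p w lam V).toRingHom

instance : IsScalarTower K (HEAQuot K w lam) (Psi K p w lam V) where
  smul_assoc r x f := by
    change quotAct K p w lam V (r • x) f = _
    rw [map_smul]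
    rfl

theorem toQuot_smul_Psi (x : HEA K w) (f : Psi K p w lam V) :
    toQuot K w lam x • f = heaAct K p w lam V x f :=
  LinearMap.congr_fun (quotAct_toQuot x) f

theorem sA_smul_psiSingle (a : Fin n → ℤ) (g : MvPolynomial (Fin n) K)
    (f : localSub K p w lam V a) :
    sA K w lam a g • psiSingle a f = psiSingle a (mkS K w g • f) := by
  obtain ⟨g, rfl⟩ : ∃ g', shift K a g' = g := by
    refine ⟨shift K (-a) g, ?_⟩
    have : (shift K a).comp (shift K (-a)) = AlgHom.id K (MvPolynomial (Fin n) K) := by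
      refine MvPolynomial.algHom_ext fun i => ?_
      rw [AlgHom.comp_apply, shift_X, map_add, map_intCast, shift_X]
      simp
    exact DFunLike.congr_fun this g
  rw [← toQuot_polH', toQuot_smul_Psi, heaAct_polH]

theorem m_smul_psiSingle (b : Fin n → ℤ) (hb : ∑ i, b i • w i = 0) (a : Fin n → ℤ)
    (f : localSub K p w lam V a) : m K w lam b hb • psiSingle a f = psiSingle (a + b)
      (mkS K w (qInvMv K a b) • ⟨_, etaS_smul_mem_localSub hb f.2⟩) := by
  rw [m_eq, toQuot_smul_Psi, heaAct_mH]

/-- The normalising factor of `cTrunc` cancels the factor `qInvMv` in the action of the monomial,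
leaving only the cocycle. -/
theorem cTrunc_smul_psiSingle {N : ℕ} (hN : ∀ i (v : V), sS K w i ^ N • v = 0)
    (b : Fin n → ℤ) (hb : ∑ i, b i • w i = 0) (a : Fin n → ℤ)
    (f : localSub K p w lam V a) : cTrunc K w lam a b hb N • psiSingle a f =
      psiSingle (a + b) ⟨_, etaS_smul_mem_localSub hb f.2⟩ := by
  rw [cTrunc, mul_smul, sA_smul_psiSingle, m_smul_psiSingle]
  congr 1
  refine Subtype.ext (funext fun y => ?_)
  change mkS K w _ • _ • mkS K w _ • f.1 y = etaS K w _ _ _ • f.1 y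
  rw [smul_smul, smul_smul, mul_right_comm, ← map_mul, mul_comm, mul_smul, ← sub_eq_zero,
    ← smul_sub]
  have := mkS_smul_eq_zero hN (qInvMv_mul_qMv K a b N) (f.1 y)
  rw [map_sub, sub_smul, map_one, one_smul] at this
  rw [this, smul_zero]

end Psi

/-! ### The equivalence of categories -/

section PsiObject

variable {K : Type u} [Field K] {p n k : ℕ} {w : Fin n → Fin k → ℤ} {lam : Fin k → ℤ}
  {V : Type u} [AddCommGroup V] [Module (SymG K w) V]
  [Module (HAlg K p w lam) V] [IsScalarTower (SymG K w) (HAlg K p w lam) V]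

variable (K) in
/-- The vector of weight `a` defined by a vector of `V`. -/
def psiVec (a : LamPt w lam) (x : Chambers p w lam) (hx : floor p a.1 = x.1) :
    V →ₗ[SymG K w] localSub K p w lam V a.1 where
  toFun v := ⟨fun y => c K p w lam y x • v, fun h => (h a.2).elim, fun u y => by
    rw [c_smul_c_smul, hx]⟩
  map_add' v v' := Subtype.ext (funext fun y => smul_add _ _ _)
  map_smul' s v := Subtype.ext (funext fun y => c_smul_symG_smul _ _ _ _)

/-- A compatible family is determined by its member at the chamber of `a`, since the structure
constant with two equal last entries is `1`. -/
theorem psiVec_apply_self (a : LamPt w lam) (x : Chambers p w lam) (hx : floor p a.1 = x.1)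
    (f : localSub K p w lam V a.1) : psiVec K a x hx (f.1 x) = f := by
  refine Subtype.ext (funext fun y => (f.2.2 y x).trans ?_)
  rw [hx, etaS_self_right, one_smul]

theorem psiVec_c_smul_ne (a : LamPt w lam) (x : Chambers p w lam) (hx : floor p a.1 = x.1)
    {x' : Chambers p w lam} (h : x ≠ x') (y : Chambers p w lam) (v : V) :
    (psiVec K a x hx (c K p w lam x' y • v) : localSub K p w lam V a.1) = 0 := by
  refine Subtype.ext (funext fun u => ?_)
  change c K p w lam u x • c K p w lam x' y • v = 0
  rw [← mul_smul, c_mul_c_ne h, zero_smul]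

variable (K w V) in
/-- A common exponent of nilpotency. -/
def UnifNil (N : ℕ) : Prop := ∀ (i : Fin n) (v : V), sS K w i ^ N • v = 0

variable [Module K V] [IsScalarTower K (SymG K w) V]

variable (K p w lam V) in
/-- The weight spaces. -/
def psiWeight (a : Fin n → ℤ) : Submodule K (Psi K p w lam V) := LinearMap.range (psiSingle a)

theorem psiEval_of_mem_ne {a a' : Fin n → ℤ} (h : a' ≠ a) {f : Psi K p w lam V}
    (hf : f ∈ psiWeight K p w lam V a) : psiEval a' f = 0 := by
  obtain ⟨f, rfl⟩ := hf
  exact psiEval_psiSingle_ne h f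

theorem psiSingle_psiEval {a : Fin n → ℤ} {f : Psi K p w lam V}
    (hf : f ∈ psiWeight K p w lam V a) : psiSingle a (psiEval a f) = f := by
  obtain ⟨f, rfl⟩ := hf
  rw [psiEval_psiSingle]

theorem psiWeight_isInternal : DirectSum.IsInternal (psiWeight K p w lam V) := by
  constructor
  · have key : ∀ (x : DirectSum _ fun a => psiWeight K p w lam V a) (a : Fin n → ℤ),
        psiEval a (DirectSum.coeAddMonoidHom (psiWeight K p w lam V) x) = psiEval a (x a).1 := by
      intro x a
      induction x using DirectSum.induction_on with
      | zero => simp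
      | of a' f =>
        rw [DirectSum.coeAddMonoidHom_of]
        by_cases h : a' = a
        · subst h
          rw [DirectSum.of_eq_same]
        · rw [DirectSum.of_eq_of_ne _ _ _ (Ne.symm h), psiEval_of_mem_ne (Ne.symm h) f.2]
          exact (map_zero _).symm
      | add x y hx hy =>
        rw [map_add, map_add, hx, hy, DirectSum.add_apply, Submodule.coe_add, map_add]
    refine (injective_iff_map_eq_zero _).2 fun x hx => ?_
    refine DFinsupp.ext fun a => Subtype.ext ?_
    have := key x a
    rw [hx, map_zero] at this
    rw [← psiSingle_psiEval (x a).2, ← this, map_zero]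
    rfl
  · intro f
    induction f using Psi_induction with
    | h0 => exact ⟨0, map_zero _⟩
    | hs a f =>
      exact ⟨DirectSum.of (fun a => psiWeight K p w lam V a) a ⟨psiSingle a f, f, rfl⟩,
        DirectSum.coeAddMonoidHom_of _ _ _⟩
    | hadd f g hf hg =>
      obtain ⟨x, rfl⟩ := hf
      obtain ⟨y, rfl⟩ := hg
      exact ⟨x + y, map_add _ _ _⟩

variable [Fact p.Prime] [CharP K p]

theorem UnifNil.kills {N : ℕ} (hN : UnifNil K w V N) {a : Fin n → ℤ} {f : Psi K p w lam V}
    (hf : f ∈ psiWeight K p w lam V a) : Kills K w lam a N f := by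
  obtain ⟨f, rfl⟩ := hf
  intro i
  have := sA_smul_psiSingle a (MvPolynomial.X i ^ N) f
  rw [map_pow, sA_X] at this
  rw [this, ← map_zero (psiSingle a)]
  congr 1
  refine Subtype.ext (funext fun y => ?_)
  rw [map_pow]
  exact hN i _

theorem cTrunc_smul_psiVec {N : ℕ} (hN : UnifNil K w V N) (a a' : LamPt w lam)
    (x y : Chambers p w lam) (hx : floor p a.1 = x.1) (hy : floor p a'.1 = y.1) (v : V) :
    cTrunc K w lam a.1 (a'.1 - a.1) (a.sub_trivial a') N • psiSingle a.1 (psiVec K a x hx v) =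
      psiSingle a'.1 (psiVec K a' y hy (c K p w lam y x • v)) := by
  rw [cTrunc_smul_psiSingle hN]
  refine Subtype.ext ?_
  change Finsupp.single _ _ = Finsupp.single _ _
  congr 1
  · abel
  · funext u
    change etaS K w u.1 _ _ • c K p w lam u x • v = c K p w lam u y • c K p w lam y x • v
    rw [c_smul_c_smul, add_sub_cancel, hx, hy]

/-- Generators lying in single summands `1_z V` are placed at the base points. The action of
`c_{x,y}` is then realised by elements of `A^λ` moving from the base point of `y` to any weight in
the chamber `x`. -/
theorem psi_finite {N : ℕ} (hN : UnifNil K w V N) {G : Set V} (hG : G.Finite)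
    (hG' : ∀ v ∈ G, ∃ z, c K p w lam z z • v = v)
    (hspan : Submodule.span (HAlg K p w lam) G = ⊤) (b : Chambers p w lam → LamPt w lam)
    (hb : ∀ x, floor p (b x).1 = x.1) : Module.Finite (HEAQuot K w lam) (Psi K p w lam V) := by
  choose z hz using hG'
  have _ : Finite G := hG
  let T : Set (Psi K p w lam V) := Set.range fun v : G =>
    psiSingle _ (psiVec K (b (z v.1 v.2)) (z v.1 v.2) (hb _) v.1)
  -- All weights are treated at once: multiplication by `c_{x,y}` uses the induction hypothesis at
  -- the base point of `y`.
  have key : ∀ (v : V) (a : LamPt w lam),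
      ∀ (u : Chambers p w lam) (hu : floor p a.1 = u.1),
        psiSingle a.1 (psiVec K a u hu v) ∈ Submodule.span (HEAQuot K w lam) T := by
    have hc : ∀ (v : V) (y : Chambers p w lam),
        psiSingle _ (psiVec K (b y) y (hb y) v) ∈ Submodule.span (HEAQuot K w lam) T →
        ∀ (x : Chambers p w lam) (a : LamPt w lam) (u : Chambers p w lam)
          (hu : floor p a.1 = u.1), psiSingle a.1 (psiVec K a u hu (c K p w lam x y • v)) ∈
            Submodule.span (HEAQuot K w lam) T := by
      intro v y hv x a u hu
      by_cases h : u = x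
      · rw [← h, ← cTrunc_smul_psiVec hN (b y) a y _ (hb y)]
        exact Submodule.smul_mem _ _ hv
      · rw [psiVec_c_smul_ne _ _ _ h, map_zero]
        exact zero_mem _
    intro v
    have hv : v ∈ Submodule.span (HAlg K p w lam) G := by rw [hspan]; trivial
    induction hv using Submodule.span_induction with
    | mem v hv =>
      rw [← hz v hv]
      exact hc v _ (Submodule.subset_span ⟨⟨v, hv⟩, rfl⟩) _
    | zero => intro a u hu; rw [map_zero, map_zero]; exact zero_mem _
    | add v v' _ _ hv hv' => intro a u hu; rw [map_add, map_add]; exact add_mem (hv a u hu) (hv' a u hu)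
    | smul t v _ hv =>
      induction t using HAlg_induction generalizing v with
      | halg s =>
        intro a u hu
        obtain ⟨f, rfl⟩ := mkS_surjective s
        rw [algebraMap_smul, map_smul, ← sA_smul_psiSingle]
        exact Submodule.smul_mem _ _ (hv a u hu)
      | hc x y =>
        exact hc v y (hv (b y) y (hb y)) x
      | hmul t t' ht ht' =>
        rw [mul_smul]
        exact ht _ (by rw [hspan]; trivial) (ht' v (by rw [hspan]; trivial) hv)
      | hadd t t' ht ht' =>
        intro a u hu
        rw [add_smul, map_add, map_add]
        exact add_mem (ht v (by rw [hspan]; trivial) hv a u hu)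
          (ht' v (by rw [hspan]; trivial) hv a u hu)
  refine Module.finite_def.2 ⟨(Set.finite_range _ : T.Finite).toFinset, ?_⟩
  rw [Set.Finite.coe_toFinset, eq_top_iff]
  rintro f -
  induction f using Psi_induction with
  | h0 => exact zero_mem _
  | hs a f =>
    by_cases ha : ∑ i, a i • w i = lam
    · have := key (f.1 (LamPt.chamberOf p ⟨a, ha⟩)) ⟨a, ha⟩
        (LamPt.chamberOf p ⟨a, ha⟩) rfl
      have e := psiVec_apply_self (K := K) ⟨a, ha⟩ (LamPt.chamberOf p ⟨a, ha⟩) rfl f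
      exact e ▸ this
    · rw [show f = 0 from Subtype.ext (f.2.1 ha), map_zero]
      exact zero_mem _
  | hadd f g hf hg => exact add_mem hf hg

/-- The object of `WtMod` defined by an `H^λ`-module. -/
def psiObj (N : ℕ) (hN : UnifNil K w V N)
    (hfin : Module.Finite (HEAQuot K w lam) (Psi K p w lam V)) : WtMod K w lam where
  carrier := Psi K p w lam V
  finite := hfin
  weight := psiWeight K p w lam V
  internal := psiWeight_isInternal
  smul_mem := by
    rintro a b x hx _ ⟨f, rfl⟩
    rcases mem_quotWeight K w lam a hx with rfl | ⟨hb, g, rfl⟩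
    · rw [zero_smul]
      exact zero_mem _
    · rw [mul_smul, sA_smul_psiSingle, m_smul_psiSingle]
      exact ⟨_, rfl⟩
  weight_eq_bot a ha := by
    rw [psiWeight, LinearMap.range_eq_bot]
    refine LinearMap.ext fun f => ?_
    rw [show f = 0 from Subtype.ext (f.2.1 ha), map_zero, map_zero]
  nilpotent i a v hv := ⟨N, hN.kills hv i⟩

end PsiObject

/-! ### Comparison of the reconstructed module with the given one -/

section EssSurj

variable {K : Type u} [Field K] {p n k : ℕ} [Fact p.Prime] [CharP K p] {w : Fin n → Fin k → ℤ}
  {lam : Fin k → ℤ}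
  {V : Type u} [AddCommGroup V] [Module (SymG K w) V]
  [Module (HAlg K p w lam) V] [IsScalarTower (SymG K w) (HAlg K p w lam) V]
  [Module K V] [IsScalarTower K (SymG K w) V]
  {N : ℕ} (hN : UnifNil K w V N)
  (hfin : Module.Finite (HEAQuot K w lam) (Psi K p w lam V))

/-- The value at the chamber `x` of a vector of weight `a` of `psiObj`. -/
def psiValue (a : Fin n → ℤ) (x : Chambers p w lam) :
    (psiObj N hN hfin).weight a →ₗ[SymG K w] V where
  toFun f := (f.1.1 : Fam p w lam V) a x
  map_add' _ _ := rfl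
  map_smul' s f := by
    obtain ⟨g, rfl⟩ := mkS_surjective s
    obtain ⟨_, f, rfl⟩ := f
    change ((mkS K w g • (⟨psiSingle a f, f, rfl⟩ : (psiObj N hN hfin).weight a)).1.1 :
      Fam p w lam V) a x = _
    rw [coe_mkS_smul]
    change ((sA K w lam a g • psiSingle a f).1 : Fam p w lam V) a x = _
    rw [sA_smul_psiSingle]
    change (Finsupp.single a _ : Fam p w lam V) a x =
      mkS K w g • (Finsupp.single a _ : Fam p w lam V) a x
    rw [Finsupp.single_eq_same, Finsupp.single_eq_same]
    rfl

/-- The vector of weight `a` of `psiObj` with given value. -/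
def psiOfValue (a : LamPt w lam) (x : Chambers p w lam) (hx : floor p a.1 = x.1) (v : V) :
    (psiObj N hN hfin).weight a.1 := ⟨psiSingle a.1 (psiVec K a x hx v), _, rfl⟩

theorem psiValue_psiOfValue (a : LamPt w lam) (x : Chambers p w lam) (hx : floor p a.1 = x.1)
    (y : Chambers p w lam) (v : V) :
    psiValue hN hfin a.1 y (psiOfValue hN hfin a x hx v) = c K p w lam y x • v := by
  change (Finsupp.single a.1 _ : Fam p w lam V) a.1 y = _
  rw [Finsupp.single_eq_same]
  rfl

theorem psiOfValue_psiValue (a : LamPt w lam) (x : Chambers p w lam) (hx : floor p a.1 = x.1)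
    (f : (psiObj N hN hfin).weight a.1) :
    psiOfValue hN hfin a x hx (psiValue hN hfin a.1 x f) = f := by
  obtain ⟨_, f, rfl⟩ := f
  refine Subtype.ext ?_
  change psiSingle a.1 (psiVec K a x hx ((Finsupp.single a.1 f.1 : Fam p w lam V) a.1 x)) = psiSingle a.1 f
  rw [Finsupp.single_eq_same, psiVec_apply_self]

theorem Cmap_psiOfValue (a a' : LamPt w lam) (x y : Chambers p w lam) (hx : floor p a.1 = x.1)
    (hy : floor p a'.1 = y.1) (v : V) : Cmap (psiObj N hN hfin) a a' (psiOfValue hN hfin a x hx v) =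
      psiOfValue hN hfin a' y hy (c K p w lam y x • v) := by
  refine Subtype.ext ?_
  rw [coe_Cmap (psiObj N hN hfin) a a' _ (N := N) (hN.kills (Subtype.prop _))]
  exact cTrunc_smul_psiVec hN a a' x y hx hy v

variable (b : Chambers p w lam → LamPt w lam) (hb : ∀ x, floor p (b x).1 = x.1)

/-- The comparison map. -/
def psiSum : HomSum b (psiObj N hN hfin) →+ V :=
  DFinsupp.sumAddHom fun x => (psiValue hN hfin (b x).1 x).toAddMonoidHom

theorem psiSum_inc (x : Chambers p w lam) (f : (psiObj N hN hfin).weight (b x).1) :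
    psiSum hN hfin b (inc b _ x f) = psiValue hN hfin (b x).1 x f :=
  DFinsupp.sumAddHom_single _ _ _

theorem psiSum_c_smul (x y : Chambers p w lam) (f : homObj b hb (psiObj N hN hfin)) :
    psiSum hN hfin b (toSum b hb (c K p w lam x y • f)) =
      c K p w lam x y • psiSum hN hfin b (toSum b hb f) := by
  rw [toSum_c_smul]
  generalize toSum b hb f = f
  induction f using HomSum_induction with
  | h0 => simp only [map_zero, smul_zero]
  | hinc u f =>
    rw [psiSum_inc, psiSum_inc]
    by_cases h : y = u
    · subst h
      rw [prj_inc, ← psiOfValue_psiValue hN hfin (b y) y (hb y) f,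
        Cmap_psiOfValue hN hfin (b y) (b x) y x (hb y) (hb x), psiValue_psiOfValue,
        psiValue_psiOfValue, ← mul_smul, ← mul_smul, c_mul_c_left, c_mul_c_right]
    · rw [prj_inc_ne _ _ h, map_zero, map_zero,
        ← psiOfValue_psiValue hN hfin (b u) u (hb u) f, psiValue_psiOfValue, ← mul_smul,
        c_mul_c_ne h, zero_smul]
  | hadd f g hf hg => simp only [map_add, smul_add, hf, hg]

theorem psiSum_algebraMap_smul (s : SymG K w) (f : homObj b hb (psiObj N hN hfin)) :
    psiSum hN hfin b (toSum b hb (algebraMap _ (HAlg K p w lam) s • f)) =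
      algebraMap _ (HAlg K p w lam) s • psiSum hN hfin b (toSum b hb f) := by
  rw [toSum_algebraMap_smul, algebraMap_smul]
  generalize toSum b hb f = f
  induction f using HomSum_induction with
  | h0 => simp only [map_zero, smul_zero]
  | hinc u f => rw [← map_smul, psiSum_inc, psiSum_inc, map_smul]
  | hadd f g hf hg => simp only [map_add, smul_add, hf, hg]

/-- The comparison map as a map of `H^λ`-modules. -/
def psiCompare : homObj b hb (psiObj N hN hfin) →ₗ[HAlg K p w lam] V where
  toFun f := psiSum hN hfin b (toSum b hb f)
  map_add' f g := map_add (psiSum hN hfin b) f g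
  map_smul' := HAlg_map_smul ((psiSum hN hfin b).comp (toSum b hb).toAddMonoidHom)
    (psiSum_algebraMap_smul hN hfin b hb) (psiSum_c_smul hN hfin b hb)

/-- Applying the idempotent `1_x` isolates the component at `x`, which is determined by its value at
`x`. -/
theorem psiCompare_injective : Function.Injective (psiCompare hN hfin b hb) := by
  refine (injective_iff_map_eq_zero _).2 fun f hf => ?_
  refine (toSum b hb).injective ?_
  rw [map_zero]
  refine HomSum_ext b _ fun x => ?_
  have h1 : psiSum hN hfin b (toSum b hb (c K p w lam x x • f)) = 0 := by
    rw [psiSum_c_smul]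
    exact (congrArg _ hf).trans (smul_zero _)
  rw [toSum_c_smul, Cmap_self, psiSum_inc] at h1
  rw [← psiOfValue_psiValue hN hfin (b x) x (hb x) (prj b _ x (toSum b hb f)), h1, map_zero]
  refine Subtype.ext ?_
  change psiSingle _ (psiVec K (b x) x (hb x) 0) = 0
  rw [map_zero, map_zero]

theorem psiCompare_surjective
    (hV : AddSubgroup.closure {v : V | ∃ (x : Chambers p w lam) (u : V), v = c K p w lam x x • u} =
      ⊤) : Function.Surjective (psiCompare hN hfin b hb) := by
  intro v
  have hv : v ∈ AddSubgroup.closure {v : V | ∃ (x : Chambers p w lam) (u : V),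
    v = c K p w lam x x • u} := by rw [hV]; trivial
  induction hv using AddSubgroup.closure_induction with
  | mem v hv =>
    obtain ⟨x, v, rfl⟩ := hv
    refine ⟨(toSum b hb).symm (inc b _ x (psiOfValue hN hfin (b x) x (hb x) v)), ?_⟩
    exact (psiSum_inc hN hfin b x _).trans (psiValue_psiOfValue hN hfin (b x) x (hb x) x v)
  | zero => exact ⟨0, map_zero _⟩
  | add v v' _ _ hv hv' =>
    obtain ⟨f, rfl⟩ := hv
    obtain ⟨g, rfl⟩ := hv'
    exact ⟨f + g, map_add _ _ _⟩
  | neg v _ hv =>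
    obtain ⟨f, rfl⟩ := hv
    exact ⟨-f, map_neg _ _⟩

end EssSurj

/-! ### Essential surjectivity and the equivalences -/

section Equivalence

variable {K : Type u} [Field K] {p : ℕ} {n k : ℕ}
  {w : Fin n → Fin k → ℤ} {lam : Fin k → ℤ}

/-- By local unitality every vector is a finite sum of vectors in the various `1_x V`, up to sign,
so generators can be replaced by such vectors. -/
theorem exists_unital_generators {V : ModuleCat.{u} (HAlg K p w lam)}
    (hV : LocallyUnital K p w lam V) (hfin : Module.Finite (HAlg K p w lam) V) :
    ∃ G : Set V, G.Finite ∧ (∀ v ∈ G, ∃ z, c K p w lam z z • v = v) ∧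
      Submodule.span (HAlg K p w lam) G = ⊤ := by
  have key : ∀ t : V, ∃ G : Set V, G.Finite ∧ (∀ v ∈ G, ∃ z, c K p w lam z z • v = v) ∧
      t ∈ Submodule.span (HAlg K p w lam) G := by
    intro t
    have ht : t ∈ AddSubgroup.closure {v : V | ∃ (x : Chambers p w lam) (u : V),
        v = c K p w lam x x • u} := by
      rw [LocallyUnital] at hV
      rw [hV]
      trivial
    induction ht using AddSubgroup.closure_induction with
    | mem v hv =>
      obtain ⟨x, u, rfl⟩ := hv
      refine ⟨{c K p w lam x x • u}, Set.finite_singleton _, ?_,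
        Submodule.mem_span_singleton_self _⟩
      rintro _ rfl
      exact ⟨x, by rw [← mul_smul, c_mul_c_left]⟩
    | zero => exact ⟨∅, Set.finite_empty, by simp, zero_mem _⟩
    | add v v' _ _ hv hv' =>
      obtain ⟨G, hG, h1, h2⟩ := hv
      obtain ⟨G', hG', h1', h2'⟩ := hv'
      refine ⟨G ∪ G', hG.union hG', ?_, add_mem (Submodule.span_mono Set.subset_union_left h2)
        (Submodule.span_mono Set.subset_union_right h2')⟩
      rintro v (hv | hv)
      exacts [h1 v hv, h1' v hv]
    | neg v _ hv =>
      obtain ⟨G, hG, h1, h2⟩ := hv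
      exact ⟨G, hG, h1, neg_mem h2⟩
  choose G hG h1 h2 using key
  obtain ⟨T, hT⟩ := hfin
  refine ⟨⋃ t ∈ T, G t, T.finite_toSet.biUnion fun t _ => hG t, ?_, ?_⟩
  · intro v hv
    obtain ⟨t, -, hv⟩ := Set.mem_iUnion₂.1 hv
    exact h1 t v hv
  · rw [← top_le_iff, ← hT, Submodule.span_le]
    intro t ht
    exact Submodule.span_mono (Set.subset_biUnion_of_mem (u := G) ht) (h2 t)

variable [Fact p.Prime] [CharP K p]
  (b : Chambers p w lam → LamPt w lam) (hb : ∀ x, floor p (b x).1 = x.1)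

theorem exists_homObj_iso {V : ModuleCat.{u} (HAlg K p w lam)} (hV : fgNil K p w lam V) :
    ∃ M : WtMod K w lam, Nonempty (homObj b hb M ≅ V) := by
  obtain ⟨hu, hs, hfin⟩ := hV
  let _ : Module (SymG K w) V := Module.compHom V (algebraMap (SymG K w) (HAlg K p w lam))
  let _ : Module K V := Module.compHom V (algebraMap K (SymG K w))
  have _ : IsScalarTower (SymG K w) (HAlg K p w lam) V := ⟨fun s x v => by
    rw [Algebra.smul_def, mul_smul]; rfl⟩
  have _ : IsScalarTower K (SymG K w) V := ⟨fun s x v => by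
    rw [Algebra.smul_def, mul_smul]; rfl⟩
  choose e he using hs
  -- The largest of the finitely many exponents serves all `s_i`.
  have hN : UnifNil K w V (Finset.univ.sup e) := by
    intro i v
    have h1 := he i v
    rw [sH, ← map_pow, algebraMap_smul] at h1
    rw [← Nat.sub_add_cancel (Finset.le_sup (f := e) (Finset.mem_univ i)), pow_add, mul_smul, h1,
      smul_zero]
  obtain ⟨G, hG, h1, h2⟩ := exists_unital_generators hu hfin
  have hpsi := psi_finite hN hG h1 h2 b hb
  exact ⟨psiObj _ hN hpsi, ⟨LinearEquiv.toModuleIso (LinearEquiv.ofBijective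
    (psiCompare hN hpsi b hb)
      ⟨psiCompare_injective hN hpsi b hb, psiCompare_surjective hN hpsi b hb hu⟩)⟩⟩

theorem lift_isEquivalence_of_homFunctor {P : ObjectProperty (WtMod K w lam)}
    {P' : ObjectProperty (ModuleCat.{u} (HAlg K p w lam))} (hle : P' ≤ fgNil K p w lam)
    (hP : ∀ M (V : ModuleCat.{u} (HAlg K p w lam)), (homObj b hb M ≅ V) → P' V → P M)
    (hF : ∀ M, P' ((P.ι ⋙ homFunctor K b hb).obj M)) :
    (P'.lift (P.ι ⋙ homFunctor K b hb) hF).IsEquivalence := by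
  have _ := homFunctor_full (K := K) b hb
  have _ := homFunctor_faithful (K := K) b hb
  have : (P'.lift (P.ι ⋙ homFunctor K b hb) hF).EssSurj := ⟨fun Y => by
    obtain ⟨M, ⟨e⟩⟩ := exists_homObj_iso b hb (hle _ Y.property)
    exact ⟨⟨M, hP M _ e Y.property⟩, ⟨P'.fullyFaithfulι.preimageIso e⟩⟩⟩
  exact { }

theorem homFunctor_lift_isEquivalence
    (hF : ∀ M, fgNil K p w lam ((homFunctor K b hb).obj M)) :
    ((fgNil K p w lam).lift (homFunctor K b hb) hF).IsEquivalence := by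
  have _ := homFunctor_full (K := K) b hb
  have _ := homFunctor_faithful (K := K) b hb
  have : ((fgNil K p w lam).lift (homFunctor K b hb) hF).EssSurj := ⟨fun Y => by
    obtain ⟨M, ⟨e⟩⟩ := exists_homObj_iso b hb Y.property
    exact ⟨M, ⟨(fgNil K p w lam).fullyFaithfulι.preimageIso e⟩⟩⟩
  exact { }

end Equivalence

/-! ### Modules supported at the origin are finite-dimensional -/

/-- As `Z` absorbs addition, an element outside it uses each nonzero generator only boundedly often.
Here `Z` will be the exponents of monomials killing a given vector. -/
theorem finite_closure_diff {A : Type*} [AddCommMonoid A] {S : AddSubmonoid A} {Z : Set A}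
    (hZ : ∀ x ∈ Z, ∀ y ∈ S, x + y ∈ Z) {G : Set A} (hG : G.Finite) (hGS : G ⊆ S)
    (hN : ∀ g ∈ G, g ≠ 0 → ∃ N : ℕ, N • g ∈ Z) :
    ((AddSubmonoid.closure G : Set A) \ Z).Finite := by
  induction G, hG using Set.Finite.induction_on with
  | empty =>
    rw [AddSubmonoid.closure_empty]
    exact (Set.finite_singleton 0).subset Set.sdiff_subset
  | @insert g G _ _ ih =>
    have ih := ih ((Set.subset_insert g G).trans hGS) fun g' hg' => hN g' (Or.inr hg')
    have hGS' : AddSubmonoid.closure G ≤ S :=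
      AddSubmonoid.closure_le.2 ((Set.subset_insert g G).trans hGS)
    have hg : g ∈ S := hGS (Or.inl rfl)
    by_cases h0 : g = 0
    · rwa [h0, AddSubmonoid.closure_insert_zero]
    · obtain ⟨N, hN⟩ := hN g (Or.inl rfl) h0
      refine ((Set.finite_lt_nat N).image2 (fun (l : ℕ) s => l • g + s) ih).subset ?_
      rintro x ⟨hx, hxZ⟩
      rw [Set.insert_eq, AddSubmonoid.closure_union] at hx
      obtain ⟨y, hy, s, hs, rfl⟩ := AddSubmonoid.mem_sup.1 hx
      obtain ⟨l, rfl⟩ := AddSubmonoid.mem_closure_singleton.1 hy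
      refine ⟨l, ?_, s, ⟨hs, fun hsZ => hxZ ?_⟩, rfl⟩
      · by_contra hl
        apply hxZ
        rw [← Nat.add_sub_cancel' (not_lt.1 hl), add_nsmul, add_assoc]
        exact hZ _ hN _ (add_mem (AddSubmonoid.nsmul_mem _ hg _) (hGS' hs))
      · change l • g + s ∈ Z
        rw [add_comm]
        exact hZ _ hsZ _ (AddSubmonoid.nsmul_mem _ hg _)

/-! ### Monoids of invariant monomials in the orthants -/

section Orthants

variable {n k : ℕ} (w : Fin n → Fin k → ℤ)

/-- The point with given absolute values and signs of the coordinates. -/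
def signed (σ : Fin n → ℤˣ) : (Fin n → ℕ) →+ (Fin n → ℤ) where
  toFun β i := σ i * β i
  map_zero' := by ext i; simp
  map_add' β β' := by ext i; simp [mul_add]

theorem exists_signed (b : Fin n → ℤ) : ∃ σ β, signed σ β = b := by
  refine ⟨fun i => if 0 ≤ b i then 1 else -1, fun i => (b i).natAbs, ?_⟩
  ext i
  change ((if 0 ≤ b i then 1 else -1 : ℤˣ) : ℤ) * _ = _
  split_ifs with h
  · simpa using h
  · rw [Units.val_neg, Units.val_one, Int.natCast_natAbs, abs_of_neg (not_le.1 h)]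
    ring

/-- The invariant monomials in an orthant. -/
def invMonoid (σ : Fin n → ℤˣ) : AddSubmonoid (Fin n → ℕ) where
  carrier := {β | ∑ i, signed σ β i • w i = 0}
  add_mem' := by
    intro β β' h h'
    have := sum_add_smul_eq_zero w h h'
    rwa [← map_add] at this
  zero_mem' := by simp

/-- Gordan's lemma: being cut out by linear equations, the monoid is closed under those differences
that stay in `ℕ^n`. -/
theorem invMonoid_fg (σ : Fin n → ℤˣ) : (invMonoid w σ).FG := by
  refine AddSubmonoid.fg_of_subtractive fun β hβ β' hβ' => ?_
  change ∑ i, signed σ _ i • w i = 0 at hβ hβ' ⊢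
  rw [map_add] at hβ'
  simp only [Pi.add_apply, add_smul, Finset.sum_add_distrib] at hβ'
  rwa [hβ, zero_add] at hβ'

end Orthants

/-! ### Finiteness from the support condition -/

section FiniteDimensional

variable {K : Type u} [Field K] {n k : ℕ} {w : Fin n → Fin k → ℤ} {lam : Fin k → ℤ}

/-- Exponents of equal sign never recross a wall, so `m` is multiplicative on each orthant. -/
theorem wallMv_signed (σ : Fin n → ℤˣ) (β β' : Fin n → ℕ) :
    wallMv K (signed σ β) (signed σ β') = 1 := by
  refine Finset.prod_eq_one fun i _ => ?_
  have : walls (signed σ β i) (signed σ β' i) = ∅ := by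
    change walls (σ i * β i) (σ i * β' i) = ∅
    rcases Int.units_eq_one_or (σ i) with h | h <;> rw [h] <;> ext j <;> simp [walls] <;> omega
  rw [wallPoly, this, Finset.prod_empty, map_one]

variable {M : Type u} [AddCommGroup M] [Module (HEAQuot K w lam) M]

theorem m_signed_add_smul {σ : Fin n → ℤˣ} {β β' : Fin n → ℕ}
    (h : ∑ i, signed σ β i • w i = 0) (h' : ∑ i, signed σ β' i • w i = 0)
    (h'' : ∑ i, signed σ (β + β') i • w i = 0) (v : M) :
    m K w lam _ h'' • v = m K w lam _ h • m K w lam _ h' • v := by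
  rw [← mul_smul, m_mul_m K w lam 0, wallMv_signed, map_one, map_one, mul_one]
  congr 2
  exact map_add _ _ _

theorem m_signed_nsmul_smul {σ : Fin n → ℤˣ} {β : Fin n → ℕ}
    (h : ∑ i, signed σ β i • w i = 0) (N : ℕ)
    (h'' : ∑ i, signed σ (N • β) i • w i = 0) (v : M) :
    m K w lam _ h'' • v = m K w lam _ h ^ N • v := by
  induction N with
  | zero =>
    have : ∀ b (hb : ∑ i, b i • w i = 0), b = 0 → m K w lam b hb = 1 := by
      rintro b hb rfl
      exact m_zero K w lam hb
    rw [this _ h'' (by rw [zero_nsmul, map_zero]), pow_zero]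
  | succ N ih =>
    have h' : ∑ i, signed σ (N • β) i • w i = 0 :=
      AddSubmonoid.nsmul_mem (invMonoid w σ) (show β ∈ invMonoid w σ from h) N
    have e : ∀ β' (hβ' : ∑ i, signed σ β' i • w i = 0), β' = β + N • β →
        m K w lam _ hβ' • v = m K w lam _ h • m K w lam _ h' • v := by
      rintro _ hβ' rfl
      exact m_signed_add_smul h h' hβ' v
    rw [e _ h'' (succ_nsmul' β N), ih h', pow_succ', mul_smul]

/-- The exponents of the Frobenius twist of the monomial `m(b)`. -/
def frobExp (b : Fin n → ℤ) : Fin n ⊕ Fin n →₀ ℕ :=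
  Finsupp.equivFunOnFinite.symm (Sum.elim (fun i => (b i).toNat) fun i => (-b i).toNat)

theorem polyInvariant_frobExp {b : Fin n → ℤ} (hb : ∑ i, b i • w i = 0) :
    PolyInvariant K w (MvPolynomial.monomial (frobExp b) (1 : K)) := by
  intro e he
  obtain rfl : e = frobExp b :=
    Finset.mem_singleton.1 (MvPolynomial.support_monomial_subset he)
  rw [← hb]
  refine Finset.sum_congr rfl fun i _ => ?_
  congr 1
  change ((b i).toNat : ℤ) - ((-b i).toNat : ℤ) = _
  omega

theorem frob_monomial (p : ℕ) (e : Fin n ⊕ Fin n →₀ ℕ) :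
    frob K p (MvPolynomial.monomial e (1 : K)) =
      zdMonomial K (fun i => p * e (Sum.inl i)) (fun i => p * e (Sum.inr i)) := by
  classical
  rw [frob, MvPolynomial.support_monomial, if_neg one_ne_zero, Finset.sum_singleton,
    MvPolynomial.coeff_monomial, if_pos rfl, one_smul]

theorem exists_m_smul_eq_zero {p : ℕ} {M : WtMod K w lam} (hM : M.SupportedAtO K w lam p)
    {σ : Fin n → ℤˣ} {β : Fin n → ℕ} (hβ : β ∈ invMonoid w σ) (h0 : β ≠ 0) (v : M.carrier) :
    ∃ N : ℕ, ∀ h, m K w lam (signed σ (N • β)) h • v = 0 := by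
  have hb : ∑ i, signed σ β i • w i = 0 := hβ
  obtain ⟨N, hN⟩ := hM _ (polyInvariant_frobExp hb) (by
    rw [MvPolynomial.constantCoeff_monomial, if_neg]
    intro h
    apply h0
    funext i
    have h1 : (signed σ β i).toNat = 0 := DFunLike.congr_fun h (Sum.inl i)
    have h2 : (-signed σ β i).toNat = 0 := DFunLike.congr_fun h (Sum.inr i)
    have h3 : (σ i : ℤ) * β i = 0 := by
      change signed σ β i = 0
      omega
    simpa using h3) v
  -- The Frobenius twist of the monomial with exponent `β` is the one with exponent `p • β`, and its
  -- `N`-th power has exponent `(N * p) • β`.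
  refine ⟨N * p, fun h => ?_⟩
  have hp : ∑ i, signed σ (p • β) i • w i = 0 :=
    AddSubmonoid.nsmul_mem (invMonoid w σ) hβ p
  have e1 : ∀ β' (hβ' : ∑ i, signed σ β' i • w i = 0), β' = N • p • β →
      m K w lam _ hβ' • v = m K w lam _ hp ^ N • v := by
    rintro _ hβ' rfl
    exact m_signed_nsmul_smul hp N hβ' v
  rw [e1 _ h (mul_smul N p β), ← hN]
  congr 2
  rw [m_eq]
  congr 1
  refine Subtype.ext ?_
  refine Eq.trans ?_ (frob_monomial p _).symm
  change zdMonomial K _ _ = zdMonomial K _ _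
  congr 1 <;> funext i
  · change ((σ i : ℤ) * ((p * β i : ℕ) : ℤ)).toNat = p * ((σ i : ℤ) * β i).toNat
    rcases Int.units_eq_one_or (σ i) with h | h
    · rw [h, Units.val_one, one_mul, one_mul, Int.toNat_natCast, Int.toNat_natCast]
    · rw [h, Units.val_neg, Units.val_one, neg_one_mul, neg_one_mul, Int.toNat_neg_natCast,
        Int.toNat_neg_natCast, mul_zero]
  · change (-((σ i : ℤ) * ((p * β i : ℕ) : ℤ))).toNat = p * (-((σ i : ℤ) * β i)).toNat
    rcases Int.units_eq_one_or (σ i) with h | h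
    · rw [h, Units.val_one, one_mul, one_mul, Int.toNat_neg_natCast, Int.toNat_neg_natCast,
        mul_zero]
    · rw [h, Units.val_neg, Units.val_one, neg_one_mul, neg_one_mul, neg_neg, neg_neg,
        Int.toNat_natCast, Int.toNat_natCast]

/-- There are finitely many orthants; in each the invariant monoid is finitely generated and some
multiple of every nonzero generator kills `v`. -/
theorem finite_m_smul_ne_zero {p : ℕ} {M : WtMod K w lam} (hM : M.SupportedAtO K w lam p)
    (v : M.carrier) : {b | ∃ h, m K w lam b h • v ≠ 0}.Finite := by
  have key : ∀ σ : Fin n → ℤˣ,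
      {β : Fin n → ℕ | ∃ h, m K w lam (signed σ β) h • v ≠ 0}.Finite := by
    intro σ
    obtain ⟨G, hG⟩ := invMonoid_fg w σ
    refine (finite_closure_diff (S := invMonoid w σ)
      (Z := {β | ∀ h, m K w lam (signed σ β) h • v = 0}) (G := G) ?_ G.finite_toSet ?_ ?_).subset ?_
    · intro β hβ β' hβ' h
      by_cases h' : ∑ i, signed σ β i • w i = 0
      · have e : ∀ β'' (hβ'' : ∑ i, signed σ β'' i • w i = 0), β'' = β' + β →
            m K w lam _ hβ'' • v = m K w lam _ hβ' • m K w lam _ h' • v := by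
          rintro _ hβ'' rfl
          exact m_signed_add_smul hβ' h' hβ'' v
        rw [e _ h (add_comm _ _), hβ h', smul_zero]
      · refine (h' ?_).elim
        have h2 : ∑ i, signed σ β' i • w i = 0 := hβ'
        rw [map_add] at h
        simp only [Pi.add_apply, add_smul, Finset.sum_add_distrib] at h
        rwa [h2, add_zero] at h
    · rw [← hG]
      exact AddSubmonoid.subset_closure
    · intro g hg h0
      exact exists_m_smul_eq_zero hM (hG ▸ AddSubmonoid.subset_closure hg) h0 v
    · rintro β ⟨h, hv⟩
      rw [hG]
      exact ⟨h, fun hZ => hv (hZ h)⟩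
  refine (Set.finite_iUnion fun σ => (key σ).image (signed σ)).subset ?_
  rintro b ⟨h, hv⟩
  obtain ⟨σ, β, rfl⟩ := exists_signed b
  exact Set.mem_iUnion.2 ⟨σ, β, ⟨h, hv⟩, rfl⟩

/-- The linear map `f ↦ f(h - a) v`. -/
def polySmul {M : WtMod K w lam} (a : Fin n → ℤ) (v : M.carrier) :
    MvPolynomial (Fin n) K →ₗ[K] M.carrier where
  toFun f := sA K w lam a f • v
  map_add' f g := by rw [map_add, add_smul]
  map_smul' r f := by rw [map_smul, smul_assoc]; rfl

theorem polySmul_range_fg {M : WtMod K w lam} {a : Fin n → ℤ} {v : M.carrier} {N : ℕ}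
    (hv : Kills K w lam a N v) : (LinearMap.range (polySmul a v)).FG := by
  have hfin : {e : Fin n →₀ ℕ | ∀ i, e i < N}.Finite := by
    refine (Set.Finite.pi' fun _ : Fin n => Set.finite_lt_nat N).preimage
      (f := fun e : Fin n →₀ ℕ => (e : Fin n → ℕ)) ?_
    exact DFunLike.coe_injective.injOn
  refine ⟨(hfin.image fun e => polySmul a v (MvPolynomial.monomial e 1)).toFinset, ?_⟩
  rw [Set.Finite.coe_toFinset]
  refine le_antisymm (Submodule.span_le.2 ?_) ?_
  · rintro _ ⟨e, -, rfl⟩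
    exact ⟨_, rfl⟩
  · rintro _ ⟨f, rfl⟩
    rw [f.as_sum, map_sum]
    refine Submodule.sum_mem _ fun e _ => ?_
    rw [← mul_one (MvPolynomial.coeff e f), ← smul_eq_mul, ← MvPolynomial.smul_monomial, map_smul]
    refine Submodule.smul_mem _ _ ?_
    by_cases he : ∀ i, e i < N
    · exact Submodule.subset_span ⟨e, he, rfl⟩
    · push Not at he
      obtain ⟨i, hi⟩ := he
      have : polySmul a v (MvPolynomial.monomial e 1) = 0 := by
        refine hv.sA_smul_eq_zero ?_
        have e1 : MvPolynomial.monomial e (1 : K) =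
            MvPolynomial.monomial (e - Finsupp.single i N) 1 * MvPolynomial.X i ^ N := by
          rw [MvPolynomial.X_pow_eq_monomial, MvPolynomial.monomial_mul, mul_one,
            tsub_add_cancel_of_le (Finsupp.single_le_iff.2 hi)]
        rw [e1]
        exact Ideal.mul_mem_left _ _ (Ideal.subset_span ⟨i, rfl⟩)
      rw [this]
      exact zero_mem _

/-- For homogeneous `v`, only finitely many `m(b)` act nontrivially, and polynomials in the `h_i`
act on `v` through a finite-dimensional quotient; finitely many such `v` generate. -/
theorem finite_of_supportedAtO {p : ℕ} {M : WtMod K w lam} (hM : M.SupportedAtO K w lam p) :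
    Module.Finite K M.carrier := by
  classical
  have key : ∀ (a : LamPt w lam) (v : M.carrier), v ∈ M.weight a.1 →
      ∃ W : Submodule K M.carrier, W.FG ∧ ∀ r : HEAQuot K w lam, r • v ∈ W := by
    intro a v hv
    obtain ⟨N, hN⟩ := exists_kills M hv
    have hfin := finite_m_smul_ne_zero hM v
    let R := LinearMap.range (polySmul (M := M) a.1 v)
    refine ⟨⨆ b ∈ hfin.toFinset, if hb : ∑ i, b i • w i = 0 then
      R.map (Algebra.lsmul K K M.carrier (m K w lam b hb)) else ⊥,
      Submodule.fg_biSup _ _ fun b _ => ?_, fun r => ?_⟩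
    · split_ifs
      · exact (polySmul_range_fg hN).map _
      · exact Submodule.fg_bot
    · induction r using HEAQuot_induction K w lam a.1 with
      | hm b hb f =>
        by_cases h0 : m K w lam b hb • v = 0
        -- The polynomial is moved to the left of the monomial, so that the vanishing of `m(b) v`
        -- suffices.
        · rw [← sA_mul_m, mul_smul, h0, smul_zero]
          exact zero_mem _
        · refine Submodule.mem_iSup_of_mem b (Submodule.mem_iSup_of_mem
            (hfin.mem_toFinset.2 ⟨hb, h0⟩) ?_)
          rw [dif_pos hb, mul_smul]
          exact ⟨_, ⟨f, rfl⟩, rfl⟩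
      | hadd x y hx hy => rw [add_smul]; exact add_mem hx hy
  obtain ⟨G, hG, hw, hspan⟩ := exists_homogeneous_generators M
  choose a ha using hw
  choose W hW hW' using fun v : G => key (a v.1 v.2) v.1 (ha v.1 v.2)
  have _ : Finite G := hG
  have hW'' : (⨆ v, W v) = ⊤ := by
    rw [eq_top_iff]
    rintro t -
    have ht : t ∈ Submodule.span (HEAQuot K w lam) G := by rw [hspan]; trivial
    have : ∀ r : HEAQuot K w lam, r • t ∈ ⨆ v, W v := by
      induction ht using Submodule.span_induction with
      | mem v hv => exact fun r => Submodule.mem_iSup_of_mem ⟨v, hv⟩ (hW' ⟨v, hv⟩ r)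
      | zero => intro r; rw [smul_zero]; exact zero_mem _
      | add v v' _ _ hv hv' => intro r; rw [smul_add]; exact add_mem (hv r) (hv' r)
      | smul s v _ hv => intro r; rw [← mul_smul]; exact hv _
    simpa using this 1
  exact ⟨hW'' ▸ Submodule.fg_iSup _ hW⟩

end FiniteDimensional

/-! ### Finite-dimensional modules are supported at the origin -/

section SupportedAtO

variable {K : Type u} [Field K] {p n k : ℕ} {w : Fin n → Fin k → ℤ} {lam : Fin k → ℤ}

/-- The Frobenius twist of a monomial in the hypertoric enveloping algebra. -/
def frobH (p : ℕ) (e : Fin n ⊕ Fin n →₀ ℕ)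
    (he : ∑ i, ((e (Sum.inl i) : ℤ) - (e (Sum.inr i) : ℤ)) • w i = 0) : HEA K w :=
  ⟨zdMonomial K (fun i => p * e (Sum.inl i)) (fun i => p * e (Sum.inr i)), by
    rw [mem_HEA]
    have := zdMonomial_mem K w (fun i => p * e (Sum.inl i)) (fun i => p * e (Sum.inr i))
    convert this using 2
    rw [← smul_zero (p : ℤ), ← he, Finset.smul_sum]
    refine Finset.sum_congr rfl fun i _ => ?_
    rw [smul_smul, mul_sub, Nat.cast_mul, Nat.cast_mul]⟩

theorem toQuot_frobH_mem (e : Fin n ⊕ Fin n →₀ ℕ)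
    (he : ∑ i, ((e (Sum.inl i) : ℤ) - (e (Sum.inr i) : ℤ)) • w i = 0) :
    toQuot K w lam (frobH p e he) ∈ quotWeight K w lam
      (fun i => p * ((e (Sum.inl i) : ℤ) - (e (Sum.inr i) : ℤ))) := by
  refine ⟨frobH p e he, ?_, rfl⟩
  have := zdMonomial_mem K (fun i : Fin n => (Pi.single i 1 : Fin n → ℤ))
    (fun i => p * e (Sum.inl i)) (fun i => p * e (Sum.inr i))
  rw [sum_smul_single] at this
  change zdMonomial K _ _ ∈ weylWeight K (fun i : Fin n => (Pi.single i 1 : Fin n → ℤ)) _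
  convert this using 2
  funext i
  push_cast
  ring

variable [Fact p.Prime] [CharP K p]

/-- The commutator of `∂` with `z^p` is `p z^{p-1}`, which is zero in characteristic `p`. -/
theorem commute_z_pow_d (i : Fin n) : Commute (z K i ^ p) (d K i) := by
  obtain ⟨l, hl⟩ := Nat.exists_eq_succ_of_ne_zero (Fact.out : p.Prime).ne_zero
  have h0 : ((l : ℤ) + 1 : ℤ) = ((p : ℕ) : ℤ) := by rw [hl, Nat.cast_succ]
  have h1 := mul_pow_of_weyl (d_mul_z_self K i) l
  rw [h0, Int.cast_natCast, ← map_natCast (algebraMap K (Weyl K n)), CharP.cast_eq_zero, map_zero,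
    add_zero, ← mul_assoc, ← pow_succ] at h1
  rw [hl]
  exact h1.symm

theorem commute_z_pow_d_pow (i j : Fin n) : Commute (z K i ^ p) (d K j ^ p) := by
  by_cases hij : i = j
  · subst hij
    exact (commute_z_pow_d i).pow_right p
  · exact (commute_z_d K hij).pow_pow p p

theorem commute_zdMonomial (α β α' β' : Fin n → ℕ) :
    Commute (zdMonomial K (fun i => p * α i) (fun i => p * β i))
      (zdMonomial K (fun i => p * α' i) (fun i => p * β' i)) := by
  have hl : ∀ {f : Fin n → Weyl K n} {x : Weyl K n}, (∀ i, Commute (f i) x) →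
      Commute ((List.finRange n).map f).prod x := by
    intro f x h
    refine Commute.list_prod_left _ _ fun y hy => ?_
    obtain ⟨i, -, rfl⟩ := List.mem_map.1 hy
    exact h i
  simp only [zdMonomial, pow_mul]
  refine ((hl fun i => ?_).mul_right (hl fun j => ?_).symm).mul_left
    ((hl fun i => ?_).mul_right (hl fun j => ?_).symm)
  · exact (hl fun j => ((show Commute (z K j) (z K i) from z_mul_z K j i).pow_pow p p).pow_pow
      _ _).symm
  · exact (hl fun i => (commute_z_pow_d_pow i j).pow_pow _ _).symm
  · exact (hl fun j => (commute_z_pow_d_pow j i).pow_pow _ _).symm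
  · exact (hl fun i => ((show Commute (d K i) (d K j) from d_mul_d K i j).pow_pow p p).pow_pow
      _ _).symm

/-- Going down by `p α` and back up crosses `α` chamber boundaries twice, so `η = α > 0`. Comparing
constant terms in `wall_identity` suffices, because the factors `q` are units. -/
theorem X_dvd_wallPolyAt (a : ℤ) {α : ℕ} (hα : α ≠ 0) :
    (Polynomial.X : Polynomial K) ∣ wallPolyAt K a (p * α : ℕ) (-(p * α : ℕ)) := by
  have hp : (p : ℤ) ≠ 0 := by exact_mod_cast (Fact.out : p.Prime).ne_zero
  have h1 := wall_identity K p a (p * α : ℕ) (-(p * α : ℕ))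
  have h2 : (a + -((p * α : ℕ) : ℤ)) / (p : ℤ) = a / p - α := by
    rw [show a + -((p * α : ℕ) : ℤ) = a + p * (-α) by push_cast; ring,
      Int.add_mul_ediv_left _ _ hp]
    ring
  have h3 : eta (a / p) (a / p - α) (a / p) = α := by
    simp only [eta, abs_eq_max_neg]
    omega
  rw [add_neg_cancel, add_zero, h2, h3, qProd_of_nonpos K le_rfl, mul_one] at h1
  have h4 := congrArg PowerSeries.constantCoeff h1
  have h5 : ∀ a b : ℤ, PowerSeries.constantCoeff (qProd K a b) ≠ 0 := fun a b h => by
    have := congrArg PowerSeries.constantCoeff (qInv_mul_qProd K a b)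
    rw [map_mul, h, mul_zero, map_one] at this
    exact zero_ne_one this
  rw [map_mul, map_pow, PowerSeries.constantCoeff_X, zero_pow hα, map_mul] at h4
  rw [Polynomial.X_dvd_iff]
  have h6 := (mul_eq_zero.1 h4).resolve_right (mul_ne_zero (h5 _ _) (h5 _ _))
  rwa [Polynomial.constantCoeff_coe] at h6

theorem toQuot_frobH_eq {e : Fin n ⊕ Fin n →₀ ℕ}
    (he : ∑ i, ((e (Sum.inl i) : ℤ) - (e (Sum.inr i) : ℤ)) • w i = 0)
    (h : ∀ i, e (Sum.inl i) = e (Sum.inr i)) {j : Fin n} (hj : e (Sum.inl j) ≠ 0)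
    (a : Fin n → ℤ) : ∃ g : MvPolynomial (Fin n) K, toQuot K w lam (frobH p e he) =
      sA K w lam a (g * MvPolynomial.X j) := by
  let b : Fin n → ℤ := fun i => (p * e (Sum.inl i) : ℕ)
  have h1 : frobH p e he = polH K w (wallMv K b (-b)) := by
    refine Subtype.ext ?_
    have h2 := mW_mul_mW K b (-b)
    rw [add_neg_cancel, mW_zero, one_mul] at h2
    rw [coe_polH, ← h2, mW, mW]
    simp only [zdMonomial, frobH, ← h, b, Pi.neg_apply, neg_neg, Int.toNat_natCast,
      Int.toNat_neg_natCast, pow_zero, List.map_const', List.prod_replicate, one_pow, mul_one,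
      one_mul]
  have h2 : MvPolynomial.X j ∣ shift K a (wallMv K b (-b)) := by
    rw [shift_wallMv]
    refine Dvd.dvd.trans ?_ (Finset.dvd_prod_of_mem _ (Finset.mem_univ j))
    obtain ⟨t, ht⟩ := X_dvd_wallPolyAt (K := K) (p := p) (a j) hj
    rw [Pi.neg_apply, ht, map_mul, Polynomial.aeval_X]
    exact dvd_mul_right _ _
  obtain ⟨g, hg⟩ := h2
  exact ⟨g, by rw [h1, toQuot_polH' K w lam a, hg, mul_comm]⟩

/-- A monomial of weight zero is divisible, as a polynomial, by some nilpotent `h_j - a_j`. Any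
other monomial moves `v` through infinitely many distinct weights, only finitely many of which occur
in `M`. -/
theorem exists_frobH_pow_smul_eq_zero {M : WtMod K w lam} (hM : Module.Finite K M.carrier)
    {e : Fin n ⊕ Fin n →₀ ℕ}
    (he : ∑ i, ((e (Sum.inl i) : ℤ) - (e (Sum.inr i) : ℤ)) • w i = 0) (h0 : e ≠ 0)
    {a : Fin n → ℤ} {v : M.carrier} (hv : v ∈ M.weight a) :
    ∃ N : ℕ, toQuot K w lam (frobH p e he) ^ N • v = 0 := by
  have hp : (p : ℤ) ≠ 0 := by exact_mod_cast (Fact.out : p.Prime).ne_zero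
  by_cases h : ∀ i, e (Sum.inl i) = e (Sum.inr i)
  · obtain ⟨j, hj⟩ : ∃ j, e (Sum.inl j) ≠ 0 := by
      by_contra! hj
      apply h0
      ext i
      rcases i with i | i
      · exact hj i
      · exact (h i).symm.trans (hj i)
    obtain ⟨g, hg⟩ := toQuot_frobH_eq (K := K) (p := p) (lam := lam) he h hj a
    obtain ⟨N, hN⟩ := exists_kills M hv
    refine ⟨N, ?_⟩
    rw [hg, ← map_pow, mul_pow, map_mul, mul_smul, map_pow, map_pow, sA_X, hN j, smul_zero]
  · push Not at h
    obtain ⟨j, hj⟩ := h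
    set δ : Fin n → ℤ := fun i => p * ((e (Sum.inl i) : ℤ) - (e (Sum.inr i) : ℤ)) with hδ
    have hfin : {a | M.weight a ≠ ⊥}.Finite :=
      WellFoundedGT.finite_ne_bot_of_iSupIndep M.internal.submodule_iSupIndep
    have hpow : ∀ N : ℕ, toQuot K w lam (frobH p e he) ^ N • v ∈ M.weight (a + N • δ) := by
      intro N
      induction N with
      | zero => simpa using hv
      | succ N ih =>
        rw [pow_succ', mul_smul, succ_nsmul, ← add_assoc]
        exact M.smul_mem _ _ _ (toQuot_frobH_mem e he) _ ih
    have hinj : Function.Injective fun N : ℕ => a + N • δ := by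
      intro N N' hN
      have h1 := congrFun (add_left_cancel hN) j
      have h2 : (N : ℤ) * δ j = N' * δ j := by simpa using h1
      have h3 : δ j ≠ 0 := mul_ne_zero hp (sub_ne_zero.2 (by exact_mod_cast hj))
      exact_mod_cast mul_right_cancel₀ h3 h2
    obtain ⟨N, hN⟩ : ∃ N : ℕ, M.weight (a + N • δ) = ⊥ := by
      by_contra! hN
      exact Set.infinite_of_injective_forall_mem hinj hN hfin
    refine ⟨N, ?_⟩
    have := hpow N
    rwa [hN, Submodule.mem_bot] at this

theorem isNilpotent_frobH {M : WtMod K w lam} (hM : Module.Finite K M.carrier)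
    {e : Fin n ⊕ Fin n →₀ ℕ}
    (he : ∑ i, ((e (Sum.inl i) : ℤ) - (e (Sum.inr i) : ℤ)) • w i = 0) (h0 : e ≠ 0) :
    IsNilpotent (Algebra.lsmul K K M.carrier (toQuot K w lam (frobH p e he))) := by
  rw [Module.End.isNilpotent_iff_of_finite]
  intro v
  have key : ∀ (N : ℕ) (v : M.carrier), (Algebra.lsmul K K M.carrier
      (toQuot K w lam (frobH p e he)) ^ N) v = toQuot K w lam (frobH p e he) ^ N • v := by
    intro N v
    rw [← map_pow]
    rfl
  simp only [key]
  induction v using weight_induction M with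
  | h0 => exact ⟨0, smul_zero _⟩
  | hw a v hv => exact exists_frobH_pow_smul_eq_zero hM he h0 hv
  | hadd v v' hv hv' =>
    obtain ⟨N, hN⟩ := hv
    obtain ⟨N', hN'⟩ := hv'
    refine ⟨N + N', ?_⟩
    rw [smul_add]
    nth_rw 1 [add_comm N N']
    rw [pow_add, pow_add, mul_smul, mul_smul, hN, hN', smul_zero, smul_zero, add_zero]

/-- An invariant polynomial without constant term maps to a sum of Frobenius monomials that are
nilpotent on `M` and commute, and such a sum is nilpotent. -/
theorem supportedAtO_of_finite {M : WtMod K w lam} (hM : Module.Finite K M.carrier) :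
    M.SupportedAtO K w lam p := by
  intro f hf hf0 v
  have h1 : (⟨frob K p f, frob_mem K w p f hf⟩ : HEA K w) =
      ∑ e ∈ f.support.attach, f.coeff e.1 • frobH p e.1 (hf e.1 e.2) := by
    refine Subtype.ext ?_
    have h2 := map_sum (HEA K w).val (fun e : f.support =>
      f.coeff e.1 • frobH p e.1 (hf e.1 e.2)) f.support.attach
    refine Eq.trans ?_ h2.symm
    exact (Finset.sum_attach f.support fun e => f.coeff e •
      zdMonomial K (fun i => p * e (Sum.inl i)) (fun i => p * e (Sum.inr i))).symm
  have h2 : IsNilpotent (Algebra.lsmul K K M.carrier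
      (toQuot K w lam ⟨frob K p f, frob_mem K w p f hf⟩)) := by
    rw [h1, map_sum, map_sum]
    refine Commute.isNilpotent_sum (fun e _ => ?_) fun e e' _ _ => ?_
    · rw [map_smul, map_smul]
      refine (isNilpotent_frobH hM _ ?_).smul _
      intro h
      have := MvPolynomial.mem_support_iff.1 e.2
      rw [h] at this
      exact this hf0
    · rw [map_smul, map_smul, map_smul, map_smul]
      refine Commute.smul_left (Commute.smul_right ?_ _) _
      change _ * _ = _ * _
      rw [← map_mul, ← map_mul, ← map_mul, ← map_mul]
      congr 2
      exact Subtype.ext (commute_zdMonomial _ _ _ _)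
  obtain ⟨N, hN⟩ := h2
  refine ⟨N, ?_⟩
  rw [← map_pow] at hN
  exact LinearMap.congr_fun hN v

end SupportedAtO

/-! ### The functor on modules supported at the origin -/

section FiniteDimensionalModules

variable {K : Type u} [Field K] {p : ℕ} {n k : ℕ} {w : Fin n → Fin k → ℤ} {lam : Fin k → ℤ}

theorem fdNil_le_fgNil : fdNil K p w lam ≤ fgNil K p w lam := by
  rintro V ⟨h1, h2, h3⟩
  refine ⟨h1, h2, ?_⟩
  let _ : Module K V := Module.compHom V (scalarH K p w lam)
  obtain ⟨T, hT⟩ := h3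
  refine ⟨T, eq_top_iff.2 fun v _ => ?_⟩
  have hv : v ∈ Submodule.span K (T : Set V) := by rw [hT]; trivial
  induction hv using Submodule.span_induction with
  | mem v hv => exact Submodule.subset_span hv
  | zero => exact zero_mem _
  | add v v' _ _ hv hv' => exact add_mem (hv trivial) (hv' trivial)
  | smul r v _ hv => exact Submodule.smul_mem _ (scalarH K p w lam r) (hv trivial)

theorem finite_weight_ne_bot {M : WtMod K w lam} (hM : Module.Finite K M.carrier) :
    {a | M.weight a ≠ ⊥}.Finite :=
  WellFoundedGT.finite_ne_bot_of_iSupIndep M.internal.submodule_iSupIndep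

theorem chamber_finite (x : Fin n → ℤ) : (chamber p w lam x).Finite :=
  (Set.finite_Icc (fun i => p * x i) (fun i => p * x i + p)).subset fun _ ha =>
    ⟨fun i => (ha.2 i).1, fun i => (ha.2 i).2.le⟩

variable (b : Chambers p w lam → LamPt w lam) (M : WtMod K w lam)

/-- The sum map to `M`. -/
def total : HomSum b M →+ M.carrier :=
  DFinsupp.sumAddHom fun x => (M.weight (b x).1).subtype.toAddMonoidHom

theorem total_inc (x : Chambers p w lam) (v : M.weight (b x).1) :
    total b M (inc b M x v) = v.1 :=
  DFinsupp.sumAddHom_single _ _ _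

theorem total_algebraMap_smul (r : K) (v : HomSum b M) :
    total b M (algebraMap K (SymG K w) r • v) = r • total b M v := by
  induction v using HomSum_induction with
  | h0 => simp only [smul_zero, map_zero]
  | hinc x v =>
    rw [← map_smul, total_inc, total_inc, algebraMap_smul_weight]
    rfl
  | hadd v v' hv hv' => simp only [smul_add, map_add, hv, hv']

variable (hb : ∀ x, floor p (b x).1 = x.1)

include hb in
theorem base_injective : Function.Injective fun x => (b x).1 := fun x y h =>
  Subtype.ext (by rw [← hb x, ← hb y]; exact congrArg (floor p) h)

include hb in
theorem component_total (x : Chambers p w lam) (v : HomSum b M) :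
    component M (b x).1 (total b M v) = prj b M x v := by
  induction v using HomSum_induction with
  | h0 => simp only [map_zero]
  | hinc y v =>
    rw [total_inc]
    by_cases h : x = y
    · subst h
      rw [component_self, prj_inc]
    · rw [component_ne M (fun e => h (base_injective b hb e).symm), prj_inc_ne b M h]
  | hadd v v' hv hv' => simp only [map_add, hv, hv']

variable [Fact p.Prime] [CharP K p]

/-- Base points of different chambers are different weights, so the direct sum of their weight
spaces embeds in `M`. -/
theorem homObj_fdNil (hM : Module.Finite K M.carrier) : fdNil K p w lam (homObj b hb M) := by
  refine ⟨homObj_locallyUnital b hb M, (homObj_fgNil b hb M).2.1, ?_⟩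
  let _ : Module K (homObj b hb M) := Module.compHom _ (scalarH K p w lam)
  let f : homObj b hb M →ₗ[K] M.carrier :=
    { toFun v := total b M (toSum b hb v)
      map_add' v v' := map_add (total b M) _ _
      map_smul' r v := by
        rw [RingHom.id_apply, ← total_algebraMap_smul]
        exact congrArg _ (toSum_algebraMap_smul b hb _ v) }
  refine Module.Finite.of_injective f fun v v' h => (toSum b hb).injective ?_
  refine HomSum_ext b M fun x => ?_
  rw [← component_total b M hb, ← component_total b M hb]
  exact congrArg _ h

variable {M}

/-- Only finitely many chambers carry a nonzero space, each chamber contains finitely many weights,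
and every weight space embeds in that of its base point. -/
theorem finite_of_homObj_iso {V : ModuleCat.{u} (HAlg K p w lam)} (e : homObj b hb M ≅ V)
    (hV : fdNil K p w lam V) : Module.Finite K M.carrier := by
  let _ : Module K V := Module.compHom V (scalarH K p w lam)
  let _ : Module K (homObj b hb M) := Module.compHom _ (scalarH K p w lam)
  have _ : Module.Finite K V := hV.2.2
  have hfin : Module.Finite K (homObj b hb M) :=
    Module.Finite.of_injective
      { toFun := e.hom.hom
        map_add' := map_add e.hom.hom
        map_smul' r v := map_smul e.hom.hom (scalarH K p w lam r) v : homObj b hb M →ₗ[K] V }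
      e.toLinearEquiv.injective
  have hbase : ∀ x, Module.Finite K (M.weight (b x).1) := fun x =>
    Module.Finite.of_injective
      { toFun v := (toSum b hb).symm (inc b M x v)
        map_add' v v' := by simp only [map_add]
        map_smul' r v := by
          rw [← algebraMap_smul_weight, toSum_symm_inc_smul]
          rfl : M.weight (b x).1 →ₗ[K] homObj b hb M }
      fun v v' h => by
        have := congrArg (prj b M x) ((toSum b hb).symm.injective h)
        rwa [prj_inc, prj_inc] at this
  have hcham : {x | M.weight (b x).1 ≠ ⊥}.Finite := by
    obtain ⟨T, hT⟩ := hfin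
    refine (T.finite_toSet.biUnion fun t _ => DFinsupp.finite_support (toSum b hb t)).subset ?_
    intro x hx
    by_contra hx'
    have h0 : ∀ t ∈ T, prj b M x (toSum b hb t) = 0 := by
      intro t ht
      by_contra h
      exact hx' (Set.mem_iUnion₂.2 ⟨t, ht, h⟩)
    apply hx
    rw [eq_bot_iff]
    intro v hv
    have key : ∀ t : homObj b hb M, prj b M x (toSum b hb t) = 0 := by
      intro t
      have ht : t ∈ Submodule.span K (T : Set (homObj b hb M)) := by rw [hT]; trivial
      induction ht using Submodule.span_induction with
      | mem t ht => exact h0 t ht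
      | zero => simp only [map_zero]
      | add t t' _ _ ht ht' => rw [map_add, map_add, ht, ht', add_zero]
      | smul r t _ ht =>
        change prj b M x (toSum b hb (algebraMap _ (HAlg K p w lam) (algebraMap K (SymG K w) r) • t)) = 0
        rw [toSum_algebraMap_smul, map_smul, ht, smul_zero]
    have := key ((toSum b hb).symm (inc b M x ⟨v, hv⟩))
    rw [AddEquiv.apply_symm_apply, prj_inc] at this
    exact congrArg Subtype.val this
  have hinj : ∀ a : LamPt w lam, Function.Injective (Cmap M a (b (a.chamberOf p))) := by
    intro a
    have hx : floor p (b (a.chamberOf p)).1 = floor p a.1 := hb _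
    refine Function.LeftInverse.injective (g := Cmap M (b (a.chamberOf p)) a) fun v => ?_
    rw [Cmap_Cmap_of_eq M p _ _ _ _ (Or.inl hx), Cmap_self]
  have hall : {a | M.weight a ≠ ⊥}.Finite := by
    refine (hcham.biUnion fun x _ => chamber_finite (p := p) (w := w) (lam := lam) x.1).subset ?_
    intro a ha
    by_cases haw : ∑ i, a i • w i = lam
    · refine Set.mem_iUnion₂.2 ⟨LamPt.chamberOf p ⟨a, haw⟩, fun h => ha ?_,
        mem_chamber_floor (p := p) (⟨a, haw⟩ : LamPt w lam)⟩
      rw [eq_bot_iff]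
      intro v hv
      have h1 := (Submodule.eq_bot_iff _).1 h _
        (Cmap M ⟨a, haw⟩ (b (LamPt.chamberOf p ⟨a, haw⟩)) ⟨v, hv⟩).2
      have h2 := hinj ⟨a, haw⟩ (a₁ := ⟨v, hv⟩) (a₂ := 0)
        (by rw [map_zero]; exact Subtype.ext h1)
      exact congrArg Subtype.val h2
    · exact (ha (M.weight_eq_bot a haw)).elim
  have htop : (⨆ a ∈ hall.toFinset, M.weight a) = ⊤ := by
    rw [← M.internal.submodule_iSup_eq_top]
    refine le_antisymm (iSup₂_le fun a _ => le_iSup M.weight a) (iSup_le fun a => ?_)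
    by_cases ha : M.weight a = ⊥
    · rw [ha]
      exact bot_le
    · exact le_iSup₂ (f := fun a (_ : a ∈ hall.toFinset) => M.weight a) a (hall.mem_toFinset.2 ha)
  refine ⟨htop ▸ Submodule.fg_biSup _ _ fun a ha => ?_⟩
  by_cases haw : ∑ i, a i • w i = lam
  · have _ := hbase (LamPt.chamberOf p ⟨a, haw⟩)
    exact Module.Finite.iff_fg.1 (Module.Finite.of_injective _ (hinj ⟨a, haw⟩))
  · rw [M.weight_eq_bot a haw]
    exact Submodule.fg_bot

end FiniteDimensionalModules

/-! ### Finiteness of the set of nonzero `Hom(P_x, M)` -/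

section ProjectiveFunctor

variable {K : Type u} [Field K] {p : ℕ} {n k : ℕ}
  {w : Fin n → Fin k → ℤ} {lam : Fin k → ℤ}

theorem finite_homQ_ne_bot (b : Chambers p w lam → LamPt w lam)
    (hb : ∀ x, floor p (b x).1 = x.1) {M : WtMod K w lam} (hM : atO K w lam p M) :
    {x | HomQ K w lam (b x).1 M ≠ ⊥}.Finite := by
  refine ((finite_weight_ne_bot (finite_of_supportedAtO hM)).preimage
    (base_injective b hb).injOn).subset fun x hx h => hx ?_
  rw [eq_bot_iff]
  intro f hf
  have h1 := (Submodule.eq_bot_iff _).1 h _ (homEquiv M (b x).1 ⟨f, hf⟩).2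
  have h2 : homEquiv M (b x).1 ⟨f, hf⟩ = 0 := Subtype.ext h1
  exact congrArg Subtype.val ((homEquiv M (b x).1).map_eq_zero_iff.1 h2)

end ProjectiveFunctor

/-! ### Characters of `H^λ` -/

section Characters

variable {K : Type u} [Field K] {p : ℕ} {n k : ℕ} {w : Fin n → Fin k → ℤ} {lam : Fin k → ℤ}

variable (K w) in
/-- The augmentation of `S`. -/
def augS : SymG K w →ₐ[K] K :=
  Ideal.Quotient.liftₐ _ (MvPolynomial.aeval fun _ => 0) (by
    intro f hf
    induction hf using Submodule.span_induction with
    | mem f hf => obtain ⟨χ, rfl⟩ := hf; simp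
    | zero => exact map_zero _
    | add f g _ _ hf hg => rw [map_add, hf, hg, add_zero]
    | smul f g _ hg => rw [smul_eq_mul, map_mul, hg, mul_zero])

theorem augS_sS (i : Fin n) : augS K w (sS K w i) = 0 :=
  MvPolynomial.aeval_X (R := K) (fun _ => (0 : K)) i

open Classical in
variable (K) in
/-- The character of `H^λ` supported at the chamber `x`. -/
def chamberChar (x : Chambers p w lam) : HAlg K p w lam →+* K :=
  letI : Algebra (SymG K w) K := (augS K w).toRingHom.toAlgebra
  (RingQuot.liftAlgHom (SymG K w) ⟨FreeAlgebra.lift (SymG K w)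
    fun yu => if yu = (x, x) then (1 : K) else 0, by
      intro f g hfg
      cases hfg with
      | mul y u t =>
        rw [map_mul, map_smul]
        simp only [FreeAlgebra.lift_ι_apply]
        change _ = augS K w _ * _
        by_cases hy : y = x
        · subst hy
          by_cases ht : t = y
          · subst ht
            by_cases hu : u = t
            · subst hu
              rw [Finset.prod_eq_one fun i _ => by rw [eta_self_left, pow_zero]]
              simp
            -- The product `c_{x,u} c_{u,x}` with `u ≠ x` has a positive power of some `s_i` in
            -- front, which the augmentation kills; hence the relation is respected.
            · obtain ⟨i, hi⟩ : ∃ i, u.1 i ≠ t.1 i := by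
                by_contra! h
                exact hu (Subtype.ext (funext h))
              have : augS K w (∏ i, sS K w i ^ eta (t.1 i) (u.1 i) (t.1 i)) = 0 := by
                rw [map_prod]
                refine Finset.prod_eq_zero (Finset.mem_univ i) ?_
                rw [map_pow, augS_sS, zero_pow]
                simp only [eta, abs_eq_max_neg]
                omega
              rw [this, if_neg (by simp [hu])]
              simp
          · simp [ht]
        · simp [hy]
      | mul_ne y u u' t hu =>
        rw [map_mul, map_zero]
        simp only [FreeAlgebra.lift_ι_apply]
        by_cases h : u = x
        · subst h
          simp [Ne.symm hu]
        · simp [h]⟩ : HAlg K p w lam →ₐ[SymG K w] K).toRingHom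

theorem chamberChar_algebraMap (x : Chambers p w lam) (s : SymG K w) :
    chamberChar K x (algebraMap _ _ s) = augS K w s := by
  let _ : Algebra (SymG K w) K := (augS K w).toRingHom.toAlgebra
  exact AlgHom.commutes (RingQuot.liftAlgHom (SymG K w) _ : HAlg K p w lam →ₐ[SymG K w] K) s

open Classical in
theorem chamberChar_c (x y u : Chambers p w lam) :
    chamberChar K x (c K p w lam y u) = if (y, u) = (x, x) then 1 else 0 := by
  let _ : Algebra (SymG K w) K := (augS K w).toRingHom.toAlgebra
  refine (RingQuot.liftAlgHom_mkAlgHom_apply (SymG K w) _ _ _).trans ?_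
  exact FreeAlgebra.lift_ι_apply _ _

end Characters

/-! ### Isomorphisms between the `Q_a` -/

section Isomorphisms

variable {K : Type u} [Field K] {p : ℕ} [Fact p.Prime] [CharP K p] {n k : ℕ}
  {w : Fin n → Fin k → ℤ} {lam : Fin k → ℤ}

theorem transHom_mem (a a' : LamPt w lam) :
    cElem K w lam a'.1 (a.1 - a'.1) (a'.sub_trivial a) ∈ QWeight K w lam a'.1 a.1 := by
  have := cElem_mem K w lam a'.1 (a.1 - a'.1) (a'.sub_trivial a)
  rwa [add_sub_cancel] at this

variable (K) in
/-- The homomorphism `Q_a → Q_a'` defined by `cElem`. -/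
def transHom (a a' : LamPt w lam) : QHom K w lam a.1 a'.1 :=
  QLift _ (transHom_mem a a')

/-- The composite is right multiplication by the product of two normalised elements, computed at
each level on the generator. The structure constant is `1` since no chamber boundary is crossed. -/
theorem transHom_comp {a a' : LamPt w lam} (h : floor p a.1 = floor p a'.1) :
    (transHom K a' a).toLin ∘ₗ (transHom K a a').toLin = LinearMap.id := by
  refine LinearMap.ext fun q => Subtype.ext (funext fun N => ?_)
  obtain ⟨x, hx⟩ := exists_QProj_eq a.1 q N
  have h1 : ((transHom K a a').toLin q).1 N = Submodule.Quotient.mk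
      (x * cTrunc K w lam a'.1 (a.1 - a'.1) (a'.sub_trivial a) N) :=
    (QLift_val (transHom_mem a a') hx).trans (congrArg _ (cElem_val K w lam _ _ _ N))
  refine (QLift_val (transHom_mem a' a) h1).trans (Eq.trans ?_ hx.symm)
  rw [cElem_val, mul_smul]
  have hk := kills_mk_one K w lam a.1 N
  have h0 : ∑ i, (0 : Fin n → ℤ) i • w i = 0 := by simp
  have h2 := hk.cTrunc_comp p (a.sub_trivial a') (a'.sub_trivial a) h0
    (a' := a'.1) (a'' := a.1) (by abel) (by abel) (by abel)
  rw [hk.cTrunc_zero_smul, show etaMv K (floor p a.1) (floor p a'.1) (floor p a.1) = 1 by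
    rw [h]; exact Finset.prod_eq_one fun i _ => by rw [eta_self_left, pow_zero], map_one,
    one_smul] at h2
  have h3 : ∀ y : HEAQuot K w lam, (Submodule.Quotient.mk y :
      HEAQuot K w lam ⧸ leftIdeal K w lam a.1 N) = y • Submodule.Quotient.mk 1 := fun y => by
    rw [← Submodule.Quotient.mk_smul, smul_eq_mul, mul_one]
  rw [h3 (cTrunc _ _ _ _ _ _ _), h2, ← h3]

/-- Take the object reconstructed from the one-dimensional module given by `chamberChar` at the
chamber of `a`: its weight space at any point of a chamber `y` is `1_y K`, nonzero only for that
chamber. -/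
theorem exists_separating {a a' : LamPt w lam} (h : floor p a.1 ≠ floor p a'.1)
    (b : Chambers p w lam → LamPt w lam) (hb : ∀ x, floor p (b x).1 = x.1) :
    ∃ M : WtMod K w lam, M.weight a.1 ≠ ⊥ ∧ M.weight a'.1 = ⊥ := by
  classical
  let x := a.chamberOf p
  let y := a'.chamberOf p
  have hyx : y ≠ x := fun e => h (congrArg Subtype.val e).symm
  let _ : Module (SymG K w) K := Module.compHom K (augS K w).toRingHom
  let _ : Module (HAlg K p w lam) K := Module.compHom K (chamberChar K x)
  have hsmul : ∀ (t : HAlg K p w lam) (r : K), t • r = chamberChar K x t * r := fun _ _ => rfl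
  have _ : IsScalarTower (SymG K w) (HAlg K p w lam) K := ⟨fun s t v => by
    rw [hsmul, hsmul, Algebra.smul_def, map_mul, chamberChar_algebraMap, mul_assoc]
    rfl⟩
  have _ : IsScalarTower K (SymG K w) K := ⟨fun r s v => by
    change augS K w (r • s) * v = r * (augS K w s * v)
    rw [map_smul, smul_eq_mul, mul_assoc]⟩
  have hN : UnifNil K w K 1 := fun i v => by
    change augS K w (sS K w i ^ 1) * v = 0
    rw [pow_one, augS_sS, zero_mul]
  have hfin : Module.Finite (HEAQuot K w lam) (Psi K p w lam K) := by
    refine psi_finite hN (Set.finite_singleton (1 : K)) (fun v _ => ⟨x, ?_⟩) ?_ b hb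
    · rw [hsmul, chamberChar_c, if_pos rfl, one_mul]
    · refine eq_top_iff.2 fun v _ => Submodule.mem_span_singleton.2
        ⟨algebraMap _ _ (algebraMap K (SymG K w) v), ?_⟩
      rw [hsmul, chamberChar_algebraMap, AlgHom.commutes, mul_one]
      rfl
  refine ⟨psiObj 1 hN hfin, fun h0 => ?_, eq_bot_iff.2 fun f hf => ?_⟩
  · have h1 := (Submodule.eq_bot_iff _).1 h0 _ (psiOfValue hN hfin a x rfl 1).2
    have h2 : psiOfValue hN hfin a x rfl 1 = 0 := Subtype.ext h1
    have h3 := psiValue_psiOfValue hN hfin a x rfl x 1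
    rw [h2, map_zero, hsmul, chamberChar_c, if_pos rfl, one_mul] at h3
    exact zero_ne_one h3
  · have h1 := psiOfValue_psiValue hN hfin a' y rfl ⟨f, hf⟩
    have h2 := psiValue_psiOfValue hN hfin a' y rfl y (psiValue hN hfin a'.1 y ⟨f, hf⟩)
    rw [h1, hsmul, chamberChar_c, if_neg (by simp [hyx]), zero_mul] at h2
    rw [h2] at h1
    have h3 : psiOfValue hN hfin a' y rfl 0 = 0 := by
      refine Subtype.ext ?_
      change psiSingle _ (psiVec K a' y rfl 0) = 0
      rw [map_zero, map_zero]
    exact congrArg Subtype.val (h1.symm.trans h3)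

/-- An isomorphism would transport a nonzero homomorphism from `Q_a` to the separating object into
one from `Q_a'`, where there is none. -/
theorem QIso_iff {a a' : LamPt w lam} (b : Chambers p w lam → LamPt w lam)
    (hb : ∀ x, floor p (b x).1 = x.1) :
    QIso K w lam a.1 a'.1 ↔ floor p a.1 = floor p a'.1 := by
  constructor
  · rintro ⟨f, g, hgf, -⟩
    by_contra h
    obtain ⟨M, h1, h2⟩ := exists_separating (K := K) h b hb
    obtain ⟨v, hv, hv0⟩ := Submodule.exists_mem_ne_zero_of_ne_bot h1
    let φ := (homEquiv M a.1).symm ⟨v, hv⟩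
    let ψ : HomQ K w lam a'.1 M := ⟨φ.1 ∘ₗ g.toLin, by
      let _ : TopologicalSpace M.carrier := ⊥
      exact ⟨(show Continuous φ.1 from φ.2.1).comp g.cont, fun c q hq => φ.2.2 c _ (g.map_weight c q hq)⟩⟩
    have h3 : ψ = 0 := by
      refine (homEquiv M a'.1).map_eq_zero_iff.1 (Subtype.ext ?_)
      exact (Submodule.eq_bot_iff _).1 h2 _ (homEquiv M a'.1 ψ).2
    have h4 : φ.1 = ψ.1 ∘ₗ f.toLin := by
      change _ = (φ.1 ∘ₗ g.toLin) ∘ₗ f.toLin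
      rw [LinearMap.comp_assoc, hgf, LinearMap.comp_id]
    have h5 : φ = 0 := Subtype.ext (by rw [h4, h3]; rfl)
    rw [LinearEquiv.map_eq_zero_iff] at h5
    exact hv0 (congrArg Subtype.val h5)
  · exact fun h => ⟨transHom K a a', transHom K a' a, transHom_comp h, transHom_comp h.symm⟩

end Isomorphisms

end

end Hypertoric

/-! ### The theorem -/

theorem mainTheorem10 {K : Type u} [Field K] {p : ℕ} [Fact p.Prime] [CharP K p] {n k : ℕ}
    (w : Fin n → Fin k → ℤ) (hw : Submodule.span ℤ (Set.range w) = ⊤) (lam : Fin k → ℤ) :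
    (∀ (b : Hypertoric.Chambers p w lam → Fin n → ℤ)
        (hb : ∀ x, b x ∈ Hypertoric.chamber p w lam x.1),
      ∃ F : Hypertoric.WtMod K w lam ⥤ ModuleCat.{u} (Hypertoric.HAlg K p w lam),
        Nonempty (Hypertoric.IsHomFunctor K p w lam b hb F) ∧
        (∀ M, Hypertoric.atO K w lam p M →
          {x | Hypertoric.HomQ K w lam (b x) M ≠ ⊥}.Finite) ∧
        (∃ hF : ∀ M, Hypertoric.fdNil K p w lam
            (((Hypertoric.atO K w lam p).ι ⋙ F).obj M),
          ((Hypertoric.fdNil K p w lam).lift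
            ((Hypertoric.atO K w lam p).ι ⋙ F) hF).IsEquivalence) ∧
        (∃ hF : ∀ M, Hypertoric.fgNil K p w lam (F.obj M),
          ((Hypertoric.fgNil K p w lam).lift F hF).IsEquivalence)) ∧
    (∀ a a' : Fin n → ℤ, ∑ i, a i • w i = lam → ∑ i, a' i • w i = lam →
      (Hypertoric.QIso K w lam a a' ↔
        ∃ x, a ∈ Hypertoric.chamber p w lam x ∧ a' ∈ Hypertoric.chamber p w lam x)) := by
  open Hypertoric in
  refine ⟨fun b hb => ?_, fun a a' ha ha' => ?_⟩
  · have hF1 : ∀ M, fdNil K p w lam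
        (((atO K w lam p).ι ⋙ homFunctor K (ptOf b hb) (floor_ptOf b hb)).obj M) := fun M =>
      homObj_fdNil _ M.obj _ (finite_of_supportedAtO M.property)
    have hF2 : ∀ M, fgNil K p w lam ((homFunctor K (ptOf b hb) (floor_ptOf b hb)).obj M) :=
      fun M => homObj_fgNil _ _ M
    exact ⟨homFunctor K (ptOf b hb) (floor_ptOf b hb), ⟨isHomFunctor b hb⟩,
      fun M hM => finite_homQ_ne_bot (ptOf b hb) (floor_ptOf b hb) hM,
      ⟨hF1, lift_isEquivalence_of_homFunctor _ _ fdNil_le_fgNil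
        (fun _ _ e hV => supportedAtO_of_finite (finite_of_homObj_iso _ _ e hV)) hF1⟩,
      ⟨hF2, homFunctor_lift_isEquivalence _ _ hF2⟩⟩
  -- The isomorphism criterion involves no base points, so arbitrary ones are chosen to build the
  -- separating objects.
  · let b : Chambers p w lam → LamPt w lam := fun x => ⟨x.2.choose, x.2.choose_spec.1⟩
    have hb : ∀ x, floor p (b x).1 = x.1 := fun x => floor_eq_of_mem x.2.choose_spec
    have key : QIso K w lam a a' ↔ floor p a = floor p a' :=
      QIso_iff (a := ⟨a, ha⟩) (a' := ⟨a', ha'⟩) b hb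
    rw [key]
    constructor
    · intro e
      have h1 := mem_chamber_floor (p := p) (⟨a, ha⟩ : LamPt w lam)
      have h2 := mem_chamber_floor (p := p) (⟨a', ha'⟩ : LamPt w lam)
      exact ⟨floor p a, h1, e ▸ h2⟩
    · rintro ⟨x, h1, h2⟩
      rw [floor_eq_of_mem h1, floor_eq_of_mem h2]
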